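/- **Setting.** Let $k\ge 4$ be an integer, $\mathcal N$ a square-free odd positive integer, $q$ a prime dividing $\mathcal N$, and $\chi$ a Dirichlet character modulo $\mathcal N$ with $\chi^2=1$ and $\chi(-1)=(-1)^k$. Write $\chi=\chi_q\,\chi_{\mathcal N/q}$ with $\chi_q$ a character modulo $q$ and $\chi_{\mathcal N/q}$ a character modulo $\mathcal N/q$. Fix a factorization $\mathcal N/q=\mathcal N_0\mathcal N_1\mathcal N_2$ and an integer $\omega$ with $\left(\frac{\omega}{q}\right)=-1$, and put $\epsilon=\left(\frac{-1}{q}\right)$. Signs $\pm$ are identified with $\pm1$. *Eisenstein series.* For $\gamma\in Sp_2(\mathbb Z)$ (integral symplectic $4\times4$ matrices) write $\gamma=\begin{pmatrix}A_\gamma&B_\gamma\\C_\gamma&D_\gamma\end{pmatrix}$ with $2\times 2$ blocks, and let $\Gamma_0(L)=\{\gamma\in Sp_2(\mathbb Z): L\mid C_\gamma\}$. For an integral diagonal $2\times2$ matrix $M_*$ let $$\mathbb E_{M_*}(\tau)=\tfrac12\sum_{\gamma}\overline{\chi}(\det D_\gamma)\,\det(M\tau+N)^{-k},\qquad (M\ N)=(M_*\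 I)\gamma,$$ for $\tau$ in the Siegel upper half space of degree $2$, where $\gamma\in\Gamma_0(q\mathcal N)$ runs over representatives such that $SL_2(\mathbb Z)(M_*\ I)\gamma$ runs once through the $\Gamma_0(q\mathcal N)$-orbit of $SL_2(\mathbb Z)(M_*\ I)$. For integers $a,d$ let $M(a,d)$ be an integral diagonal matrix that is congruent to $\mathrm{diag}(a,d)$ modulo $q^2$ and that is congruent to $0$, $\mathrm{diag}(1,0)$, $I$ modulo every prime dividing $\mathcal N_0$, $\mathcal N_1$, $\mathcal N_2$ respectively. Put $$\mathbb E_2=\mathbb E_{M(1,1)},\quad \mathbb E_{1,2,+}=\mathbb E_{M(1,q)},\quad \mathbb E_{1,2,-}=\mathbb E_{M(1,q\omega)},\quad \mathbb E_{0,2,\pm}=\sum_{\substack{\alpha\bmod q\\ \left(\frac{\alpha}{q}\right)=\pm1}}\mathbb E_{M(q,q\alpha)},\quad \mathbb E_{0,2}=\mathbb E_{0,2,+}+\mathbb E_{0,2,-}.$$ *Twist operator.* For $\gamma=\begin{pmatrix}A&B\\C&D\end{pmatrix}\in Sp_2(\mathbb Q)$ let $(f|\gamma)(\tau)=\det(C\tau+D)^{-k}f\big((A\tau+B)(C\tau+D)^{-1}\big)$,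 and let $$f|A_1^*(q)=\sum_{G,Y}\left(\frac{y_1}{q}\right)f\Big|\begin{pmatrix}G^{-1}&Y\,{}^tG/q\\0&{}^tG\end{pmatrix},$$ where $G$ runs over representatives of $SL_2(\mathbb Z)/\{E\in SL_2(\mathbb Z):E\equiv\begin{pmatrix}*&0\\ *&*\end{pmatrix}\ (\mathrm{mod}\ q)\}$, for example matrices congruent modulo $q$ to $\begin{pmatrix}1&\alpha\\0&1\end{pmatrix}$ ($\alpha$ modulo $q$) or $\begin{pmatrix}0&-1\\1&0\end{pmatrix}$, and $Y=\begin{pmatrix}y_1&y_2\\y_2&y_4\end{pmatrix}$ runs over the symmetric integral matrices modulo $q$. **Proposition 5.23.** Suppose $\chi_q\ne1$ and let $\nu=+$ or $-$. Then the series $\mathbb E_{M(a,d)}$ converge absolutely for all integers $a,d$, and $$\mathbb E_{1,2,\nu}|A_1^*(q)=-\nu q\,\mathbb E_{1,2,\epsilon\nu}+\epsilon\chi_{\mathcal N/q}(q)\frac{q^{1-k}(q^2-1)}2\,\mathbb E_2+\chi_{\mathcal N/q}(q)\frac{q^{k+2}}2\,\mathbb E_{0,2}-\epsilon\chi_{\mathcal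 N/q}(q)\frac{q^{k+1}}2\,(\mathbb E_{0,2,+}-\mathbb E_{0,2,-}).$$ -/

import Mathlib

open Matrix
open scoped MatrixGroups

noncomputable section

namespace SiegelEis

/-- The Siegel upper half space of degree 2, as a set of complex `2 × 2` matrices. -/
def upperHalfSpace : Set (Matrix (Fin 2) (Fin 2) ℂ) :=
  {τ | τᵀ = τ ∧ (τ.map Complex.im).PosDef}

/-- `f | γ`: with `γ = (A B; C D)`,
`(f | γ)(τ) = (det γ)^(k/2) det(Cτ + D)^(-k) f((Aτ + B)(Cτ + D)⁻¹)`. -/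
def slash (k : ℕ) (f : Matrix (Fin 2) (Fin 2) ℂ → ℂ)
    (γ : Matrix (Fin 2 ⊕ Fin 2) (Fin 2 ⊕ Fin 2) ℚ) (τ : Matrix (Fin 2) (Fin 2) ℂ) : ℂ :=
  ((((γ.det : ℚ) : ℝ) ^ ((k : ℝ) / 2) : ℝ) : ℂ) *
    ((γ.toBlocks₂₁.map (Rat.cast : ℚ → ℂ) * τ + γ.toBlocks₂₂.map (Rat.cast : ℚ → ℂ)).det ^ k)⁻¹ *
    f ((γ.toBlocks₁₁.map (Rat.cast : ℚ → ℂ) * τ + γ.toBlocks₁₂.map (Rat.cast : ℚ → ℂ)) *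
      (γ.toBlocks₂₁.map (Rat.cast : ℚ → ℂ) * τ + γ.toBlocks₂₂.map (Rat.cast : ℚ → ℂ))⁻¹)

/-- `Γ₀(L)`: the `γ = (A B; C D)` in `Sp₂(ℤ)` (`4 × 4` matrices) with `L ∣ C`. -/
def Gamma0 (L : ℕ) : Type :=
  {γ : Matrix.symplecticGroup (Fin 2) ℤ //
    ∀ i j, (L : ℤ) ∣ (γ : Matrix (Fin 2 ⊕ Fin 2) (Fin 2 ⊕ Fin 2) ℤ).toBlocks₂₁ i j}

/-- The underlying `4 × 4` matrix. -/
def Gamma0.mat {L : ℕ} (γ : Gamma0 L) : Matrix (Fin 2 ⊕ Fin 2) (Fin 2 ⊕ Fin 2) ℤ :=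
  (γ.1 : Matrix (Fin 2 ⊕ Fin 2) (Fin 2 ⊕ Fin 2) ℤ)

/-- The left half `M` of `(M N) = (M₀ I) γ`. -/
def pairM {L : ℕ} (M₀ : Matrix (Fin 2) (Fin 2) ℤ) (γ : Gamma0 L) : Matrix (Fin 2) (Fin 2) ℤ :=
  M₀ * γ.mat.toBlocks₁₁ + γ.mat.toBlocks₂₁

/-- The right half `N` of `(M N) = (M₀ I) γ`. -/
def pairN {L : ℕ} (M₀ : Matrix (Fin 2) (Fin 2) ℤ) (γ : Gamma0 L) : Matrix (Fin 2) (Fin 2) ℤ :=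
  M₀ * γ.mat.toBlocks₁₂ + γ.mat.toBlocks₂₂

/-- `γ` and `γ'` are identified when `SL₂(ℤ)(M₀ I)γ = SL₂(ℤ)(M₀ I)γ'`. The quotient is the
`Γ₀(L)`-orbit of `SL₂(ℤ)(M₀ I)`. -/
def orbitSetoid (L : ℕ) (M₀ : Matrix (Fin 2) (Fin 2) ℤ) : Setoid (Gamma0 L) where
  r γ γ' := ∃ E : SL(2, ℤ),
    pairM M₀ γ' = (E : Matrix (Fin 2) (Fin 2) ℤ) * pairM M₀ γ ∧
    pairN M₀ γ' = (E : Matrix (Fin 2) (Fin 2) ℤ) * pairN M₀ γ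
  iseqv :=
    { refl := fun γ => ⟨1, by simp, by simp⟩
      symm := by
        rintro γ γ' ⟨E, h₁, h₂⟩
        have hE : ((E⁻¹ : SL(2, ℤ)) : Matrix (Fin 2) (Fin 2) ℤ) *
            (E : Matrix (Fin 2) (Fin 2) ℤ) = 1 := by
          rw [← Matrix.SpecialLinearGroup.coe_mul, inv_mul_cancel]; simp
        exact ⟨E⁻¹, by rw [h₁, ← Matrix.mul_assoc, hE, Matrix.one_mul],
          by rw [h₂, ← Matrix.mul_assoc, hE, Matrix.one_mul]⟩
      trans := by
        rintro γ γ' γ'' ⟨E, h₁, h₂⟩ ⟨F, h₃, h₄⟩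
        exact ⟨F * E, by rw [h₃, h₁, Matrix.SpecialLinearGroup.coe_mul, Matrix.mul_assoc],
          by rw [h₄, h₂, Matrix.SpecialLinearGroup.coe_mul, Matrix.mul_assoc]⟩ }

/-- The Eisenstein summand `conj χ(det D_γ) · det(Mτ + N)^(-k)`, where `(M N) = (M₀ I) γ`. -/
def eisTerm {N L : ℕ} (k : ℕ) (χ : DirichletCharacter ℂ N) (M₀ : Matrix (Fin 2) (Fin 2) ℤ)
    (τ : Matrix (Fin 2) (Fin 2) ℂ) (γ : Gamma0 L) : ℂ :=
  (starRingEnd ℂ) (χ ((γ.mat.toBlocks₂₂.det : ℤ) : ZMod N)) *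
    (((pairM M₀ γ).map (Int.cast : ℤ → ℂ) * τ + (pairN M₀ γ).map (Int.cast : ℤ → ℂ)).det ^ k)⁻¹

/-- The family of summands of `2𝔼` at `τ`: one for each `SL₂(ℤ)`-class in the `Γ₀(L)`-orbit of
`SL₂(ℤ)(M₀ I)`. -/
def eisFamily {N : ℕ} (k : ℕ) (χ : DirichletCharacter ℂ N) (L : ℕ)
    (M₀ : Matrix (Fin 2) (Fin 2) ℤ) (τ : Matrix (Fin 2) (Fin 2) ℂ)
    (c : Quotient (orbitSetoid L M₀)) : ℂ :=
  eisTerm k χ M₀ τ c.out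

/-- The weight `k`, level `L`, character `χ` Eisenstein series `𝔼` for which `2𝔼` is supported on
the `Γ₀(L)`-orbit of `SL₂(ℤ)(M₀ I)`. -/
def eisenstein {N : ℕ} (k : ℕ) (χ : DirichletCharacter ℂ N) (L : ℕ)
    (M₀ : Matrix (Fin 2) (Fin 2) ℤ) (τ : Matrix (Fin 2) (Fin 2) ℂ) : ℂ :=
  (1 / 2) * ∑' c : Quotient (orbitSetoid L M₀), eisFamily k χ L M₀ τ c

/-- `M₀` is an integral diagonal matrix, congruent to `diag(a, d)` modulo `q²` and, modulo each
prime `p` dividing `N₀`, `N₁`, `N₂`, to `0`, `diag(1, 0)`, `I` respectively. -/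
def IsTypeMatrix (q N₀ N₁ N₂ : ℕ) (a d : ℤ) (M₀ : Matrix (Fin 2) (Fin 2) ℤ) : Prop :=
  ∃ x y : ℤ, M₀ = Matrix.diagonal ![x, y] ∧
    (x ≡ a [ZMOD (q : ℤ) ^ 2] ∧ y ≡ d [ZMOD (q : ℤ) ^ 2]) ∧
    (∀ p : ℕ, p.Prime → p ∣ N₀ → x ≡ 0 [ZMOD p] ∧ y ≡ 0 [ZMOD p]) ∧
    (∀ p : ℕ, p.Prime → p ∣ N₁ → x ≡ 1 [ZMOD p] ∧ y ≡ 0 [ZMOD p]) ∧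
    (∀ p : ℕ, p.Prime → p ∣ N₂ → x ≡ 1 [ZMOD p] ∧ y ≡ 1 [ZMOD p])

/-! Below, `M a d` stands for a diagonal matrix that is `diag(a, d)` modulo `q²` and of the fixed
type modulo `N / q`. -/

/-- `𝔼₂`, of level `qN`. -/
def E2 {N : ℕ} (k : ℕ) (χ : DirichletCharacter ℂ N) (q : ℕ)
    (M : ℤ → ℤ → Matrix (Fin 2) (Fin 2) ℤ) (τ : Matrix (Fin 2) (Fin 2) ℂ) : ℂ :=
  eisenstein k χ (q * N) (M 1 1) τ

/-- `𝔼_{1,2,s}` for a sign `s = ±1`: the matrix is `diag(1, q)` modulo `q²` if `s = 1`, and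
`diag(1, qω)` if `s = -1`. -/
def E12 {N : ℕ} (k : ℕ) (χ : DirichletCharacter ℂ N) (q : ℕ)
    (M : ℤ → ℤ → Matrix (Fin 2) (Fin 2) ℤ) (ω s : ℤ) (τ : Matrix (Fin 2) (Fin 2) ℂ) : ℂ :=
  eisenstein k χ (q * N) (M 1 (if s = 1 then (q : ℤ) else (q : ℤ) * ω)) τ

/-- `𝔼_{0,2,α}`: the matrix is `diag(q, qα)` modulo `q²`. -/
def E02at {N : ℕ} (k : ℕ) (χ : DirichletCharacter ℂ N) (q : ℕ)
    (M : ℤ → ℤ → Matrix (Fin 2) (Fin 2) ℤ) (α : ℕ) (τ : Matrix (Fin 2) (Fin 2) ℂ) : ℂ :=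
  eisenstein k χ (q * N) (M (q : ℤ) ((q : ℤ) * (α : ℤ))) τ

/-- `𝔼_{0,2,s} = ∑ 𝔼_{0,2,α}` for a sign `s = ±1`, over the classes `α` modulo `q` with
`(α/q) = s`. -/
def E02 {N : ℕ} (k : ℕ) (χ : DirichletCharacter ℂ N) (q : ℕ) [Fact q.Prime]
    (M : ℤ → ℤ → Matrix (Fin 2) (Fin 2) ℤ) (s : ℤ) (τ : Matrix (Fin 2) (Fin 2) ℂ) : ℂ :=
  ∑ α ∈ (Finset.range q).filter (fun α : ℕ => legendreSym q (α : ℤ) = s), E02at k χ q M α τ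

/-- `𝒢` represents `SL₂(ℤ)` modulo right multiplication by the `E ∈ SL₂(ℤ)` with
`E ≡ (* 0; * *) (mod q)`. -/
def IsCosetReps (q : ℕ) (𝒢 : Finset SL(2, ℤ)) : Prop :=
  ∀ H : SL(2, ℤ), ∃! G : SL(2, ℤ), G ∈ 𝒢 ∧ (q : ℤ) ∣ (G⁻¹ * H : SL(2, ℤ)) 0 1

/-- `𝒴` represents the symmetric integral `2 × 2` matrices modulo `q`. -/
def IsSymmReps (q : ℕ) (𝒴 : Finset (Matrix (Fin 2) (Fin 2) ℤ)) : Prop :=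
  (∀ Y ∈ 𝒴, Yᵀ = Y) ∧
    ∀ S : Matrix (Fin 2) (Fin 2) ℤ, Sᵀ = S →
      ∃! Y : Matrix (Fin 2) (Fin 2) ℤ, Y ∈ 𝒴 ∧ ∀ i j, Y i j ≡ S i j [ZMOD q]

/-- The matrix `(G⁻¹, Y ᵗG / q; 0, ᵗG)`. -/
def twistMatrix (q : ℕ) (G : SL(2, ℤ)) (Y : Matrix (Fin 2) (Fin 2) ℤ) :
    Matrix (Fin 2 ⊕ Fin 2) (Fin 2 ⊕ Fin 2) ℚ :=
  Matrix.fromBlocks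
    (((G⁻¹ : SL(2, ℤ)) : Matrix (Fin 2) (Fin 2) ℤ).map (Int.cast : ℤ → ℚ))
    ((1 / (q : ℚ)) • (Y * (G : Matrix (Fin 2) (Fin 2) ℤ)ᵀ).map (Int.cast : ℤ → ℚ))
    0
    ((G : Matrix (Fin 2) (Fin 2) ℤ)ᵀ.map (Int.cast : ℤ → ℚ))

/-- The twist operator `f | A₁*(q) = ∑_{G,Y} (y₁/q) f | (G⁻¹, Y ᵗG / q; 0, ᵗG)`, where `y₁` is
the top left entry of `Y`, computed with the representatives `G ∈ 𝒢` and `Y ∈ 𝒴`. -/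
def A1star (k q : ℕ) [Fact q.Prime] (𝒢 : Finset SL(2, ℤ))
    (𝒴 : Finset (Matrix (Fin 2) (Fin 2) ℤ)) (f : Matrix (Fin 2) (Fin 2) ℂ → ℂ)
    (τ : Matrix (Fin 2) (Fin 2) ℂ) : ℂ :=
  ∑ G ∈ 𝒢, ∑ Y ∈ 𝒴, ((legendreSym q (Y 0 0) : ℤ) : ℂ) * slash k f (twistMatrix q G Y) τ

end SiegelEis

end

/-!
The proof compares both sides coefficient by coefficient, after rewriting every Eisenstein series as
an absolutely convergent sum over the rational symmetric `2 × 2` matrices `S`.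

*Convergence.* The Plücker coordinates embed the `SL₂(ℤ)`-classes of primitive symmetric pairs
`(M N)` into the integral points of the cone `xy = ac - b²`, on which `|det(Mτ + N)|` is bounded
below by a multiple of the height (`pluckerForm_bound`). The divisor bound shows that the sum of
`height⁻⁴` over these points converges (`summable_size`); this gives `summable_eisFamily`.

*Coefficients.* For the types that occur, `det M ≠ 0` throughout the orbit, and a class is determined
by its slope `S = M⁻¹N` and the sign of `det M`, the two signs contributing the same because
`χ(-1) = (-1)^k`. Hence `𝔼(τ) = ∑ wt(S) det(τ + S)^(-k)` (`eisenstein_eq_tsum`), where `wt(S)` is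
`χ(det D_γ) det(M)^(-k)` if `(M N)` lies in the orbit, and zero otherwise. A term of the twist
operator shifts the argument of `wt` by `G Y ᵗG / q` (`slash_eisenstein`).

*Localization.* By strong approximation for `SL₂` and the Chinese remainder theorem, a primitive pair
lies in the orbit if and only if it does so modulo `q²` and modulo `N / q`, and since the matrix that
defines the orbit is a diagonal idempotent modulo `N` the quadratic character `χ` takes a well
defined value (`exists_inOrbit`, `OrbitRep.det_eq_sq_mul`). Write `S = M⁻¹N + Z / q` with `M⁻¹N`
integral at `q`; the slopes that are not of this form have coefficient zero in all the series. Then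
each coefficient is a factor common to all the series times a function of the symmetric matrix `Z`
modulo `q`: the types `diag(1, 1)`, `diag(1, qa)`, `diag(q, qα)` see, respectively, `Z = 0`, `Z` of
rank one in the class of `a`, and `Z` invertible with `det(M)² det(Z) = α` (`CharSplit.wt_rankZero`,
`CharSplit.wt_rankOne`, `CharSplit.wt_rankTwo`).

*Character sums.* The representatives `G` run over the projective line modulo `q` and `y₁` becomes
the value of a binary quadratic form at the first row of `G⁻¹`. What is left is an identity of
quadratic character sums over symmetric `2 × 2` matrices over the field with `q` elements
(`sum_twist`), which is summed by completing the square. The rank of `Z` accounts for the four terms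
on the right hand side: rank one gives `𝔼_{1,2}`, rank zero `𝔼₂`, and rank two the two combinations
of `𝔼_{0,2,±}`.
-/

namespace SiegelEis

/-! ### Integral points on a quadric cone, by height -/

/-- The divisor bound `d(n) ≪ n^(1/3)`. Only the primes below `8` have `(e + 1)³ > p^e` for some `e`,
and each of them costs a factor of at most `64`. -/
theorem card_divisors_cube_le (n : ℕ) : n.divisors.card ^ 3 ≤ 2 ^ 48 * n := by
  rcases eq_or_ne n 0 with rfl | hn
  · simp
  have key : ∀ p ∈ n.primeFactors, (n.factorization p + 1) ^ 3 ≤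
      (if p < 8 then 64 else 1) * p ^ n.factorization p := by
    intro p hp
    have hp2 : 2 ≤ p := (Nat.prime_of_mem_primeFactors hp).two_le
    generalize n.factorization p = e
    split_ifs with h
    · have h1 : (e + 1) ^ 3 ≤ 64 * 2 ^ e := by
        induction e with
        | zero => norm_num
        | succ e ih =>
          rcases Nat.lt_or_ge e 3 with h3 | h3
          · interval_cases e <;> norm_num
          · have : (e + 1 + 1) ^ 3 ≤ 2 * (e + 1) ^ 3 := by nlinarith [sq_nonneg (e : ℤ)]
            rw [pow_succ 2 e]; omega
      exact h1.trans (Nat.mul_le_mul_left _ (Nat.pow_le_pow_left hp2 e))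
    · have h1 : (e + 1) ^ 3 ≤ 8 ^ e := by
        have : e + 1 ≤ 2 ^ e := Nat.lt_two_pow_self
        calc (e + 1) ^ 3 ≤ (2 ^ e) ^ 3 := Nat.pow_le_pow_left this 3
          _ = 8 ^ e := by rw [← pow_mul, mul_comm, pow_mul]; norm_num
      rw [one_mul]
      exact h1.trans (Nat.pow_le_pow_left (by omega) e)
  rw [Nat.card_divisors hn, ← Finset.prod_pow]
  refine (Finset.prod_le_prod' key).trans ?_
  rw [Finset.prod_mul_distrib]
  have h2 : ∏ p ∈ n.primeFactors, p ^ n.factorization p = n := by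
    conv_rhs => rw [← Nat.prod_factorization_pow_eq_self hn]
    rfl
  rw [h2, Finset.prod_ite, Finset.prod_const, Finset.prod_const_one, mul_one]
  refine Nat.mul_le_mul_right _ ?_
  have h3 : (n.primeFactors.filter (· < 8)).card ≤ 8 := by
    calc _ ≤ (Finset.range 8).card := Finset.card_le_card (fun p hp => by
            simpa using (Finset.mem_filter.1 hp).2)
      _ = 8 := by simp
  calc 64 ^ _ ≤ 64 ^ 8 := Nat.pow_le_pow_right (by norm_num) h3
    _ = 2 ^ 48 := by norm_num

theorem summable_one_add_abs_rpow {s : ℝ} (hs : 1 < s) :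
    Summable (fun n : ℤ => (1 + |(n : ℝ)|) ^ (-s)) := by
  have h : Summable (fun n : ℕ => (1 + |((n : ℤ) : ℝ)|) ^ (-s)) := by
    have := (Real.summable_one_div_nat_add_rpow 1 s).2 hs
    refine this.congr (fun n => ?_)
    have h0 : (0 : ℝ) ≤ n := n.cast_nonneg
    rw [Int.cast_natCast, abs_of_nonneg h0, abs_of_nonneg (by linarith), Real.rpow_neg (by linarith),
      one_div, add_comm]
  refine Summable.of_nat_of_neg h ?_
  simpa using h

/-- The product majorant on `ℤ³`. -/
theorem summable_prod_three {s : ℝ} (hs : 1 < s) :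
    Summable (fun v : ℤ × ℤ × ℤ => (1 + |(v.1 : ℝ)|) ^ (-s) *
      ((1 + |(v.2.1 : ℝ)|) ^ (-s) * (1 + |(v.2.2 : ℝ)|) ^ (-s))) := by
  have h := summable_one_add_abs_rpow hs
  have h0 : ∀ n : ℤ, 0 ≤ (1 + |(n : ℝ)|) ^ (-s) := fun n => by positivity
  have h2 := h.mul_of_nonneg h h0 h0
  exact h.mul_of_nonneg h2 h0 (fun v => mul_nonneg (h0 _) (h0 _))

theorem rpow_neg_le_prod_three {H t : ℝ} (ht : 0 ≤ t) {a b c : ℤ} (ha : 1 + |(a : ℝ)| ≤ H)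
    (hb : 1 + |(b : ℝ)| ≤ H) (hc : 1 + |(c : ℝ)| ≤ H) :
    H ^ (-(3 * t)) ≤ (1 + |(a : ℝ)|) ^ (-t) *
      ((1 + |(b : ℝ)|) ^ (-t) * (1 + |(c : ℝ)|) ^ (-t)) := by
  have pos : ∀ n : ℤ, 0 < 1 + |(n : ℝ)| := fun n => by positivity
  have hH : 0 < H := (pos a).trans_le ha
  have e : H ^ (-(3 * t)) = H ^ (-t) * (H ^ (-t) * H ^ (-t)) := by
    rw [← Real.rpow_add hH, ← Real.rpow_add hH]; ring_nf
  rw [e]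
  have m : ∀ n : ℤ, 1 + |(n : ℝ)| ≤ H → H ^ (-t) ≤ (1 + |(n : ℝ)|) ^ (-t) := fun n hn =>
    Real.rpow_le_rpow_of_nonpos (pos n) hn (by linarith)
  have p : ∀ n : ℤ, 0 ≤ (1 + |(n : ℝ)|) ^ (-t) := fun n => by positivity
  exact mul_le_mul (m a ha) (mul_le_mul (m b hb) (m c hc) (by positivity) (p b)) (by positivity) (p a)

/-- The number of factorizations `n = xy` over `ℤ`, through the divisor bound; `17 = 48 / 3 + 1`, the
last factor two accounting for the signs. -/
theorem card_int_factorizations_le {n : ℤ} {H : ℝ} (hH : 1 ≤ H) (hn : |(n : ℝ)| ≤ H ^ 2) :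
    (n.divisorsAntidiag.card : ℝ) ≤ 2 ^ 17 * H ^ ((2 : ℝ) / 3) := by
  have hc : n.divisorsAntidiag.card ≤ 2 * n.natAbs.divisors.card := by
    have h1 : n.natAbs.divisorsAntidiagonal.card = n.natAbs.divisors.card := by
      rw [← Nat.map_div_right_divisors, Finset.card_map]
    rcases n with n | n
    · simp only [Int.divisorsAntidiag, Finset.card_disjUnion, Finset.card_map]
      simp at h1 ⊢
      omega
    · simp only [Int.divisorsAntidiag, Finset.card_disjUnion, Finset.card_map]
      simp at h1 ⊢
      omega
  have h3 := card_divisors_cube_le n.natAbs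
  set d := n.natAbs.divisors.card
  have h4 : (d : ℝ) ^ 3 ≤ (2 ^ 16 * H ^ ((2 : ℝ) / 3)) ^ 3 := by
    have h5 : (H ^ ((2 : ℝ) / 3)) ^ 3 = H ^ 2 := by
      rw [← Real.rpow_natCast, ← Real.rpow_mul (by linarith), ← Real.rpow_natCast]; norm_num
    rw [mul_pow, h5]
    have h6 : ((d ^ 3 : ℕ) : ℝ) ≤ ((2 ^ 48 * n.natAbs : ℕ) : ℝ) := by exact_mod_cast h3
    push_cast [Nat.cast_natAbs] at h6
    nlinarith
  have h5 : (d : ℝ) ≤ 2 ^ 16 * H ^ ((2 : ℝ) / 3) :=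
    le_of_pow_le_pow_left₀ (by norm_num) (by positivity) h4
  have h6 : (n.divisorsAntidiag.card : ℝ) ≤ 2 * d := by exact_mod_cast hc
  linarith

/-- Integral points `(x, y, a, b, c)` of the cone `xy = ac - b²`. -/
abbrev NullCone : Type := {p : ℤ × ℤ × ℤ × ℤ × ℤ //
  p.1 * p.2.1 = p.2.2.1 * p.2.2.2.2 - p.2.2.2.1 ^ 2}

/-- The size `1 + |x| + |y| + |a| + |b| + |c|`. -/
def size (p : ℤ × ℤ × ℤ × ℤ × ℤ) : ℝ :=
  1 + |(p.1 : ℝ)| + |(p.2.1 : ℝ)| + |(p.2.2.1 : ℝ)| + |(p.2.2.2.1 : ℝ)| + |(p.2.2.2.2 : ℝ)|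

theorem size_pos (p) : 0 < size p := by unfold size; positivity

/-- Given `(a, b, c)` with `ac ≠ b²` there are `≪ H^(2/3)` points on the cone, where `H` is the
height of `(a, b, c)`. As `4 - 2/3 = 3 · 10/9`, the product majorant of exponent `10/9 > 1` applies. -/
theorem summable_size_nondegenerate :
    Summable (fun p : {p : NullCone // p.1.1 * p.1.2.1 ≠ 0} => (size p.1.1 ^ 4)⁻¹) := by
  classical
  -- the sum over all `((a, b, c), (x, y))`, extended by zero
  let g : (ℤ × ℤ × ℤ) × (ℤ × ℤ) → ℝ := fun v =>
    if v.2 ∈ (v.1.1 * v.1.2.2 - v.1.2.1 ^ 2).divisorsAntidiag then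
      ((1 + |(v.1.1 : ℝ)| + |(v.1.2.1 : ℝ)| + |(v.1.2.2 : ℝ)|) ^ 4)⁻¹ else 0
  have g0 : 0 ≤ g := fun v => by
    simp only [g, Pi.zero_apply]; split_ifs
    · positivity
    · exact le_rfl
  have hsum : ∀ v : ℤ × ℤ × ℤ, HasSum (fun w => g (v, w))
      ((v.1 * v.2.2 - v.2.1 ^ 2).divisorsAntidiag.card •
        ((1 + |(v.1 : ℝ)| + |(v.2.1 : ℝ)| + |(v.2.2 : ℝ)|) ^ 4)⁻¹) := by
    intro v
    rw [← Finset.sum_const]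
    have : HasSum (fun w => g (v, w)) (∑ w ∈ (v.1 * v.2.2 - v.2.1 ^ 2).divisorsAntidiag, g (v, w)) :=
      hasSum_sum_of_ne_finset_zero (fun w hw => by simp only [g, if_neg hw])
    convert this using 1
    exact Finset.sum_congr rfl (fun w hw => by simp only [g, if_pos hw])
  have hg : Summable g := by
    rw [summable_prod_of_nonneg g0]
    refine ⟨fun v => (hsum v).summable, ?_⟩
    refine Summable.of_nonneg_of_le (fun v => tsum_nonneg (fun w => g0 _)) (fun v => ?_)
      ((summable_prod_three (s := 10 / 9) (by norm_num)).mul_left (2 ^ 17))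
    rw [(hsum v).tsum_eq, nsmul_eq_mul]
    obtain ⟨a, b, c⟩ := v
    simp only
    set H : ℝ := 1 + |(a : ℝ)| + |(b : ℝ)| + |(c : ℝ)| with hHdef
    have ha := abs_nonneg (a : ℝ)
    have hb := abs_nonneg (b : ℝ)
    have hc := abs_nonneg (c : ℝ)
    have hH : 1 ≤ H := by linarith
    have h1 := card_int_factorizations_le (n := a * c - b ^ 2) hH (by
      push_cast
      calc |(a : ℝ) * c - b ^ 2| ≤ |(a : ℝ) * c| + |(b : ℝ) ^ 2| := abs_sub _ _
        _ = |(a : ℝ)| * |(c : ℝ)| + |(b : ℝ)| ^ 2 := by rw [abs_mul, abs_pow]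
        _ ≤ H ^ 2 := by rw [hHdef]; nlinarith [mul_nonneg ha hb, mul_nonneg ha hc, mul_nonneg hb hc])
    have h2 := rpow_neg_le_prod_three (H := H) (t := 10 / 9) (by norm_num) (a := a) (b := b) (c := c)
      (by linarith) (by linarith) (by linarith)
    refine le_trans ?_ (mul_le_mul_of_nonneg_left h2 (by norm_num))
    calc _ ≤ 2 ^ 17 * H ^ ((2 : ℝ) / 3) * (H ^ 4)⁻¹ := by gcongr
      _ = _ := by
        rw [mul_assoc, ← Real.rpow_natCast H 4, ← Real.rpow_neg (by linarith),
          ← Real.rpow_add (by linarith)]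
        norm_num
  let i : {p : NullCone // p.1.1 * p.1.2.1 ≠ 0} → (ℤ × ℤ × ℤ) × (ℤ × ℤ) :=
    fun p => (p.1.1.2.2, (p.1.1.1, p.1.1.2.1))
  have hi : Function.Injective i := by
    rintro ⟨⟨⟨x, y, v⟩, h⟩, h'⟩ ⟨⟨⟨x', y', v'⟩, k⟩, k'⟩ e
    simp only [i, Prod.mk.injEq] at e
    obtain ⟨rfl, rfl, rfl⟩ := e
    rfl
  refine Summable.of_nonneg_of_le (fun p => by have := size_pos p.1.1; positivity) (fun p => ?_)
    (hg.comp_injective hi)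
  obtain ⟨⟨⟨x, y, a, b, c⟩, h⟩, h'⟩ := p
  simp only at h h'
  have hm : (x, y) ∈ (a * c - b ^ 2).divisorsAntidiag := by
    rw [Int.mem_divisorsAntidiag]; exact ⟨h, h ▸ h'⟩
  simp only [Function.comp, i, g, if_pos hm, size]
  gcongr
  have := abs_nonneg (x : ℝ)
  have := abs_nonneg (y : ℝ)
  linarith

/-- A point with `xy = 0` is determined by `(x + y, a, c)` up to finitely many choices, as then
`b² = ac`; the product majorant has exponent `4/3`. -/
theorem summable_size_degenerate :
    Summable (fun p : {p : NullCone // p.1.1 * p.1.2.1 = 0} => (size p.1.1 ^ 4)⁻¹) := by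
  classical
  have h := summable_prod_three (s := 4 / 3) (by norm_num)
  have hB : Summable (fun _ : Bool × Bool => (1 : ℝ)) := (hasSum_fintype _).summable
  have hg := h.mul_of_nonneg hB (fun v => by simp only [Pi.zero_apply]; positivity)
    (fun _ => by simp)
  let i : {p : NullCone // p.1.1 * p.1.2.1 = 0} → (ℤ × ℤ × ℤ) × (Bool × Bool) := fun p =>
    ((p.1.1.1 + p.1.1.2.1, p.1.1.2.2.1, p.1.1.2.2.2.2), (decide (p.1.1.1 = 0),
      decide (0 ≤ p.1.1.2.2.2.1)))
  have hi : Function.Injective i := by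
    rintro ⟨⟨⟨x, y, a, b, c⟩, h⟩, h'⟩ ⟨⟨⟨x', y', a', b', c'⟩, k⟩, k'⟩ e
    simp only at h h' k k'
    simp only [i, Prod.mk.injEq, decide_eq_decide] at e
    obtain ⟨⟨e1, rfl, rfl⟩, e4, e5⟩ := e
    have hb : b = b' := by
      have hsq : b ^ 2 = b' ^ 2 := by linarith
      rcases sq_eq_sq_iff_eq_or_eq_neg.1 hsq with hh | hh
      · exact hh
      · omega
    have hx : x = x' ∧ y = y' := by
      rcases mul_eq_zero.1 h' with hh | hh <;> rcases mul_eq_zero.1 k' with kk | kk <;> omega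
    simp [hb, hx.1, hx.2]
  refine Summable.of_nonneg_of_le (fun p => by have := size_pos p.1.1; positivity) (fun p => ?_)
    (hg.comp_injective hi)
  obtain ⟨⟨⟨x, y, a, b, c⟩, h⟩, h'⟩ := p
  simp only [Function.comp, i, mul_one]
  have hx := abs_nonneg (x : ℝ)
  have hy := abs_nonneg (y : ℝ)
  have ha := abs_nonneg (a : ℝ)
  have hb := abs_nonneg (b : ℝ)
  have hc := abs_nonneg (c : ℝ)
  have e : (size (x, y, a, b, c) ^ 4)⁻¹ = size (x, y, a, b, c) ^ (-(3 * (4 / 3 : ℝ))) := by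
    rw [← Real.rpow_natCast, ← Real.rpow_neg (size_pos _).le]; norm_num
  rw [e]
  refine rpow_neg_le_prod_three (by norm_num) ?_ ?_ ?_
  · have : |((x + y : ℤ) : ℝ)| ≤ |(x : ℝ)| + |(y : ℝ)| := by push_cast; exact abs_add_le _ _
    simp only [size]; linarith
  · simp only [size]; linarith
  · simp only [size]; linarith

/-- The sum of `size⁻⁴` over the integral points of the null cone converges; this is where the weight
bound `k ≥ 4` comes from. -/
theorem summable_size : Summable (fun p : NullCone => (size p.1 ^ 4)⁻¹) := by
  have h1 := summable_size_nondegenerate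
  have h2 := summable_size_degenerate
  have e : {p : NullCone | p.1.1 * p.1.2.1 = 0}ᶜ = {p : NullCone | p.1.1 * p.1.2.1 ≠ 0} := rfl
  exact (summable_subtype_and_compl (s := {p : NullCone | p.1.1 * p.1.2.1 = 0})).1 ⟨h2, h1⟩

/-! ### A lower bound for the automorphy factor on the null cone -/

theorem abs_le_of_sq_mul_le {t d F : ℝ} (hd : 0 < d) (hF : 0 ≤ F) (h : d * t ^ 2 ≤ F ^ 2) :
    |t| ≤ (Real.sqrt d)⁻¹ * F := by
  have hs : 0 < Real.sqrt d := Real.sqrt_pos.2 hd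
  rw [inv_mul_eq_div, le_div_iff₀ hs]
  refine le_of_pow_le_pow_left₀ two_ne_zero hF ?_
  rw [mul_pow, sq_abs, Real.sq_sqrt hd.le]
  linarith

/-- The linear form `p ↦ det(Mτ + N)` in the Plücker coordinates of `(M N)`. -/
def pluckerForm (τ : Matrix (Fin 2) (Fin 2) ℂ) (x y a b c : ℝ) : ℂ :=
  x * τ.det + c * τ 0 0 + a * τ 1 1 - 2 * b * τ 0 1 + y

/-- On the real null cone `xy = ac - b²` the form `det(Mτ + N)` is bounded below by a multiple of the
norm of the coordinates: its squared modulus is there a positive definite sum of five squares. -/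
theorem pluckerForm_bound {τ : Matrix (Fin 2) (Fin 2) ℂ} (hτ : τ ∈ upperHalfSpace) :
    ∃ K : ℝ, 0 < K ∧ ∀ x y a b c : ℝ, x * y = a * c - b ^ 2 →
      |x| + |y| + |a| + |b| + |c| ≤ K * ‖pluckerForm τ x y a b c‖ := by
  obtain ⟨hs, hp⟩ := hτ
  have hsym : τ 1 0 = τ 0 1 := congr_fun (congr_fun hs 0) 1
  obtain ⟨X1, Y1, e1⟩ : ∃ X Y : ℝ, τ 0 0 = ⟨X, Y⟩ := ⟨_, _, rfl⟩
  obtain ⟨X2, Y2, e2⟩ : ∃ X Y : ℝ, τ 0 1 = ⟨X, Y⟩ := ⟨_, _, rfl⟩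
  obtain ⟨X3, Y3, e3⟩ : ∃ X Y : ℝ, τ 1 1 = ⟨X, Y⟩ := ⟨_, _, rfl⟩
  have hY1 : 0 < Y1 := by
    have := hp.diag_pos (i := 0)
    simpa [e1] using this
  have hD : 0 < Y1 * Y3 - Y2 ^ 2 := by
    have := hp.det_pos
    rw [Matrix.det_fin_two] at this
    simp only [Matrix.map_apply, hsym, e1, e2, e3] at this
    nlinarith
  set D := Y1 * Y3 - Y2 ^ 2 with hDdef
  set s := Y2 / Y1 with hsdef
  have hs1 : s * Y1 = Y2 := by rw [hsdef]; field_simp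
  clear_value s
  -- the square of the modulus is a sum of squares
  have key : ∀ x y a b c : ℝ, x * y = a * c - b ^ 2 →
      ‖pluckerForm τ x y a b c‖ ^ 2 =
        (x * (X1 * X3 - X2 ^ 2) + a * X3 - 2 * b * X2 + c * X1 + y) ^ 2 + D ^ 2 * x ^ 2
        + (D / Y1) ^ 2 * (a + x * X1) ^ 2
        + Y1 ^ 2 * ((c + x * X3) - 2 * s * (b + x * X2) + s ^ 2 * (a + x * X1)) ^ 2
        + 2 * D * ((b + x * X2) - s * (a + x * X1)) ^ 2 := by
    intro x y a b c h
    have hY3 : Y3 = D / Y1 + s ^ 2 * Y1 := by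
      field_simp
      rw [hDdef, ← hs1]; ring
    have eR : (pluckerForm τ x y a b c).re =
        (x * (X1 * X3 - X2 ^ 2) + a * X3 - 2 * b * X2 + c * X1 + y) - x * D := by
      simp only [pluckerForm, Matrix.det_fin_two, hsym, e1, e2, e3]
      simp
      rw [hDdef]; ring
    have eI : (pluckerForm τ x y a b c).im =
        (D / Y1) * (a + x * X1) +
          Y1 * ((c + x * X3) - 2 * s * (b + x * X2) + s ^ 2 * (a + x * X1)) := by
      simp only [pluckerForm, Matrix.det_fin_two, hsym, e1, e2, e3]
      simp
      rw [hY3, ← hs1]; ring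
    rw [← Complex.normSq_eq_norm_sq, Complex.normSq_apply, eR, eI]
    have hE : D / Y1 * Y1 = D := by field_simp
    generalize D / Y1 = E at *
    rw [← hE]
    linear_combination (-2 * (E * Y1)) * h
  clear_value D
  set K1 := (Real.sqrt (D ^ 2))⁻¹
  set K2 := (Real.sqrt ((D / Y1) ^ 2))⁻¹
  set K3 := (Real.sqrt (Y1 ^ 2))⁻¹
  set K4 := (Real.sqrt (2 * D))⁻¹
  have hK1 : 0 ≤ K1 := by positivity
  have hK2 : 0 ≤ K2 := by positivity
  have hK3 : 0 ≤ K3 := by positivity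
  have hK4 : 0 ≤ K4 := by positivity
  -- successive bounds for the coordinates
  set L1 := K2 + |X1| * K1
  set L2 := K4 + |s| * K2 + |X2| * K1
  set L3 := K3 + 2 * |s| * (K4 + |s| * K2) + |s| ^ 2 * K2 + |X3| * K1
  refine ⟨K1 + (1 + |X1 * X3 - X2 ^ 2| * K1 + |X3| * L1 + 2 * |X2| * L2 + |X1| * L3) + L1 + L2 + L3,
    by positivity, ?_⟩
  intro x y a b c h
  have hk := key x y a b c h
  set F := ‖pluckerForm τ x y a b c‖
  have hF : 0 ≤ F := norm_nonneg _
  set y' := x * (X1 * X3 - X2 ^ 2) + a * X3 - 2 * b * X2 + c * X1 + y with hy'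
  set A := a + x * X1 with hA
  set C := (c + x * X3) - 2 * s * (b + x * X2) + s ^ 2 * A with hC
  set B := (b + x * X2) - s * A with hB
  have p1 : 0 ≤ D ^ 2 * x ^ 2 := by positivity
  have p2 : 0 ≤ (D / Y1) ^ 2 * A ^ 2 := by positivity
  have p3 : 0 ≤ Y1 ^ 2 * C ^ 2 := by positivity
  have p4 : 0 ≤ 2 * D * B ^ 2 := by positivity
  have p5 : 0 ≤ y' ^ 2 := by positivity
  have b1 : |x| ≤ K1 * F := abs_le_of_sq_mul_le (by positivity) hF (by linarith)
  have b2 : |A| ≤ K2 * F := abs_le_of_sq_mul_le (by positivity) hF (by linarith)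
  have b3 : |C| ≤ K3 * F := abs_le_of_sq_mul_le (by positivity) hF (by linarith)
  have b4 : |B| ≤ K4 * F := abs_le_of_sq_mul_le (by positivity) hF (by linarith)
  have b5 : |y'| ≤ F := abs_le_of_sq_le_sq (by linarith) hF
  have c1 : |a| ≤ L1 * F := by
    have e : a = A - X1 * x := by rw [hA]; ring
    calc |a| ≤ |A| + |X1 * x| := by rw [e]; exact abs_sub _ _
      _ ≤ K2 * F + |X1| * (K1 * F) := by rw [abs_mul]; gcongr
      _ = L1 * F := by ring
  have cB : |b + x * X2| ≤ (K4 + |s| * K2) * F := by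
    have e : b + x * X2 = B + s * A := by rw [hB]; ring
    calc |b + x * X2| ≤ |B| + |s * A| := by rw [e]; exact abs_add_le _ _
      _ ≤ K4 * F + |s| * (K2 * F) := by rw [abs_mul]; gcongr
      _ = _ := by ring
  have c2 : |b| ≤ L2 * F := by
    have e : b = (b + x * X2) - X2 * x := by ring
    calc |b| ≤ |b + x * X2| + |X2 * x| := by
            conv_lhs => rw [e]
            exact abs_sub _ _
      _ ≤ (K4 + |s| * K2) * F + |X2| * (K1 * F) := by rw [abs_mul]; gcongr
      _ = L2 * F := by ring
  have c3 : |c| ≤ L3 * F := by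
    have e : c = C + 2 * s * (b + x * X2) - s ^ 2 * A - X3 * x := by rw [hC]; ring
    calc |c| ≤ |C| + |2 * s * (b + x * X2)| + |s ^ 2 * A| + |X3 * x| := by
            conv_lhs => rw [e]
            exact (abs_sub _ _).trans (add_le_add_left ((abs_sub _ _).trans
              (add_le_add_left (abs_add_le _ _) _)) _)
      _ ≤ K3 * F + 2 * |s| * ((K4 + |s| * K2) * F) + |s| ^ 2 * (K2 * F) + |X3| * (K1 * F) := by
            rw [abs_mul, abs_mul, abs_mul, abs_mul, abs_pow, abs_two]; gcongr
      _ = L3 * F := by ring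
  have c4 : |y| ≤ (1 + |X1 * X3 - X2 ^ 2| * K1 + |X3| * L1 + 2 * |X2| * L2 + |X1| * L3) * F := by
    have e : y = y' - (X1 * X3 - X2 ^ 2) * x - X3 * a + 2 * X2 * b - X1 * c := by rw [hy']; ring
    calc |y| ≤ |y'| + |(X1 * X3 - X2 ^ 2) * x| + |X3 * a| + |2 * X2 * b| + |X1 * c| := by
            conv_lhs => rw [e]
            exact (abs_sub _ _).trans (add_le_add_left ((abs_add_le _ _).trans
              (add_le_add_left ((abs_sub _ _).trans (add_le_add_left (abs_sub _ _) _)) _)) _)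
      _ ≤ F + |X1 * X3 - X2 ^ 2| * (K1 * F) + |X3| * (L1 * F) + 2 * |X2| * (L2 * F)
            + |X1| * (L3 * F) := by
            rw [abs_mul, abs_mul, abs_mul, abs_mul, abs_mul, abs_two]; gcongr
      _ = _ := by ring
  calc _ ≤ K1 * F + (1 + |X1 * X3 - X2 ^ 2| * K1 + |X3| * L1 + 2 * |X2| * L2 + |X1| * L3) * F
      + L1 * F + L2 * F + L3 * F := by gcongr
    _ = _ := by ring

/-! ### Symplectic matrices and primitive symmetric pairs -/

theorem fromBlocks_mem_symplectic_iff {R : Type*} [CommRing R] {A B C D : Matrix (Fin 2) (Fin 2) R} :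
    fromBlocks A B C D ∈ symplecticGroup (Fin 2) R ↔
      A * Bᵀ = B * Aᵀ ∧ C * Dᵀ = D * Cᵀ ∧ A * Dᵀ - B * Cᵀ = 1 := by
  rw [SymplecticGroup.mem_iff, J, fromBlocks_transpose, fromBlocks_multiply, fromBlocks_multiply,
    fromBlocks_inj]
  simp only [Matrix.mul_zero, Matrix.mul_one, Matrix.mul_neg, zero_add, add_zero, Matrix.neg_mul]
  constructor
  · rintro ⟨h1, h2, h3, h4⟩
    refine ⟨?_, ?_, ?_⟩
    · rw [← sub_eq_add_neg, sub_eq_zero] at h1; exact h1.symm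
    · rw [← sub_eq_add_neg, sub_eq_zero] at h4; exact h4.symm
    · rw [← sub_eq_add_neg] at h2; rw [← neg_inj, ← h2]; abel
  · rintro ⟨h1, h2, h3⟩
    refine ⟨by rw [h1]; abel, ?_, ?_, by rw [h2]; abel⟩
    · rw [← h3]; abel
    · rw [← transpose_one, ← h3]; simp [transpose_mul]; abel

/-- The relations between the blocks of a symplectic matrix, by rows and by columns. -/
structure IsSymplecticBlocks {R : Type*} [CommRing R] (A B C D : Matrix (Fin 2) (Fin 2) R) :
    Prop where
  AB : A * Bᵀ = B * Aᵀ
  CD : C * Dᵀ = D * Cᵀ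
  AD : A * Dᵀ - B * Cᵀ = 1
  AC : Aᵀ * C = Cᵀ * A
  BD : Bᵀ * D = Dᵀ * B
  AD' : Aᵀ * D - Cᵀ * B = 1

theorem isSymplecticBlocks_of_mem {R : Type*} [CommRing R] {A B C D : Matrix (Fin 2) (Fin 2) R}
    (h : fromBlocks A B C D ∈ symplecticGroup (Fin 2) R) : IsSymplecticBlocks A B C D := by
  have h' := SymplecticGroup.transpose_mem h
  rw [fromBlocks_transpose, fromBlocks_mem_symplectic_iff] at h'
  rw [fromBlocks_mem_symplectic_iff] at h
  simp only [transpose_transpose] at h'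
  exact ⟨h.1, h.2.1, h.2.2, h'.1, h'.2.1, h'.2.2⟩

theorem IsSymplecticBlocks.map {R S : Type*} [CommRing R] [CommRing S] (f : R →+* S)
    {A B C D : Matrix (Fin 2) (Fin 2) R} (h : IsSymplecticBlocks A B C D) :
    IsSymplecticBlocks (A.map f) (B.map f) (C.map f) (D.map f) := by
  constructor
  · have := congrArg (fun X : Matrix (Fin 2) (Fin 2) R => X.map f) h.AB
    simpa only [Matrix.map_mul, transpose_map] using this
  · have := congrArg (fun X : Matrix (Fin 2) (Fin 2) R => X.map f) h.CD
    simpa only [Matrix.map_mul, transpose_map] using this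
  · have := congrArg (fun X : Matrix (Fin 2) (Fin 2) R => X.map f) h.AD
    simpa [Matrix.map_mul, transpose_map, Matrix.map_sub] using this
  · have := congrArg (fun X : Matrix (Fin 2) (Fin 2) R => X.map f) h.AC
    simpa only [Matrix.map_mul, transpose_map] using this
  · have := congrArg (fun X : Matrix (Fin 2) (Fin 2) R => X.map f) h.BD
    simpa only [Matrix.map_mul, transpose_map] using this
  · have := congrArg (fun X : Matrix (Fin 2) (Fin 2) R => X.map f) h.AD'
    simpa [Matrix.map_mul, transpose_map, Matrix.map_sub] using this

theorem Gamma0.blocks {L : ℕ} (γ : Gamma0 L) : IsSymplecticBlocks γ.mat.toBlocks₁₁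
    γ.mat.toBlocks₁₂ γ.mat.toBlocks₂₁ γ.mat.toBlocks₂₂ := by
  apply isSymplecticBlocks_of_mem
  rw [fromBlocks_toBlocks]
  exact γ.1.2

/-- An element of `Γ₀(L)` from its blocks. -/
theorem exists_gamma0 {L : ℕ} {A B C D : Matrix (Fin 2) (Fin 2) ℤ} (h1 : A * Bᵀ = B * Aᵀ)
    (h2 : C * Dᵀ = D * Cᵀ) (h3 : A * Dᵀ - B * Cᵀ = 1) (hC : ∀ i j, (L : ℤ) ∣ C i j) :
    ∃ γ : Gamma0 L, γ.mat.toBlocks₁₁ = A ∧ γ.mat.toBlocks₁₂ = B ∧ γ.mat.toBlocks₂₁ = C ∧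
      γ.mat.toBlocks₂₂ = D :=
  ⟨⟨⟨fromBlocks A B C D, fromBlocks_mem_symplectic_iff.2 ⟨h1, h2, h3⟩⟩, by simpa using hC⟩,
    by simp [Gamma0.mat], by simp [Gamma0.mat], by simp [Gamma0.mat], by simp [Gamma0.mat]⟩

/-- `(M N)` is the lower half of an integral symplectic matrix: it is symmetric and has an integral
right inverse. -/
structure IsPrimPair (M N : Matrix (Fin 2) (Fin 2) ℤ) : Prop where
  symm : M * Nᵀ = N * Mᵀ
  exists_inv : ∃ X Y, M * X + N * Y = 1

theorem isPrimPair_pair {L : ℕ} {M₀ : Matrix (Fin 2) (Fin 2) ℤ} (hM₀ : M₀ᵀ = M₀) (γ : Gamma0 L) :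
    IsPrimPair (pairM M₀ γ) (pairN M₀ γ) := by
  obtain ⟨hAB, hCD, hAD, -, -, -⟩ := γ.blocks
  have hDA := congrArg transpose hAD
  simp only [transpose_sub, transpose_mul, transpose_transpose, transpose_one] at hDA
  simp only [pairM, pairN]
  generalize γ.mat.toBlocks₁₁ = A at *
  generalize γ.mat.toBlocks₁₂ = B at *
  generalize γ.mat.toBlocks₂₁ = C at *
  generalize γ.mat.toBlocks₂₂ = D at *
  constructor
  · simp only [transpose_add, transpose_mul, hM₀]
    have e1 : M₀ * (A * Bᵀ) * M₀ = M₀ * (B * Aᵀ) * M₀ := by rw [hAB]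
    have e2 : M₀ * (A * Dᵀ - B * Cᵀ) = M₀ := by rw [hAD, Matrix.mul_one]
    have e3 : (D * Aᵀ - C * Bᵀ) * M₀ = M₀ := by rw [hDA, Matrix.one_mul]
    have e4 := e2.trans e3.symm
    simp only [Matrix.add_mul, Matrix.mul_add, Matrix.sub_mul, Matrix.mul_sub, Matrix.mul_assoc] at *
    rw [e1, hCD]
    have e5 := eq_add_of_sub_eq e4
    have : M₀ * (A * Dᵀ) + C * (Bᵀ * M₀) = D * (Aᵀ * M₀) + M₀ * (B * Cᵀ) := by
      rw [e5]; abel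
    calc _ = M₀ * (B * (Aᵀ * M₀)) + D * Cᵀ + (M₀ * (A * Dᵀ) + C * (Bᵀ * M₀)) := by abel
      _ = _ := by rw [this]; abel
  · refine ⟨-Bᵀ, Aᵀ, ?_⟩
    rw [← hDA, Matrix.mul_neg, Matrix.add_mul, Matrix.add_mul, Matrix.mul_assoc, hAB,
      Matrix.mul_assoc]
    abel

/-! ### Plücker coordinates -/

/-- The Plücker coordinates `(det M, det N, a, b, c)` of a symmetric pair, where
`adj(M) N = (a b; b c)`. -/
def plucker (M N : Matrix (Fin 2) (Fin 2) ℤ) : ℤ × ℤ × ℤ × ℤ × ℤ :=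
  (M.det, N.det, M 1 1 * N 0 0 - M 0 1 * N 1 0, M 1 1 * N 0 1 - M 0 1 * N 1 1,
    M 0 0 * N 1 1 - M 1 0 * N 0 1)

theorem symm_entry {R : Type*} [CommRing R] {M N : Matrix (Fin 2) (Fin 2) R}
    (h : M * Nᵀ = N * Mᵀ) :
    M 0 0 * N 1 0 + M 0 1 * N 1 1 = N 0 0 * M 1 0 + N 0 1 * M 1 1 := by
  have := congr_fun (congr_fun h 0) 1
  simpa [Matrix.mul_apply, Fin.sum_univ_two] using this

theorem plucker_null {M N : Matrix (Fin 2) (Fin 2) ℤ} (h : M * Nᵀ = N * Mᵀ) :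
    (plucker M N).1 * (plucker M N).2.1 =
      (plucker M N).2.2.1 * (plucker M N).2.2.2.2 - (plucker M N).2.2.2.1 ^ 2 := by
  have := symm_entry h
  simp only [plucker, det_fin_two]
  linear_combination (-(M 1 1 * N 0 1 - M 0 1 * N 1 1)) * this

theorem minors_eq_of_plucker_eq {M N M' N' : Matrix (Fin 2) (Fin 2) ℤ} (h : M * Nᵀ = N * Mᵀ)
    (h' : M' * N'ᵀ = N' * M'ᵀ) (e : plucker M N = plucker M' N') (j k : Fin 2 ⊕ Fin 2) :
    fromCols M N 0 j * fromCols M N 1 k - fromCols M N 0 k * fromCols M N 1 j =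
      fromCols M' N' 0 j * fromCols M' N' 1 k - fromCols M' N' 0 k * fromCols M' N' 1 j := by
  have s := symm_entry h
  have s' := symm_entry h'
  simp only [plucker, Prod.mk.injEq, det_fin_two] at e
  obtain ⟨e1, e2, e3, e4, e5⟩ := e
  rcases j with j | j <;> rcases k with k | k <;> fin_cases j <;> fin_cases k <;>
    simp only [fromCols_apply_inl, fromCols_apply_inr, Fin.zero_eta, Fin.mk_one] <;> linarith

theorem det_mul_eq_sum_minors (P : Matrix (Fin 2) (Fin 2 ⊕ Fin 2) ℤ)
    (R : Matrix (Fin 2 ⊕ Fin 2) (Fin 2) ℤ) :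
    (P * R).det = ∑ j, ∑ k, R j 0 * R k 1 * (P 0 j * P 1 k - P 0 k * P 1 j) := by
  simp only [det_fin_two, mul_apply, Fintype.sum_sum_type, Fin.sum_univ_two]
  ring

/-- Primitive symmetric pairs with the same Plücker coordinates differ by `SL₂(ℤ)`. -/
theorem exists_SL2_of_plucker_eq {M N M' N' : Matrix (Fin 2) (Fin 2) ℤ} (h : IsPrimPair M N)
    (h' : M' * N'ᵀ = N' * M'ᵀ) (e : plucker M N = plucker M' N') :
    ∃ E : SL(2, ℤ), M' = (E : Matrix (Fin 2) (Fin 2) ℤ) * M ∧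
      N' = (E : Matrix (Fin 2) (Fin 2) ℤ) * N := by
  obtain ⟨hs, X, Y, hXY⟩ := h
  have hm := minors_eq_of_plucker_eq hs h' e
  have hPR : fromCols M N * fromRows X Y = 1 := by rw [fromCols_mul_fromRows, hXY]
  set P := fromCols M N
  set P' := fromCols M' N'
  set R := fromRows X Y
  have hdet : (P' * R).det = 1 := by
    rw [det_mul_eq_sum_minors]
    simp only [← hm]
    rw [← det_mul_eq_sum_minors, hPR, det_one]
  have hmul : P' = P' * R * P := by
    have a00 : ∑ j, P 0 j * R j 0 = 1 := by rw [← mul_apply, hPR]; rfl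
    have a01 : ∑ j, P 0 j * R j 1 = 0 := by rw [← mul_apply, hPR]; rfl
    have a10 : ∑ j, P 1 j * R j 0 = 0 := by rw [← mul_apply, hPR]; rfl
    have a11 : ∑ j, P 1 j * R j 1 = 1 := by rw [← mul_apply, hPR]; rfl
    ext r i
    -- a row of `P'` is orthogonal to the Plücker vector of `P'`, which is that of `P`
    have cyc : ∀ j k, P' r i * (P 0 j * P 1 k - P 0 k * P 1 j)
        - P' r j * (P 0 i * P 1 k - P 0 k * P 1 i)
        + P' r k * (P 0 i * P 1 j - P 0 j * P 1 i) = 0 := by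
      intro j k
      rw [hm, hm, hm]
      fin_cases r <;> simp only [Fin.zero_eta, Fin.mk_one] <;> ring
    have sum0 : ∑ j, ∑ k, R j 0 * R k 1 * (P' r i * (P 0 j * P 1 k - P 0 k * P 1 j)
        - P' r j * (P 0 i * P 1 k - P 0 k * P 1 i)
        + P' r k * (P 0 i * P 1 j - P 0 j * P 1 i)) = 0 :=
      Finset.sum_eq_zero fun j _ => Finset.sum_eq_zero fun k _ => by rw [cyc, mul_zero]
    have expand : ∑ j, ∑ k, R j 0 * R k 1 * (P' r i * (P 0 j * P 1 k - P 0 k * P 1 j)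
        - P' r j * (P 0 i * P 1 k - P 0 k * P 1 i)
        + P' r k * (P 0 i * P 1 j - P 0 j * P 1 i)) =
        P' r i * ((∑ j, P 0 j * R j 0) * (∑ j, P 1 j * R j 1)
          - (∑ j, P 0 j * R j 1) * (∑ j, P 1 j * R j 0))
        - (∑ j, P' r j * R j 0) * (P 0 i * (∑ j, P 1 j * R j 1) - (∑ j, P 0 j * R j 1) * P 1 i)
        + (∑ j, P' r j * R j 1) * (P 0 i * (∑ j, P 1 j * R j 0) - (∑ j, P 0 j * R j 0) * P 1 i) := by
      simp only [Fintype.sum_sum_type, Fin.sum_univ_two]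
      ring
    rw [sum0, a00, a01, a10, a11] at expand
    rw [mul_apply, Fin.sum_univ_two, mul_apply, mul_apply]
    linarith
  have hcols : fromCols M' N' = fromCols (P' * R * M) (P' * R * N) := by
    rw [← mul_fromCols]; exact hmul
  rw [fromCols_ext_iff] at hcols
  exact ⟨⟨P' * R, hdet⟩, by simpa using hcols.1, by simpa using hcols.2⟩

theorem plucker_ne_zero {M N : Matrix (Fin 2) (Fin 2) ℤ} (h : IsPrimPair M N) :
    plucker M N ≠ 0 := by
  intro e
  obtain ⟨hs, X, Y, hXY⟩ := h
  have hm := minors_eq_of_plucker_eq (M' := 0) (N' := 0) hs (by simp)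
    (e.trans (by simp [plucker]; rfl))
  have := det_mul_eq_sum_minors (fromCols M N) (fromRows X Y)
  simp only [hm] at this
  rw [fromCols_mul_fromRows, hXY] at this
  simp at this

theorem det_eq_pluckerForm {τ : Matrix (Fin 2) (Fin 2) ℂ} (hτ : τᵀ = τ)
    {M N : Matrix (Fin 2) (Fin 2) ℤ} (h : M * Nᵀ = N * Mᵀ) :
    (M.map (Int.cast : ℤ → ℂ) * τ + N.map (Int.cast : ℤ → ℂ)).det =
      pluckerForm τ (plucker M N).1 (plucker M N).2.1 (plucker M N).2.2.1 (plucker M N).2.2.2.1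
        (plucker M N).2.2.2.2 := by
  have s := congrArg (Int.cast : ℤ → ℂ) (symm_entry h)
  have ht : τ 1 0 = τ 0 1 := congr_fun (congr_fun hτ 0) 1
  push_cast at s
  simp only [plucker, pluckerForm, det_fin_two, Matrix.add_apply, mul_apply,
    Fin.sum_univ_two, map_apply, ht]
  push_cast
  linear_combination (-τ 0 1) * s

/-- Absolute convergence: the Plücker coordinates embed the classes into the integral points of the
null cone. -/
theorem summable_eisFamily {k N L : ℕ} (hk : 4 ≤ k) (χ : DirichletCharacter ℂ N)
    {M₀ : Matrix (Fin 2) (Fin 2) ℤ} (hM₀ : M₀ᵀ = M₀) {τ : Matrix (Fin 2) (Fin 2) ℂ}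
    (hτ : τ ∈ upperHalfSpace) : Summable (eisFamily k χ L M₀ τ) := by
  obtain ⟨K, hK, hb⟩ := pluckerForm_bound hτ
  have hp : ∀ γ : Gamma0 L, IsPrimPair (pairM M₀ γ) (pairN M₀ γ) := isPrimPair_pair hM₀
  let i : Quotient (orbitSetoid L M₀) → NullCone := fun c =>
    ⟨plucker (pairM M₀ c.out) (pairN M₀ c.out), plucker_null (hp c.out).symm⟩
  have hi : Function.Injective i := by
    intro c c' e
    obtain ⟨E, h1, h2⟩ := exists_SL2_of_plucker_eq (hp c.out) (hp c'.out).symm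
      (congrArg Subtype.val e)
    rw [← Quotient.out_eq c, ← Quotient.out_eq c']
    exact Quotient.sound ⟨E, h1, h2⟩
  refine Summable.of_norm_bounded (g := fun c => (2 * K) ^ k * (size (i c).1 ^ 4)⁻¹)
    ((summable_size.comp_injective hi).mul_left _) (fun c => ?_)
  have h0 := hp c.out
  have hn := plucker_null h0.symm
  have hne := plucker_ne_zero h0
  simp only [eisFamily, eisTerm, i, det_eq_pluckerForm hτ.1 h0.symm]
  generalize plucker (pairM M₀ c.out) (pairN M₀ c.out) = p at *
  obtain ⟨x, y, a, b, c'⟩ := p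
  simp only at hn ⊢
  have hF := hb x y a b c' (by exact_mod_cast hn)
  set F := ‖pluckerForm τ x y a b c'‖ with hFdef
  have h1 : (1 : ℝ) ≤ |(x : ℝ)| + |(y : ℝ)| + |(a : ℝ)| + |(b : ℝ)| + |(c' : ℝ)| := by
    have : 1 ≤ |x| + |y| + |a| + |b| + |c'| := by
      by_contra hcon
      apply hne
      have := abs_nonneg x; have := abs_nonneg y; have := abs_nonneg a
      have := abs_nonneg b; have := abs_nonneg c'
      have hx : x = 0 := abs_eq_zero.1 (by omega)
      have hy : y = 0 := abs_eq_zero.1 (by omega)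
      have ha : a = 0 := abs_eq_zero.1 (by omega)
      have hb : b = 0 := abs_eq_zero.1 (by omega)
      have hc : c' = 0 := abs_eq_zero.1 (by omega)
      simp [hx, hy, ha, hb, hc]
    exact_mod_cast this
  have h2 : size (x, y, a, b, c') ≤ 2 * K * F := by
    simp only [size]; linarith
  have h3 : 1 ≤ size (x, y, a, b, c') := by simp only [size]; linarith
  have h4 : 0 < F := by
    by_contra hcon
    have : 2 * K * F ≤ 0 := mul_nonpos_of_nonneg_of_nonpos (by positivity) (not_lt.1 hcon)
    linarith
  rw [norm_mul, RCLike.norm_conj, norm_inv, norm_pow, ← hFdef]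
  calc _ ≤ 1 * (F ^ k)⁻¹ := by gcongr; exact DirichletCharacter.norm_le_one χ _
    _ ≤ (2 * K) ^ k * (size (x, y, a, b, c') ^ 4)⁻¹ := by
      rw [one_mul, ← div_eq_mul_inv, le_div_iff₀ (by positivity), inv_mul_le_iff₀ (by positivity),
        ← mul_pow, mul_comm F]
      calc _ ≤ size (x, y, a, b, c') ^ k := pow_le_pow_right₀ h3 hk
        _ ≤ _ := by gcongr

/-! ### Lifting from congruences -/

/-- A residue class `c` modulo `n` contains an integer prime to `d ≠ 0` if `c`, `d`, `n` are jointly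
unimodular: divide by `gcd(c, n)` and lift a unit. -/
theorem exists_isCoprime_add_mul {c d : ℤ} {n : ℕ} (hd : d ≠ 0)
    (h : ∃ x y z : ℤ, x * c + y * d + z * n = 1) : ∃ t : ℤ, IsCoprime (c + t * n) d := by
  rcases Nat.eq_zero_or_pos n with rfl | hn
  · obtain ⟨x, y, z, h⟩ := h
    exact ⟨0, x, y, by simpa using h⟩
  obtain ⟨g, c', n', hg, hcop, hc, hn'⟩ : ∃ g c' n' : ℤ, g ≠ 0 ∧ IsCoprime c' n' ∧ c = c' * g ∧
      (n : ℤ) = n' * g := by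
    have hgcd : 0 < Int.gcd c n := Int.gcd_pos_of_ne_zero_right _ (by exact_mod_cast hn.ne')
    obtain ⟨c', n', h1, h2, h3⟩ := Int.exists_gcd_one hgcd
    exact ⟨Int.gcd c n, c', n', by exact_mod_cast hgcd.ne', Int.isCoprime_iff_gcd_eq_one.2 h1, h2, h3⟩
  have hgd : IsCoprime g d := by
    obtain ⟨x, y, z, h⟩ := h
    exact ⟨x * c' + z * n', y, by rw [← h, hc, hn']; ring⟩
  have hn'0 : n' ≠ 0 := by rintro rfl; simp at hn'; omega
  set m := n'.natAbs * d.natAbs with hm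
  have : NeZero m := ⟨Nat.mul_ne_zero (Int.natAbs_ne_zero.2 hn'0) (Int.natAbs_ne_zero.2 hd)⟩
  have hdvd : n'.natAbs ∣ m := Dvd.intro _ rfl
  have hu : IsUnit ((c' : ℤ) : ZMod n'.natAbs) := by
    rw [ZMod.coe_int_isUnit_iff_isCoprime]
    rw [Int.isCoprime_iff_gcd_eq_one] at hcop ⊢
    rw [Int.gcd_comm] at hcop
    simpa only [Int.gcd, Int.natAbs_natCast] using hcop
  obtain ⟨v, hv⟩ := ZMod.unitsMap_surjective hdvd hu.unit
  obtain ⟨w, hw⟩ := ZMod.intCast_surjective (v : ZMod m)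
  have hwd : IsCoprime w d := by
    have h1 : IsUnit ((w : ℤ) : ZMod m) := hw ▸ v.isUnit
    rw [ZMod.coe_int_isUnit_iff_isCoprime] at h1
    have h2 : IsCoprime d w := h1.of_isCoprime_of_dvd_left
      (by rw [hm]; push_cast; exact (self_dvd_abs d).trans (Dvd.intro_left _ rfl))
    exact h2.symm
  have hwc : ((w : ℤ) : ZMod n'.natAbs) = (c' : ℤ) := by
    have h1 := congrArg Units.val hv
    rw [ZMod.unitsMap_val, ← hw, ZMod.cast_intCast hdvd] at h1
    simpa using h1
  rw [ZMod.intCast_eq_intCast_iff, Int.modEq_iff_dvd] at hwc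
  obtain ⟨t, ht⟩ := (Int.natAbs_dvd.1 hwc)
  refine ⟨-t, ?_⟩
  have : c + -t * n = w * g := by rw [hc, hn']; linear_combination g * ht
  rw [this]
  exact hwd.mul_left hgd

/-- `SL₂(ℤ) → SL₂(ℤ/n)` is onto. -/
theorem exists_SL2_congr {n : ℕ} (hn : 0 < n) (m : Matrix (Fin 2) (Fin 2) ℤ)
    (hm : (n : ℤ) ∣ m.det - 1) :
    ∃ E : SL(2, ℤ), ∀ i j, (n : ℤ) ∣ (E : Matrix (Fin 2) (Fin 2) ℤ) i j - m i j := by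
  obtain ⟨r, hr⟩ := hm
  rw [det_fin_two] at hr
  -- the lower right entry can be made nonzero
  obtain ⟨d, e, hd, hde⟩ : ∃ d e : ℤ, d ≠ 0 ∧ d = m 1 1 + n * e := by
    by_cases h : m 1 1 = 0
    · exact ⟨n, 1, by exact_mod_cast hn.ne', by simp [h]⟩
    · exact ⟨m 1 1, 0, h, by simp⟩
  obtain ⟨t, ht⟩ := exists_isCoprime_add_mul (c := m 1 0) (n := n) hd
    ⟨-m 0 1, m 0 0, -(r + m 0 0 * e), by rw [hde]; linear_combination hr⟩
  set c := m 1 0 + t * n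
  obtain ⟨y, x, hxy⟩ := ht
  obtain ⟨r', hr'⟩ : ∃ r', m 0 0 * d - m 0 1 * c = 1 + n * r' :=
    ⟨r + m 0 0 * e - m 0 1 * t, by rw [hde]; linear_combination hr⟩
  refine ⟨⟨!![m 0 0 - n * r' * x, m 0 1 + n * r' * y; c, d], ?_⟩, ?_⟩
  · rw [det_fin_two_of]
    linear_combination hr' - n * r' * hxy
  · intro i j
    fin_cases i <;> fin_cases j
    · exact ⟨-(r' * x), by simp; ring⟩
    · exact ⟨r' * y, by simp; ring⟩
    · exact ⟨t, by simp [c]; ring⟩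
    · exact ⟨e, by simp [hde]⟩

/-- Every primitive symmetric pair is the lower half of a symplectic matrix. -/
theorem IsPrimPair.exists_completion {M N : Matrix (Fin 2) (Fin 2) ℤ} (h : IsPrimPair M N) :
    ∃ A B, fromBlocks A B M N ∈ symplecticGroup (Fin 2) ℤ := by
  obtain ⟨hs, X, Y, hXY⟩ := h
  have h1 : Yᵀ * Nᵀ + Xᵀ * Mᵀ = 1 := by
    have := congrArg transpose hXY
    simpa [transpose_mul, add_comm] using this
  have h2 : N * Y + M * X = 1 := by rw [add_comm]; exact hXY
  set θ : ℤ := (Xᵀ * Y - Yᵀ * X) 0 1 with hθ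
  let S : Matrix (Fin 2) (Fin 2) ℤ := !![0, θ; 0, 0]
  have hS : Xᵀ * Y - Yᵀ * X = S - Sᵀ := by
    ext i j
    fin_cases i <;> fin_cases j <;> simp [S, hθ, mul_apply, Fin.sum_univ_two] <;> ring
  refine ⟨Yᵀ + S * M, -Xᵀ + S * N, fromBlocks_mem_symplectic_iff.2 ⟨?_, hs, ?_⟩⟩
  · simp only [transpose_add, transpose_mul, transpose_neg, transpose_transpose, Matrix.add_mul,
      Matrix.mul_add, Matrix.mul_neg, Matrix.neg_mul, Matrix.mul_assoc]
    have e1 : Yᵀ * (Nᵀ * Sᵀ) + Xᵀ * (Mᵀ * Sᵀ) = Sᵀ := by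
      rw [← Matrix.mul_assoc, ← Matrix.mul_assoc, ← Matrix.add_mul, h1, Matrix.one_mul]
    have e2 : S * (N * Y) + S * (M * X) = S := by rw [← Matrix.mul_add, h2, Matrix.mul_one]
    have e3 : S * (M * (Nᵀ * Sᵀ)) = S * (N * (Mᵀ * Sᵀ)) := by
      rw [← Matrix.mul_assoc M, hs, Matrix.mul_assoc]
    rw [e3]
    rw [sub_eq_sub_iff_add_eq_add] at hS
    generalize Yᵀ * (Nᵀ * Sᵀ) = a at *
    generalize Xᵀ * (Mᵀ * Sᵀ) = b at *
    generalize S * (N * Y) = c at *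
    generalize S * (M * X) = d at *
    have : Xᵀ * Y = S - Sᵀ + Yᵀ * X := by rw [eq_comm, sub_add_eq_add_sub, sub_eq_iff_eq_add, hS]
    rw [this, ← e1, ← e2]
    abel
  · simp only [Matrix.add_mul, Matrix.neg_mul, Matrix.mul_assoc, hs]
    rw [← h1]; abel

/-! ### Orbit representations over a ring -/

/-- Over a ring `R`: `(M N) = E (M₀ I) γ` with `det E = 1` and `γ = (A B; 0 D)` symplectic,
`u = det A`. -/
def OrbitRep {R : Type*} [CommRing R] (M₀ M N : Matrix (Fin 2) (Fin 2) R) (u : R) : Prop :=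
  ∃ E A B D : Matrix (Fin 2) (Fin 2) R, E.det = 1 ∧ A * Dᵀ = 1 ∧ A * Bᵀ = B * Aᵀ ∧
    M = E * (M₀ * A) ∧ N = E * (M₀ * B + D) ∧ u = A.det

theorem OrbitRep.isUnit {R : Type*} [CommRing R] {M₀ M N : Matrix (Fin 2) (Fin 2) R} {u : R}
    (h : OrbitRep M₀ M N u) : IsUnit u := by
  obtain ⟨E, A, B, D, -, hAD, -, -, -, rfl⟩ := h
  have := congrArg det hAD
  rw [det_mul, det_one] at this
  exact IsUnit.of_mul_eq_one _ this

/-- The stabiliser of `(diag(x, y) I)`, with idempotents `y ≤ x`: the determinants are squares. -/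
theorem det_isSquare_of_stabilizer {R : Type*} [CommRing R] {x y : R} (hx : x * x = x)
    (hy : y * y = y) (hxy : x * y = y) {A B D G : Matrix (Fin 2) (Fin 2) R} (hG : G.det = 1)
    (hA : diagonal ![x, y] * A = G * diagonal ![x, y]) (hB : diagonal ![x, y] * B + D = G)
    (hAD : A * Dᵀ = 1) : ∃ s, A.det = s ^ 2 := by
  have ent := fun i j => congr_fun (congr_fun hA i) j
  have a11 := ent 0 0
  have a12 := ent 0 1
  have a21 := ent 1 0
  have a22 := ent 1 1
  have ent := fun i j => congr_fun (congr_fun hB i) j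
  have d11 := ent 0 0
  have d12 := ent 0 1
  have d21 := ent 1 0
  have d22 := ent 1 1
  have ent := fun i j => congr_fun (congr_fun hAD i) j
  have i11 := ent 0 0
  have i12 := ent 0 1
  have i21 := ent 1 0
  have i22 := ent 1 1
  have hdet := congrArg det hAD
  rw [det_mul, det_transpose, det_one, det_fin_two, det_fin_two] at hdet
  rw [det_fin_two] at hG ⊢
  simp [mul_apply, Fin.sum_univ_two] at a11 a12 a21 a22 d11 d12 d21 d22 i11 i12 i21 i22
  generalize A 0 0 = a at *
  generalize A 0 1 = b at *
  generalize A 1 0 = c at *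
  generalize A 1 1 = d at *
  generalize G 0 0 = g at *
  generalize G 0 1 = h at *
  generalize G 1 0 = k at *
  generalize G 1 1 = l at *
  generalize D 0 0 = p at *
  generalize D 0 1 = q at *
  generalize D 1 0 = r at *
  generalize D 1 1 = t at *
  refine ⟨(1 - x) + y + (x - y) * a, ?_⟩
  have e1 : (1 - x) * (a * d - b * c) = 1 - x := by
    have h1 : (1 - x) * (p * t - q * r) = 1 - x := by
      have hp : (1 - x) * p = (1 - x) * g := by linear_combination (1 - x) * d11 + B 0 0 * hx
      have hq : (1 - x) * q = (1 - x) * h := by linear_combination (1 - x) * d12 + B 0 1 * hx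
      have hr : (1 - x) * r = (1 - x) * k := by linear_combination (1 - x) * d21 + B 1 0 * hxy
      have ht : (1 - x) * t = (1 - x) * l := by linear_combination (1 - x) * d22 + B 1 1 * hxy
      linear_combination t * hp + g * ht - r * hq - h * hr + (1 - x) * hG
    linear_combination (1 - x) * hdet - (a * d - b * c) * h1
  have e2 : y * (a * d - b * c) = y := by
    have ha : y * a = y * g := by linear_combination y * a11 - a * hxy + g * hxy
    have hb : y * b = y * h := by linear_combination y * a12 - b * hxy + h * hy
    have hc : y * c = y * k := by linear_combination y * a21 - c * hy + k * hxy
    have hd : y * d = y * l := by linear_combination a22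
    linear_combination d * ha + g * hd - c * hb - h * hc + y * hG
  have e3 : (x - y) * (a * d - b * c) = (x - y) * a ^ 2 := by
    have hb : (x - y) * b = 0 := by linear_combination (x - y) * a12 - b * hx + b * hxy - h * hy + h * hxy
    have hk : (x - y) * k = 0 := by linear_combination -(x - y) * a21 - k * hx + k * hxy + c * hxy - c * hy
    have hag : (x - y) * a = (x - y) * g := by
      linear_combination (x - y) * a11 - a * hx + a * hxy + g * hx - g * hxy
    have htl : (x - y) * t = (x - y) * l := by
      linear_combination (x - y) * d22 - B 1 1 * hxy + B 1 1 * hy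
    have hr : (x - y) * r = 0 := by
      linear_combination (x - y) * d21 + hk - B 1 0 * hxy + B 1 0 * hy
    have h1 : (x - y) * (d * t) = x - y := by linear_combination (x - y) * i22 - c * hr
    have h2 : (x - y) * (a * t) = x - y := by
      linear_combination t * hag + g * htl + (x - y) * hG + h * hk
    have h3 : (x - y) * d = (x - y) * a := by
      linear_combination a * h1 - d * h2
    linear_combination a * h3 - c * hb
  have hsq : ((1 - x) + y + (x - y) * a) ^ 2 = (1 - x) + y + (x - y) * a ^ 2 := by
    linear_combination (1 - a) ^ 2 * hx - 2 * (1 - a) ^ 2 * hxy + (1 - a) ^ 2 * hy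
  linear_combination e1 + e2 + e3 - hsq

section Rep
variable {R : Type*} [CommRing R]

theorem mul_comm_eq_one {A B : Matrix (Fin 2) (Fin 2) R} (h : A * B = 1) : B * A = 1 :=
  mul_eq_one_comm.1 h

/-- The determinant of `A` in a representation is unique up to squares. -/
theorem OrbitRep.det_eq_sq_mul {x y : R} (hx : x * x = x) (hy : y * y = y) (hxy : x * y = y)
    {M N : Matrix (Fin 2) (Fin 2) R} {u u' : R} (h : OrbitRep (diagonal ![x, y]) M N u)
    (h' : OrbitRep (diagonal ![x, y]) M N u') : ∃ s, u' = s ^ 2 * u := by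
  obtain ⟨E, A, B, D, hE, hAD, hAB, hM, hN, rfl⟩ := h
  obtain ⟨F, A', B', D', hF, hAD', hAB', hM', hN', rfl⟩ := h'
  set M₀ : Matrix (Fin 2) (Fin 2) R := diagonal ![x, y]
  have hFF : F.adjugate * F = 1 := by rw [adjugate_mul, hF, one_smul]
  have hDA := congrArg transpose hAD
  simp only [transpose_mul, transpose_transpose, transpose_one] at hDA
  have hDA' : Dᵀ * A = 1 := mul_comm_eq_one hAD
  have eM : M₀ * A' = F.adjugate * E * (M₀ * A) := by
    rw [Matrix.mul_assoc, ← hM, hM', ← Matrix.mul_assoc, hFF, Matrix.one_mul]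
  have eN : M₀ * B' + D' = F.adjugate * E * (M₀ * B + D) := by
    rw [Matrix.mul_assoc, ← hN, hN', ← Matrix.mul_assoc, hFF, Matrix.one_mul]
  obtain ⟨s, hs⟩ := det_isSquare_of_stabilizer hx hy hxy (A := A' * Dᵀ)
    (B := B' * Aᵀ - A' * Bᵀ) (D := D' * Aᵀ) (G := F.adjugate * E)
    (by rw [det_mul, det_adjugate, hF, hE]; simp)
    (by rw [← Matrix.mul_assoc, eM, Matrix.mul_assoc, Matrix.mul_assoc M₀, hAD, Matrix.mul_one])
    (by
      have : M₀ * (B' * Aᵀ - A' * Bᵀ) + D' * Aᵀ = (M₀ * B' + D') * Aᵀ - M₀ * A' * Bᵀ := by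
        simp only [Matrix.mul_sub, Matrix.add_mul, Matrix.mul_assoc]; abel
      rw [this, eN, eM]
      have : F.adjugate * E * (M₀ * B + D) * Aᵀ - F.adjugate * E * (M₀ * A) * Bᵀ =
          F.adjugate * E * (M₀ * (B * Aᵀ) + D * Aᵀ - M₀ * (A * Bᵀ)) := by
        simp only [Matrix.mul_sub, Matrix.mul_add, Matrix.add_mul, Matrix.mul_assoc]
      rw [this, hAB, hDA]; simp)
    (by rw [transpose_mul, transpose_transpose, Matrix.mul_assoc, ← Matrix.mul_assoc Dᵀ, hDA',
          Matrix.one_mul, hAD'])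
  refine ⟨s, ?_⟩
  have hd := congrArg det hDA'
  rw [det_mul, det_one, det_transpose] at hd
  rw [det_mul, det_transpose] at hs
  rw [← hs, mul_assoc, hd, mul_one]

theorem OrbitRep.shift {M₀ M N Z : Matrix (Fin 2) (Fin 2) R} {u : R} (h : OrbitRep M₀ M N u)
    (hZ : Zᵀ = Z) : OrbitRep M₀ M (N + M * Z) u := by
  obtain ⟨E, A, B, D, hE, hAD, hAB, rfl, rfl, rfl⟩ := h
  refine ⟨E, A, B + A * Z, D, hE, hAD, ?_, rfl, ?_, rfl⟩
  · simp only [transpose_add, transpose_mul, hZ, Matrix.mul_add, Matrix.add_mul, hAB,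
      Matrix.mul_assoc]
  · simp only [Matrix.mul_add, Matrix.mul_assoc]; abel

/-- Left multiplication by `g` of determinant `h` multiplies the determinant of `A` by `h`, up to
squares. -/
theorem OrbitRep.mul_left {x y h h' : R} (hy : y * y = y) (hh : h * h' = 1)
    {M N g : Matrix (Fin 2) (Fin 2) R} {u : R} (hr : OrbitRep (diagonal ![x, y]) M N u)
    (hg : g.det = h) : ∃ s, OrbitRep (diagonal ![x, y]) (g * M) (g * N) (u * h * s ^ 2) := by
  obtain ⟨E, A, B, D, hE, hAD, hAB, rfl, rfl, rfl⟩ := hr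
  refine ⟨y + (1 - y) * h', g * E * diagonal ![1, h'], diagonal ![1, y * h + (1 - y) * h'] * A,
    diagonal ![1, y * h + (1 - y) * h'] * B + diagonal ![0, y * (h - h')] * D,
    diagonal ![1, y * h' + (1 - y) * h] * D, ?_, ?_, ?_, ?_, ?_, ?_⟩
  · rw [det_mul, det_mul, hg, hE, det_diagonal]; simp [hh]
  · rw [transpose_mul, diagonal_transpose, Matrix.mul_assoc, ← Matrix.mul_assoc A, hAD,
      Matrix.one_mul, diagonal_mul_diagonal, ← diagonal_one]
    congr 1
    funext i
    fin_cases i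
    · simp
    · simp
      linear_combination (1 - 2 * y + 2 * y ^ 2) * hh + (2 - h ^ 2 - h' ^ 2) * hy
  · have hDA : D * Aᵀ = 1 := by simpa [transpose_mul] using congrArg transpose hAD
    simp only [transpose_mul, transpose_add, diagonal_transpose, Matrix.mul_add, Matrix.add_mul]
    congr 1
    · simp only [Matrix.mul_assoc]; rw [← Matrix.mul_assoc A, hAB, Matrix.mul_assoc]
    · rw [Matrix.mul_assoc, ← Matrix.mul_assoc A, hAD, Matrix.one_mul, Matrix.mul_assoc,
        ← Matrix.mul_assoc D, hDA, Matrix.one_mul, diagonal_mul_diagonal, diagonal_mul_diagonal]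
      congr 1
      funext i
      exact mul_comm _ _
  · have e : diagonal ![1, h'] * (diagonal ![x, y] * diagonal ![1, y * h + (1 - y) * h']) =
        diagonal ![x, y] := by
      rw [diagonal_mul_diagonal, diagonal_mul_diagonal]
      congr 1
      funext i
      fin_cases i
      · simp
      · simp
        linear_combination y ^ 2 * hh + (1 - h' ^ 2) * hy
    rw [← Matrix.mul_assoc (diagonal ![x, y]), Matrix.mul_assoc (g * E), ← Matrix.mul_assoc
      (diagonal ![1, h']), e, Matrix.mul_assoc]
  · have e : diagonal ![1, h'] * (diagonal ![x, y] * diagonal ![1, y * h + (1 - y) * h']) =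
        diagonal ![x, y] := by
      rw [diagonal_mul_diagonal, diagonal_mul_diagonal]
      congr 1
      funext i
      fin_cases i
      · simp
      · simp
        linear_combination y ^ 2 * hh + (1 - h' ^ 2) * hy
    have e2 : diagonal ![1, h'] * (diagonal ![x, y] * diagonal ![0, y * (h - h')] +
        diagonal ![1, y * h' + (1 - y) * h]) = 1 := by
      rw [diagonal_mul_diagonal, diagonal_add, diagonal_mul_diagonal, ← diagonal_one]
      congr 1
      funext i
      fin_cases i
      · simp
      · simp
        linear_combination hh + (h * h' - h' ^ 2) * hy
    have e3 : g * E * diagonal ![1, h'] * (diagonal ![x, y] *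
          (diagonal ![1, y * h + (1 - y) * h'] * B + diagonal ![0, y * (h - h')] * D) +
          diagonal ![1, y * h' + (1 - y) * h] * D) =
        g * E * ((diagonal ![1, h'] * (diagonal ![x, y] * diagonal ![1, y * h + (1 - y) * h'])) * B
          + (diagonal ![1, h'] * (diagonal ![x, y] * diagonal ![0, y * (h - h')] +
        diagonal ![1, y * h' + (1 - y) * h])) * D) := by
      simp only [Matrix.mul_add, Matrix.add_mul, Matrix.mul_assoc, add_assoc]
    rw [e3, e, e2, Matrix.one_mul, Matrix.mul_assoc]
  · rw [det_mul, det_diagonal]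
    simp
    linear_combination A.det * (h - 2 * h * h' + h * h' ^ 2) * hy + A.det * ((1 - y) * h') * hh

/-- A representation, in terms of a given symplectic completion `(A B; M N)`. -/
theorem OrbitRep.exists_completion {M₀ M N A B : Matrix (Fin 2) (Fin 2) R} {u : R}
    (h : OrbitRep M₀ M N u) (hs : IsSymplecticBlocks A B M N) :
    ∃ E T : Matrix (Fin 2) (Fin 2) R, E.det = 1 ∧ Tᵀ = T ∧
      M = E * (M₀ * (Eᵀ * (A + T * M))) := by
  obtain ⟨E, A', B', D', hE, hAD, hAB, hM, hN, rfl⟩ := h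
  have hEE : E * E.adjugate = 1 := by rw [mul_adjugate, hE, one_smul]
  have hEE' : Eᵀ * E.adjugateᵀ = 1 := by
    rw [← transpose_mul, adjugate_mul, hE, one_smul, transpose_one]
  set A₁ := E.adjugateᵀ * A' with hA₁
  set B₁ := E.adjugateᵀ * B' with hB₁
  have hDA : D' * A'ᵀ = 1 := by simpa [transpose_mul] using congrArg transpose hAD
  -- `(A₁ B₁)` is another completion
  have s1 : A₁ * B₁ᵀ = B₁ * A₁ᵀ := by
    rw [hA₁, hB₁, transpose_mul, transpose_mul, Matrix.mul_assoc, ← Matrix.mul_assoc A', hAB]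
    simp only [Matrix.mul_assoc]
  obtain ⟨hAB0, hMN, hAN, hAM, hBN, hAN'⟩ := hs
  have s2 : N * A₁ᵀ - M * B₁ᵀ = 1 := by
    rw [hM, hN, hA₁, hB₁, transpose_mul, transpose_mul, transpose_transpose]
    have : E * (M₀ * B' + D') * (A'ᵀ * E.adjugate) - E * (M₀ * A') * (B'ᵀ * E.adjugate) =
        E * (M₀ * (B' * A'ᵀ) + D' * A'ᵀ - M₀ * (A' * B'ᵀ)) * E.adjugate := by
      simp only [Matrix.mul_sub, Matrix.sub_mul, Matrix.mul_add, Matrix.add_mul, Matrix.mul_assoc]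
    rw [this, hAB, hDA]
    simp [hEE]
  have s2' : A₁ * Nᵀ - B₁ * Mᵀ = 1 := by
    simpa [transpose_mul, transpose_sub] using congrArg transpose s2
  have hAN'' : Nᵀ * A - Bᵀ * M = 1 := by
    simpa [transpose_mul, transpose_sub] using congrArg transpose hAN'
  have hNA : N * Aᵀ - M * Bᵀ = 1 := by
    simpa [transpose_mul, transpose_sub] using congrArg transpose hAN
  set T := B₁ * Aᵀ - A₁ * Bᵀ with hT
  have hTM : A + T * M = A₁ := by
    have e1 : T * M = B₁ * (Aᵀ * M) - A₁ * (Bᵀ * M) := by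
      rw [hT, Matrix.sub_mul, Matrix.mul_assoc B₁, Matrix.mul_assoc A₁]
    have e2 : Bᵀ * M = Nᵀ * A - 1 := by rw [← hAN'']; abel
    have e3 : T * M = A₁ - (A₁ * Nᵀ - B₁ * Mᵀ) * A := by
      rw [e1, hAM, e2]; simp only [Matrix.mul_sub, Matrix.sub_mul, Matrix.mul_assoc, Matrix.mul_one]
      abel
    rw [e3, s2', Matrix.one_mul]; abel
  have hTN : B + T * N = B₁ := by
    have e1 : T * N = B₁ * (Aᵀ * N) - A₁ * (Bᵀ * N) := by
      rw [hT, Matrix.sub_mul, Matrix.mul_assoc B₁, Matrix.mul_assoc A₁]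
    have e2 : Aᵀ * N = Mᵀ * B + 1 := by rw [← hAN']; abel
    have e3 : T * N = B₁ - (A₁ * Nᵀ - B₁ * Mᵀ) * B := by
      rw [e1, hBN, e2]; simp only [Matrix.mul_add, Matrix.sub_mul, Matrix.mul_assoc, Matrix.mul_one]
      abel
    rw [e3, s2', Matrix.one_mul]; abel
  refine ⟨E, T, hE, ?_, ?_⟩
  · rw [← hTM, ← hTN] at s1
    simp only [transpose_add, transpose_mul, Matrix.add_mul, Matrix.mul_add, Matrix.mul_assoc] at s1
    have e1 : A * (Nᵀ * Tᵀ) - B * (Mᵀ * Tᵀ) = Tᵀ := by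
      rw [← Matrix.mul_assoc, ← Matrix.mul_assoc, ← Matrix.sub_mul, hAN, Matrix.one_mul]
    have e2 : T * (N * Aᵀ) - T * (M * Bᵀ) = T := by
      rw [← Matrix.mul_sub, hNA, Matrix.mul_one]
    have e3 : T * (M * (Nᵀ * Tᵀ)) = T * (N * (Mᵀ * Tᵀ)) := by
      rw [← Matrix.mul_assoc M, hMN, Matrix.mul_assoc]
    rw [hAB0, e3] at s1
    rw [← e1]
    conv_rhs => rw [← e2]
    rw [sub_eq_sub_iff_add_eq_add]
    have := add_right_cancel (b := B * Aᵀ + T * (N * (Mᵀ * Tᵀ)))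
      (a := A * (Nᵀ * Tᵀ) + T * (M * Bᵀ)) (c := T * (N * Aᵀ) + B * (Mᵀ * Tᵀ)) (by
        convert s1 using 1 <;> abel)
    exact this
  · rw [hTM, hA₁, ← Matrix.mul_assoc Eᵀ, hEE', Matrix.one_mul, hM]

end Rep

/-! ### Reduction modulo `n` -/

/-- Reduction of an integral matrix modulo `n`. -/
def red (n : ℕ) : Matrix (Fin 2) (Fin 2) ℤ →+* Matrix (Fin 2) (Fin 2) (ZMod n) :=
  (Int.castRingHom (ZMod n)).mapMatrix

theorem red_apply (n : ℕ) (M : Matrix (Fin 2) (Fin 2) ℤ) (i j) : red n M i j = (M i j : ZMod n) := rfl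

theorem red_transpose (n : ℕ) (M : Matrix (Fin 2) (Fin 2) ℤ) : red n Mᵀ = (red n M)ᵀ := rfl

theorem red_det (n : ℕ) (M : Matrix (Fin 2) (Fin 2) ℤ) : (red n M).det = (M.det : ZMod n) :=
  ((Int.castRingHom (ZMod n)).map_det M).symm

theorem red_eq_iff {n : ℕ} {M M' : Matrix (Fin 2) (Fin 2) ℤ} :
    red n M = red n M' ↔ ∀ i j, (n : ℤ) ∣ M i j - M' i j := by
  simp only [← Matrix.ext_iff, red_apply, ZMod.intCast_eq_intCast_iff_dvd_sub]
  exact forall₂_congr fun i j => by rw [← dvd_neg, neg_sub]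

theorem red_eq_zero_iff {n : ℕ} {M : Matrix (Fin 2) (Fin 2) ℤ} :
    red n M = 0 ↔ ∀ i j, (n : ℤ) ∣ M i j := by
  rw [← map_zero (red n), red_eq_iff]; simp

theorem red_diagonal (n : ℕ) (x y : ℤ) :
    red n (diagonal ![x, y]) = diagonal ![(x : ZMod n), (y : ZMod n)] := by
  ext i j
  fin_cases i <;> fin_cases j <;> simp [red_apply]

theorem exists_red_eq {n : ℕ} (X : Matrix (Fin 2) (Fin 2) (ZMod n)) :
    ∃ Y : Matrix (Fin 2) (Fin 2) ℤ, red n Y = X ∧ (Xᵀ = X → Yᵀ = Y) := by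
  choose f hf using (ZMod.intCast_surjective (n := n))
  refine ⟨X.map f, ?_, fun h => by rw [← transpose_map, h]⟩
  ext i j
  simp [red_apply, hf]

/-- The Chinese remainder theorem for integral matrices, compatible with symmetry. -/
theorem exists_crt {n₁ n₂ : ℕ} (h : n₁.Coprime n₂) (A B : Matrix (Fin 2) (Fin 2) ℤ) :
    ∃ Z : Matrix (Fin 2) (Fin 2) ℤ, red n₁ Z = red n₁ A ∧ red n₂ Z = red n₂ B ∧
      (Aᵀ = A → Bᵀ = B → Zᵀ = Z) := by
  obtain ⟨u, v, huv⟩ := (Nat.isCoprime_iff_coprime.2 h)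
  refine ⟨(v * n₂) • A + (u * n₁) • B, ?_, ?_, fun hA hB => by
    rw [transpose_add, transpose_smul, transpose_smul, hA, hB]⟩
  · rw [red_eq_iff]
    exact fun i j => ⟨u * (B i j - A i j), by
      rw [Matrix.add_apply, Matrix.smul_apply, Matrix.smul_apply, smul_eq_mul, smul_eq_mul]
      linear_combination A i j * huv⟩
  · rw [red_eq_iff]
    exact fun i j => ⟨v * (A i j - B i j), by
      rw [Matrix.add_apply, Matrix.smul_apply, Matrix.smul_apply, smul_eq_mul, smul_eq_mul]
      linear_combination B i j * huv⟩

/-! ### Orbits -/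

/-- `(M N)` lies in `SL₂(ℤ)(M₀ I)γ`. -/
def InOrbit {L : ℕ} (M₀ M N : Matrix (Fin 2) (Fin 2) ℤ) (γ : Gamma0 L) : Prop :=
  ∃ E : SL(2, ℤ), M = (E : Matrix (Fin 2) (Fin 2) ℤ) * pairM M₀ γ ∧
    N = (E : Matrix (Fin 2) (Fin 2) ℤ) * pairN M₀ γ

theorem red_C_eq_zero {L n : ℕ} (hn : n ∣ L) (γ : Gamma0 L) : red n γ.mat.toBlocks₂₁ = 0 :=
  red_eq_zero_iff.2 fun i j => (Int.natCast_dvd_natCast.2 hn).trans (γ.2 i j)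

theorem red_AD {L n : ℕ} (hn : n ∣ L) (γ : Gamma0 L) :
    red n γ.mat.toBlocks₁₁ * (red n γ.mat.toBlocks₂₂)ᵀ = 1 := by
  have := congrArg (red n) γ.blocks.AD
  rw [map_sub, map_mul, map_mul, red_transpose, red_transpose, red_C_eq_zero hn, map_one] at this
  simpa using this

theorem InOrbit.orbitRep {L n : ℕ} (hn : n ∣ L) {M₀ M N : Matrix (Fin 2) (Fin 2) ℤ} {γ : Gamma0 L}
    (h : InOrbit M₀ M N γ) :
    OrbitRep (red n M₀) (red n M) (red n N) (γ.mat.toBlocks₁₁.det : ZMod n) := by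
  obtain ⟨E, rfl, rfl⟩ := h
  refine ⟨red n E, red n γ.mat.toBlocks₁₁, red n γ.mat.toBlocks₁₂, red n γ.mat.toBlocks₂₂, ?_,
    red_AD hn γ, ?_, ?_, ?_, ?_⟩
  · rw [red_det, E.det_coe, Int.cast_one]
  · have := congrArg (red n) γ.blocks.AB
    rwa [map_mul, map_mul, red_transpose, red_transpose] at this
  · rw [map_mul, pairM, map_add, red_C_eq_zero hn, add_zero, map_mul]
  · rw [map_mul, pairN, map_add, map_mul]
  · rw [red_det]

/-- Local representations modulo coprime `n₁`, `n₂` come from a global one modulo `n₁ n₂`. -/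
theorem exists_inOrbit {L n₁ n₂ : ℕ} (hL : L = n₁ * n₂) (hcop : n₁.Coprime n₂) (hL0 : 0 < L)
    {M₀ M N : Matrix (Fin 2) (Fin 2) ℤ} (hM₀ : M₀ᵀ = M₀) (h : IsPrimPair M N)
    (r₁ : ∃ u, OrbitRep (red n₁ M₀) (red n₁ M) (red n₁ N) u)
    (r₂ : ∃ u, OrbitRep (red n₂ M₀) (red n₂ M) (red n₂ N) u) :
    ∃ γ : Gamma0 L, InOrbit M₀ M N γ := by
  obtain ⟨A, B, hAB⟩ := h.exists_completion
  have hs := isSymplecticBlocks_of_mem hAB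
  obtain ⟨u₁, r₁⟩ := r₁
  obtain ⟨u₂, r₂⟩ := r₂
  obtain ⟨E₁, T₁, hE₁, hT₁, hM₁⟩ := r₁.exists_completion (hs.map (Int.castRingHom (ZMod n₁)))
  obtain ⟨E₂, T₂, hE₂, hT₂, hM₂⟩ := r₂.exists_completion (hs.map (Int.castRingHom (ZMod n₂)))
  obtain ⟨E₁, rfl, -⟩ := exists_red_eq E₁
  obtain ⟨E₂, rfl, -⟩ := exists_red_eq E₂
  obtain ⟨T₁, rfl, hT₁'⟩ := exists_red_eq T₁
  obtain ⟨T₂, rfl, hT₂'⟩ := exists_red_eq T₂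
  obtain ⟨m, hm₁, hm₂, -⟩ := exists_crt hcop E₁ E₂
  obtain ⟨T, ht₁, ht₂, hT⟩ := exists_crt hcop T₁ T₂
  replace hT := hT (hT₁' hT₁) (hT₂' hT₂)
  have hdvd : ∀ z : ℤ, (n₁ : ℤ) ∣ z → (n₂ : ℤ) ∣ z → (L : ℤ) ∣ z := fun z h1 h2 => by
    rw [hL]; push_cast
    exact (Nat.isCoprime_iff_coprime.2 hcop).mul_dvd h1 h2
  have hdet : ∀ n : ℕ, (red n m).det = 1 → (n : ℤ) ∣ m.det - 1 := fun n hn => by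
    rw [red_det] at hn
    rw [← ZMod.intCast_eq_intCast_iff_dvd_sub, hn, Int.cast_one]
  obtain ⟨E, hE⟩ := exists_SL2_congr hL0 m (hdvd _ (hdet n₁ (hm₁ ▸ hE₁)) (hdet n₂ (hm₂ ▸ hE₂)))
  have hEn : ∀ n : ℕ, n ∣ L → red n (E : Matrix (Fin 2) (Fin 2) ℤ) = red n m := fun n hn =>
    red_eq_iff.2 fun i j => (Int.natCast_dvd_natCast.2 hn).trans (hE i j)
  set E' : Matrix (Fin 2) (Fin 2) ℤ := (E : Matrix (Fin 2) (Fin 2) ℤ)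
  have hdE : E'.det = 1 := E.det_coe
  have hEE : E'.adjugate * E' = 1 := by rw [adjugate_mul, hdE, one_smul]
  have hEE' : E' * E'.adjugate = 1 := by rw [mul_adjugate, hdE, one_smul]
  have hEEt : E'ᵀ * E'.adjugateᵀ = 1 := by rw [← transpose_mul, hEE, transpose_one]
  have hcong : ∀ i j, (L : ℤ) ∣ (M - E' * (M₀ * (E'ᵀ * (A + T * M)))) i j := by
    intro i j
    refine hdvd _ (red_eq_zero_iff.1 ?_ i j) (red_eq_zero_iff.1 ?_ i j)
    · simp only [map_sub, map_mul, map_add, red_transpose, hEn n₁ ⟨n₂, hL⟩, hm₁, ht₁]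
      rw [sub_eq_zero]; exact hM₁
    · simp only [map_sub, map_mul, map_add, red_transpose, hEn n₂ ⟨n₁, by rw [hL, mul_comm]⟩, hm₂,
        ht₂]
      rw [sub_eq_zero]; exact hM₂
  -- `γ = (1 0; -M₀ 1) (Eᵀ 0; 0 E⁻¹) (1 T; 0 1) (A B; M N)`
  have g1 : fromBlocks 1 T 0 1 ∈ symplecticGroup (Fin 2) ℤ :=
    fromBlocks_mem_symplectic_iff.2 ⟨by simp [hT], by simp, by simp⟩
  have g2 : fromBlocks E'ᵀ 0 0 E'.adjugate ∈ symplecticGroup (Fin 2) ℤ :=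
    fromBlocks_mem_symplectic_iff.2 ⟨by simp, by simp, by simp [hEEt]⟩
  have g3 : fromBlocks 1 0 (-M₀) 1 ∈ symplecticGroup (Fin 2) ℤ :=
    fromBlocks_mem_symplectic_iff.2 ⟨by simp, by simp [hM₀], by simp⟩
  have g := mul_mem g3 (mul_mem g2 (mul_mem g1 hAB))
  simp only [fromBlocks_multiply, Matrix.one_mul, Matrix.zero_mul, zero_add, add_zero] at g
  refine ⟨⟨⟨_, g⟩, fun i j => ?_⟩, E, ?_, ?_⟩
  · rw [toBlocks_fromBlocks₂₁]
    have e : -M₀ * (E'ᵀ * (A + T * M)) + E'.adjugate * M =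
        E'.adjugate * (M - E' * (M₀ * (E'ᵀ * (A + T * M)))) := by
      rw [Matrix.mul_sub, ← Matrix.mul_assoc _ E', hEE, Matrix.one_mul, Matrix.neg_mul]; abel
    rw [e, mul_apply]
    exact Finset.dvd_sum fun k _ => (hcong k j).mul_left _
  · simp only [pairM, Gamma0.mat, toBlocks_fromBlocks₁₁, toBlocks_fromBlocks₂₁]
    rw [Matrix.neg_mul, add_neg_cancel_left, ← Matrix.mul_assoc]
    simp only [E'] at hEE'
    rw [hEE', Matrix.one_mul]
  · simp only [pairN, Gamma0.mat, toBlocks_fromBlocks₁₂, toBlocks_fromBlocks₂₂]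
    rw [Matrix.neg_mul, add_neg_cancel_left, ← Matrix.mul_assoc]
    simp only [E'] at hEE'
    rw [hEE', Matrix.one_mul]

/-! ### The coefficient functions -/

section Char
variable {R : Type*} [CommRing R] {χ : MulChar R ℂ}

theorem char_sq_eq_one (hχ : χ ^ 2 = 1) {u : R} (hu : IsUnit u) : χ u ^ 2 = 1 := by
  have := congrArg (fun ψ : MulChar R ℂ => ψ u) hχ
  simpa [MulChar.pow_apply' χ two_ne_zero, MulChar.one_apply hu] using this

theorem char_conj (hχ : χ ^ 2 = 1) (u : R) : (starRingEnd ℂ) (χ u) = χ u := by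
  by_cases hu : IsUnit u
  · rcases sq_eq_sq_iff_eq_or_eq_neg.1 ((char_sq_eq_one hχ hu).trans (one_pow 2).symm) with h | h <;>
      simp [h]
  · simp [MulChar.map_nonunit χ hu]

theorem char_eq_of_mul_eq_one (hχ : χ ^ 2 = 1) {u v : R} (h : u * v = 1) : χ v = χ u := by
  have h1 := char_sq_eq_one hχ (IsUnit.of_mul_eq_one _ h)
  have h2 : χ u * χ v = 1 := by rw [← map_mul, h, map_one]
  calc χ v = χ u ^ 2 * χ v := by rw [h1, one_mul]
    _ = χ u * (χ u * χ v) := by ring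
    _ = χ u := by rw [h2, mul_one]

/-- The value of `χ(det A)` on the representations `(M N) = E (M₀ I) (A B; 0 D)` over `R`,
zero if there is none. It is read off a chosen representation; for quadratic `χ` and diagonal
idempotent `M₀` it does not depend on the choice, by `localCoeff_eq`. -/
noncomputable def localCoeff (χ : MulChar R ℂ) (M₀ M N : Matrix (Fin 2) (Fin 2) R) : ℂ :=
  open Classical in if h : ∃ u, OrbitRep M₀ M N u then χ h.choose else 0

theorem char_eq_of_orbitRep (hχ : χ ^ 2 = 1) {x y : R} (hx : x * x = x) (hy : y * y = y)
    (hxy : x * y = y) {M N : Matrix (Fin 2) (Fin 2) R} {u u' : R}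
    (h : OrbitRep (diagonal ![x, y]) M N u) (h' : OrbitRep (diagonal ![x, y]) M N u') :
    χ u' = χ u := by
  obtain ⟨s, rfl⟩ := h.det_eq_sq_mul hx hy hxy h'
  have hs : IsUnit s := by
    have := h'.isUnit
    rw [IsUnit.mul_iff, isUnit_pow_iff two_ne_zero] at this
    exact this.1
  rw [map_mul, map_pow, char_sq_eq_one hχ hs, one_mul]

theorem localCoeff_eq (hχ : χ ^ 2 = 1) {x y : R} (hx : x * x = x) (hy : y * y = y)
    (hxy : x * y = y) {M N : Matrix (Fin 2) (Fin 2) R} {u : R}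
    (h : OrbitRep (diagonal ![x, y]) M N u) : localCoeff χ (diagonal ![x, y]) M N = χ u := by
  have h' : ∃ u, OrbitRep (diagonal ![x, y]) M N u := ⟨u, h⟩
  rw [localCoeff, dif_pos h']
  exact char_eq_of_orbitRep hχ hx hy hxy h h'.choose_spec

theorem localCoeff_eq_zero {M₀ M N : Matrix (Fin 2) (Fin 2) R} (h : ¬ ∃ u, OrbitRep M₀ M N u) :
    localCoeff χ M₀ M N = 0 := by
  rw [localCoeff, dif_neg h]

/-- The effect on the local coefficient of a left multiplication by an invertible `g` and of a symmetric
translation. -/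
theorem localCoeff_mul_left (hχ : χ ^ 2 = 1) {x y : R} (hx : x * x = x) (hy : y * y = y)
    (hxy : x * y = y) {M N g Z : Matrix (Fin 2) (Fin 2) R} (hg : IsUnit g.det) (hZ : Zᵀ = Z) :
    localCoeff χ (diagonal ![x, y]) (g * M) (g * (N + M * Z)) =
      χ g.det * localCoeff χ (diagonal ![x, y]) M N := by
  obtain ⟨h', hh⟩ := hg.exists_right_inv
  by_cases h : ∃ u, OrbitRep (diagonal ![x, y]) M N u
  · obtain ⟨u, hu⟩ := h
    obtain ⟨s, hs⟩ := (hu.shift hZ).mul_left hy hh rfl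
    have hsu : IsUnit s := by
      have := hs.isUnit
      rw [IsUnit.mul_iff, isUnit_pow_iff two_ne_zero] at this
      exact this.2
    rw [localCoeff_eq hχ hx hy hxy hu, localCoeff_eq hχ hx hy hxy hs, map_mul, map_mul, map_pow,
      char_sq_eq_one hχ hsu]
    ring
  · rw [localCoeff_eq_zero h, mul_zero]
    refine localCoeff_eq_zero fun ⟨u, hu⟩ => h ?_
    have hgg : h' • g.adjugate * g = 1 := by
      rw [Matrix.smul_mul, adjugate_mul, smul_smul, mul_comm, hh, one_smul]
    have hd : (h' • g.adjugate).det * g.det = 1 := by rw [← det_mul, hgg, det_one]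
    obtain ⟨s, hs⟩ := hu.mul_left hy hd rfl
    rw [← Matrix.mul_assoc, ← Matrix.mul_assoc, hgg, Matrix.one_mul, Matrix.one_mul] at hs
    have := hs.shift (Z := -Z) (by rw [transpose_neg, hZ])
    rw [Matrix.mul_neg, add_neg_cancel_right] at this
    exact ⟨_, this⟩

end Char

/-- The coefficient `χ(det D_γ)` for `(M N) ∈ SL₂(ℤ)(M₀ I)γ`, zero outside of the orbit. It is read
off a chosen `γ`; that the choice does not matter is `orbitCoeff_eq`. -/
noncomputable def orbitCoeff {n : ℕ} (χ : DirichletCharacter ℂ n) (L : ℕ)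
    (M₀ M N : Matrix (Fin 2) (Fin 2) ℤ) : ℂ :=
  open Classical in if h : ∃ γ : Gamma0 L, InOrbit M₀ M N γ then
    χ ((h.choose.mat.toBlocks₂₂.det : ℤ) : ZMod n) else 0

theorem orbitCoeff_eq_zero {n : ℕ} {χ : DirichletCharacter ℂ n} {L : ℕ}
    {M₀ M N : Matrix (Fin 2) (Fin 2) ℤ} (h : ¬ ∃ γ : Gamma0 L, InOrbit M₀ M N γ) :
    orbitCoeff χ L M₀ M N = 0 := by
  rw [orbitCoeff, dif_neg h]

theorem char_det_D {n : ℕ} {χ : DirichletCharacter ℂ n} (hχ : χ ^ 2 = 1) {L : ℕ} (hn : n ∣ L)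
    (γ : Gamma0 L) : χ ((γ.mat.toBlocks₂₂.det : ℤ) : ZMod n) =
      χ ((γ.mat.toBlocks₁₁.det : ℤ) : ZMod n) := by
  refine char_eq_of_mul_eq_one hχ ?_
  rw [← red_det, ← red_det, ← det_transpose (red n γ.mat.toBlocks₂₂), ← det_mul, red_AD hn, det_one]

theorem orbitCoeff_eq {n : ℕ} {χ : DirichletCharacter ℂ n} (hχ : χ ^ 2 = 1) {L : ℕ} (hn : n ∣ L)
    {x y : ℤ} (hx : (x * x : ZMod n) = x) (hy : (y * y : ZMod n) = y) (hxy : (x * y : ZMod n) = y)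
    {M N : Matrix (Fin 2) (Fin 2) ℤ} {γ : Gamma0 L} (h : InOrbit (diagonal ![x, y]) M N γ) :
    orbitCoeff χ L (diagonal ![x, y]) M N = χ ((γ.mat.toBlocks₁₁.det : ℤ) : ZMod n) := by
  have h' : ∃ γ : Gamma0 L, InOrbit (diagonal ![x, y]) M N γ := ⟨γ, h⟩
  rw [orbitCoeff, dif_pos h', char_det_D hχ hn]
  have r := h.orbitRep hn
  have r' := h'.choose_spec.orbitRep hn
  rw [red_diagonal] at r r'
  exact char_eq_of_orbitRep hχ hx hy hxy r r'

/-! ### Primitive pairs and rational symmetric matrices -/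

/-- The symmetric matrix `(a b; b c)` of a triple `(a, b, c)`. Triples serve as the coordinates of
symmetric matrices throughout. -/
def sym {R : Type*} (s : R × R × R) : Matrix (Fin 2) (Fin 2) R := !![s.1, s.2.1; s.2.1, s.2.2]

theorem sym_transpose {R : Type*} (s : R × R × R) : (sym s)ᵀ = sym s := by
  ext i j; fin_cases i <;> fin_cases j <;> rfl

theorem eq_sym {R : Type*} {S : Matrix (Fin 2) (Fin 2) R} (h : Sᵀ = S) :
    S = sym (S 0 0, S 0 1, S 1 1) := by
  have h10 : S 1 0 = S 0 1 := congr_fun (congr_fun h 0) 1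
  ext i j; fin_cases i <;> fin_cases j <;> simp [sym, h10]

theorem sym_injective {R : Type*} : Function.Injective (sym (R := R)) := by
  rintro ⟨a, b, c⟩ ⟨a', b', c'⟩ h
  have h00 := congr_fun (congr_fun h 0) 0
  have h01 := congr_fun (congr_fun h 0) 1
  have h11 := congr_fun (congr_fun h 1) 1
  simp only [sym, of_apply, cons_val', cons_val_zero, cons_val_one, cons_val_fin_one] at h00 h01 h11
  rw [h00, h01, h11]

theorem sym_add {R : Type*} [Add R] (s t : R × R × R) : sym (s + t) = sym s + sym t := by
  ext i j; fin_cases i <;> fin_cases j <;> rfl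

/-- An integral matrix as a rational one. -/
def toRat : Matrix (Fin 2) (Fin 2) ℤ →+* Matrix (Fin 2) (Fin 2) ℚ :=
  (Int.castRingHom ℚ).mapMatrix

theorem toRat_apply (M : Matrix (Fin 2) (Fin 2) ℤ) (i j) : toRat M i j = (M i j : ℚ) := rfl

theorem toRat_det (M : Matrix (Fin 2) (Fin 2) ℤ) : (toRat M).det = (M.det : ℚ) :=
  ((Int.castRingHom ℚ).map_det M).symm

theorem toRat_transpose (M : Matrix (Fin 2) (Fin 2) ℤ) : toRat Mᵀ = (toRat M)ᵀ := rfl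

theorem toRat_injective : Function.Injective toRat := fun M M' h => by
  ext i j
  have := congr_fun (congr_fun h i) j
  rw [toRat_apply, toRat_apply] at this
  exact_mod_cast this

theorem mul_left_cancel_of_det_ne_zero {K : Type*} [CommRing K] [IsDomain K]
    {g A B : Matrix (Fin 2) (Fin 2) K} (hg : g.det ≠ 0) (h : g * A = g * B) : A = B := by
  have := congrArg (g.adjugate * ·) h
  simp only [← Matrix.mul_assoc, adjugate_mul, Matrix.smul_mul, Matrix.one_mul] at this
  ext i j
  have := congr_fun (congr_fun this i) j
  simpa [hg] using this

theorem mul_right_cancel_of_det_ne_zero {K : Type*} [CommRing K] [IsDomain K]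
    {g A B : Matrix (Fin 2) (Fin 2) K} (hg : g.det ≠ 0) (h : A * g = B * g) : A = B := by
  have := congrArg transpose h
  rw [transpose_mul, transpose_mul] at this
  exact transpose_injective (mul_left_cancel_of_det_ne_zero (by rwa [det_transpose]) this)

/-- A symmetric pair of full rank is the left multiple of a primitive one: take for `g` a basis of
the lattice spanned by the columns. -/
theorem exists_primPair_of_symm {M N : Matrix (Fin 2) (Fin 2) ℤ} (hs : M * Nᵀ = N * Mᵀ)
    (hM : M.det ≠ 0) : ∃ g M' N' : Matrix (Fin 2) (Fin 2) ℤ, M = g * M' ∧ N = g * N' ∧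
      IsPrimPair M' N' := by
  set P := fromCols M N
  set Λ := LinearMap.range P.mulVecLin
  have hcM : ∀ v, M *ᵥ v ∈ Λ := fun v => ⟨Sum.elim v 0, by simp [P]⟩
  have hcN : ∀ v, N *ᵥ v ∈ Λ := fun v => ⟨Sum.elim 0 v, by simp [P]⟩
  have hfin : Module.finrank ℤ Λ = 2 := by
    apply le_antisymm
    · have := Submodule.finrank_le Λ
      simpa using this
    · have hinj : Function.Injective (LinearMap.codRestrict Λ M.mulVecLin hcM) := by
        intro v w h
        have h1 : M *ᵥ v = M *ᵥ w := congrArg Subtype.val h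
        exact mulVec_injective_of_det_ne_zero hM h1
      have := LinearMap.finrank_le_finrank_of_injective hinj
      simpa using this
  let b := Module.finBasisOfFinrankEq ℤ Λ hfin
  let g : Matrix (Fin 2) (Fin 2) ℤ := of fun i j => (b j : Fin 2 → ℤ) i
  have hg : ∀ v : Λ, g *ᵥ (b.repr v) = v := by
    intro v
    have := congrArg Subtype.val (b.sum_repr v)
    ext i
    rw [← congr_fun this i]
    simp only [Fin.sum_univ_two, Submodule.coe_add, Submodule.coe_smul, Pi.add_apply, Pi.smul_apply,
      smul_eq_mul, mulVec, dotProduct, g, of_apply]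
    ring
  let M' : Matrix (Fin 2) (Fin 2) ℤ := of fun i j => b.repr ⟨M *ᵥ Pi.single j 1, hcM _⟩ i
  let N' : Matrix (Fin 2) (Fin 2) ℤ := of fun i j => b.repr ⟨N *ᵥ Pi.single j 1, hcN _⟩ i
  have eM : M = g * M' := by
    ext i j
    have := congr_fun (hg ⟨M *ᵥ Pi.single j 1, hcM _⟩) i
    simp only [mulVec_single_one] at this
    rw [mul_apply]
    simpa [mulVec, dotProduct, M'] using this.symm
  have eN : N = g * N' := by
    ext i j
    have := congr_fun (hg ⟨N *ᵥ Pi.single j 1, hcN _⟩) i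
    simp only [mulVec_single_one] at this
    rw [mul_apply]
    simpa [mulVec, dotProduct, N'] using this.symm
  have hgdet : g.det ≠ 0 := by
    intro h0
    rw [eM, det_mul, h0, zero_mul] at hM
    exact hM rfl
  choose r hr using fun j => (b j).2
  have eg : g = M * (of fun i j => r j (Sum.inl i)) + N * (of fun i j => r j (Sum.inr i)) := by
    ext i j
    have := congr_fun (hr j) i
    simp only [g, of_apply]
    rw [← this]
    simp [P, mulVec, dotProduct, mul_apply]
  refine ⟨g, M', N', eM, eN, ⟨?_, _, _, mul_left_cancel_of_det_ne_zero hgdet (A := M' *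
    (of fun i j => r j (Sum.inl i)) + N' * (of fun i j => r j (Sum.inr i))) (B := 1) ?_⟩⟩
  · rw [eM, eN, transpose_mul, transpose_mul] at hs
    apply mul_left_cancel_of_det_ne_zero hgdet
    apply mul_right_cancel_of_det_ne_zero (g := gᵀ) (by rwa [det_transpose])
    simpa only [Matrix.mul_assoc] using hs
  · rw [Matrix.mul_add, ← Matrix.mul_assoc, ← Matrix.mul_assoc, ← eM, ← eN, ← eg, Matrix.mul_one]

/-- Every rational symmetric `S` is `M⁻¹N` for a primitive symmetric pair with `det M > 0`. -/
theorem exists_primPair (s : ℚ × ℚ × ℚ) : ∃ M N : Matrix (Fin 2) (Fin 2) ℤ, IsPrimPair M N ∧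
    0 < M.det ∧ toRat N = toRat M * sym s := by
  obtain ⟨a, b, c⟩ := s
  set d : ℤ := a.den * b.den * c.den with hd
  have hd0 : d ≠ 0 := by simp [hd]
  let N : Matrix (Fin 2) (Fin 2) ℤ := sym (a.num * b.den * c.den, b.num * a.den * c.den,
    c.num * a.den * b.den)
  have hNs : toRat N = toRat (diagonal ![d, d]) * sym (a, b, c) := by
    have ha := Rat.mul_den_eq_num a
    have hb := Rat.mul_den_eq_num b
    have hc := Rat.mul_den_eq_num c
    ext i j
    fin_cases i <;> fin_cases j <;>
      simp [N, sym, toRat_apply, mul_apply, Fin.sum_univ_two, hd] <;>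
      simp only [← ha, ← hb, ← hc] <;> ring
  obtain ⟨g, M', N', eM, eN, hp⟩ := exists_primPair_of_symm (M := diagonal ![d, d]) (N := N)
    (by ext i j; fin_cases i <;> fin_cases j <;>
          simp [N, sym, mul_apply, Fin.sum_univ_two, mul_comm])
    (by simp [det_diagonal, hd0])
  have hg : g.det ≠ 0 ∧ M'.det ≠ 0 := by
    have := congrArg det eM
    rw [det_mul, det_diagonal] at this
    constructor <;> rintro h <;> simp [h, hd0] at this
  have hS : toRat N' = toRat M' * sym (a, b, c) := by
    rw [eM, eN, map_mul, map_mul, Matrix.mul_assoc] at hNs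
    exact mul_left_cancel_of_det_ne_zero (by rw [toRat_det]; exact_mod_cast hg.1) hNs
  rcases lt_or_gt_of_ne hg.2 with hneg | hpos
  · let ρ : Matrix (Fin 2) (Fin 2) ℤ := diagonal ![1, -1]
    have hρ : ρ * ρ = 1 := by
      rw [diagonal_mul_diagonal, ← diagonal_one]; congr 1; funext i; fin_cases i <;> rfl
    obtain ⟨hs, X, Y, hXY⟩ := hp
    refine ⟨ρ * M', ρ * N', ⟨?_, X * ρ, Y * ρ, ?_⟩, ?_, ?_⟩
    · rw [transpose_mul, transpose_mul, Matrix.mul_assoc, ← Matrix.mul_assoc M', hs]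
      simp only [Matrix.mul_assoc]
    · have : ρ * M' * (X * ρ) + ρ * N' * (Y * ρ) = ρ * (M' * X + N' * Y) * ρ := by
        simp only [Matrix.mul_add, Matrix.add_mul, Matrix.mul_assoc]
      rw [this, hXY, Matrix.mul_one, hρ]
    · rw [det_mul, det_diagonal]; simpa using hneg
    · rw [map_mul, map_mul, hS, Matrix.mul_assoc]
  · exact ⟨M', N', hp, hpos, hS⟩

/-- A primitive symmetric pair with `det M > 0` is determined up to `SL₂(ℤ)` by its slope `M⁻¹N`. -/
theorem exists_SL2_of_slope_eq {S : Matrix (Fin 2) (Fin 2) ℚ} {M N M' N' : Matrix (Fin 2) (Fin 2) ℤ}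
    (h : IsPrimPair M N) (h' : IsPrimPair M' N') (hd : 0 < M.det) (hd' : 0 < M'.det)
    (hS : toRat N = toRat M * S) (hS' : toRat N' = toRat M' * S) :
    ∃ E : SL(2, ℤ), M' = (E : Matrix (Fin 2) (Fin 2) ℤ) * M ∧
      N' = (E : Matrix (Fin 2) (Fin 2) ℤ) * N := by
  have key : ∀ {M N M' N' : Matrix (Fin 2) (Fin 2) ℤ}, IsPrimPair M N → toRat N = toRat M * S →
      toRat N' = toRat M' * S → ∃ E, M' = E * M := by
    rintro M N M' N' ⟨-, X, Y, hXY⟩ hS hS'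
    refine ⟨M' * X + N' * Y, toRat_injective ?_⟩
    have h1 := congrArg toRat hXY
    rw [map_add, map_mul, map_mul, hS, Matrix.mul_assoc, ← Matrix.mul_add, map_one] at h1
    have h2 := mul_comm_eq_one h1
    rw [map_mul, map_add, map_mul, map_mul, hS', Matrix.mul_assoc, ← Matrix.mul_add,
      Matrix.mul_assoc, h2, Matrix.mul_one]
  obtain ⟨E, hE⟩ := key h hS hS'
  obtain ⟨F, hF⟩ := key h' hS' hS
  have hdE : E.det = 1 := by
    have e1 : M'.det = E.det * M.det := by rw [hE, det_mul]
    have e2 : M.det = F.det * M'.det := by rw [← det_mul, ← hF]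
    have hE0 : 0 < E.det := by
      by_contra hcon
      nlinarith
    have hu : IsUnit E.det := by
      refine IsUnit.of_mul_eq_one F.det ?_
      have : M'.det * (E.det * F.det) = M'.det * 1 := by
        rw [mul_one]; nth_rewrite 2 [e1]; rw [e2]; ring
      exact mul_left_cancel₀ hd'.ne' this
    rcases Int.isUnit_iff.1 hu with h1 | h1
    · exact h1
    · omega
  refine ⟨⟨E, hdE⟩, hE, toRat_injective ?_⟩
  rw [map_mul, hS', hS, ← Matrix.mul_assoc, ← map_mul, ← hE]

/-- The denominator `M` of a rational symmetric matrix `S = M⁻¹N`, with `det M > 0`; it is unique up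
to left multiplication by `SL₂(ℤ)`, and one choice is fixed here. -/
noncomputable def denM (s : ℚ × ℚ × ℚ) : Matrix (Fin 2) (Fin 2) ℤ := (exists_primPair s).choose

/-- The numerator `N` of a rational symmetric matrix `S = M⁻¹N` that belongs to `denM`. -/
noncomputable def denN (s : ℚ × ℚ × ℚ) : Matrix (Fin 2) (Fin 2) ℤ :=
  (exists_primPair s).choose_spec.choose

theorem den_spec (s : ℚ × ℚ × ℚ) : IsPrimPair (denM s) (denN s) ∧ 0 < (denM s).det ∧
    toRat (denN s) = toRat (denM s) * sym s :=
  (exists_primPair s).choose_spec.choose_spec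

/-! ### Invariance of the coefficients -/

/-- `diag(x, y)` is, modulo `n`, a diagonal matrix of idempotents `y ≤ x`. -/
structure IdempotentMod (n : ℕ) (x y : ℤ) : Prop where
  x_sq : (x * x : ZMod n) = x
  y_sq : (y * y : ZMod n) = y
  xy : (x * y : ZMod n) = y

theorem orbitCoeff_congr {n : ℕ} {χ : DirichletCharacter ℂ n} {L : ℕ}
    {M₀ M N M' N' : Matrix (Fin 2) (Fin 2) ℤ}
    (h : ∀ γ : Gamma0 L, InOrbit M₀ M N γ ↔ InOrbit M₀ M' N' γ) :
    orbitCoeff χ L M₀ M N = orbitCoeff χ L M₀ M' N' := by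
  have : InOrbit (L := L) M₀ M N = InOrbit M₀ M' N' := funext fun γ => propext (h γ)
  unfold orbitCoeff
  rw [this]

theorem SL2_inv_mul (E : SL(2, ℤ)) : ((E⁻¹ : SL(2, ℤ)) : Matrix (Fin 2) (Fin 2) ℤ) *
    (E : Matrix (Fin 2) (Fin 2) ℤ) = 1 := by
  rw [← Matrix.SpecialLinearGroup.coe_mul, inv_mul_cancel, Matrix.SpecialLinearGroup.coe_one]

theorem SL2_mul_inv (E : SL(2, ℤ)) : (E : Matrix (Fin 2) (Fin 2) ℤ) *
    ((E⁻¹ : SL(2, ℤ)) : Matrix (Fin 2) (Fin 2) ℤ) = 1 := by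
  rw [← Matrix.SpecialLinearGroup.coe_mul, mul_inv_cancel, Matrix.SpecialLinearGroup.coe_one]

theorem InOrbit.mul_left {L : ℕ} {M₀ M N : Matrix (Fin 2) (Fin 2) ℤ} {γ : Gamma0 L}
    (h : InOrbit M₀ M N γ) (E : SL(2, ℤ)) :
    InOrbit M₀ ((E : Matrix (Fin 2) (Fin 2) ℤ) * M) ((E : Matrix (Fin 2) (Fin 2) ℤ) * N) γ := by
  obtain ⟨F, rfl, rfl⟩ := h
  exact ⟨E * F, by rw [Matrix.SpecialLinearGroup.coe_mul, Matrix.mul_assoc],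
    by rw [Matrix.SpecialLinearGroup.coe_mul, Matrix.mul_assoc]⟩

theorem orbitCoeff_SL2 {n : ℕ} {χ : DirichletCharacter ℂ n} {L : ℕ}
    {M₀ M N : Matrix (Fin 2) (Fin 2) ℤ} (E : SL(2, ℤ)) :
    orbitCoeff χ L M₀ ((E : Matrix (Fin 2) (Fin 2) ℤ) * M) ((E : Matrix (Fin 2) (Fin 2) ℤ) * N) =
      orbitCoeff χ L M₀ M N := by
  refine orbitCoeff_congr fun γ => ⟨fun h => ?_, fun h => h.mul_left E⟩
  have := h.mul_left E⁻¹
  rwa [← Matrix.mul_assoc, ← Matrix.mul_assoc, SL2_inv_mul, Matrix.one_mul, Matrix.one_mul] at this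

theorem InOrbit.mul_right {L : ℕ} {M₀ M N P P' : Matrix (Fin 2) (Fin 2) ℤ} {γ : Gamma0 L}
    (h : InOrbit M₀ M N γ) (hP : P * P'ᵀ = 1) :
    ∃ γ' : Gamma0 L, InOrbit M₀ (M * P) (N * P') γ' ∧
      γ'.mat.toBlocks₁₁.det = γ.mat.toBlocks₁₁.det * P.det := by
  obtain ⟨E, rfl, rfl⟩ := h
  have hP' : P' * Pᵀ = 1 := by simpa [transpose_mul] using congrArg transpose hP
  have hb := γ.blocks
  have hC := γ.2
  obtain ⟨γ', h1, h2, h3, h4⟩ := exists_gamma0 (L := L) (A := γ.mat.toBlocks₁₁ * P)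
    (B := γ.mat.toBlocks₁₂ * P') (C := γ.mat.toBlocks₂₁ * P) (D := γ.mat.toBlocks₂₂ * P')
    (by rw [transpose_mul, transpose_mul, Matrix.mul_assoc, ← Matrix.mul_assoc P, hP, Matrix.one_mul,
          Matrix.mul_assoc, ← Matrix.mul_assoc P', hP', Matrix.one_mul, hb.AB])
    (by rw [transpose_mul, transpose_mul, Matrix.mul_assoc, ← Matrix.mul_assoc P, hP, Matrix.one_mul,
          Matrix.mul_assoc, ← Matrix.mul_assoc P', hP', Matrix.one_mul, hb.CD])
    (by rw [transpose_mul, transpose_mul, Matrix.mul_assoc, ← Matrix.mul_assoc P, hP, Matrix.one_mul,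
          Matrix.mul_assoc, ← Matrix.mul_assoc P', hP', Matrix.one_mul, hb.AD])
    (fun i j => by rw [mul_apply]; exact Finset.dvd_sum fun k _ => (hC i k).mul_right _)
  refine ⟨γ', ⟨E, ?_, ?_⟩, by rw [h1, det_mul]⟩
  · simp only [pairM, h1, h3, Matrix.mul_assoc, Matrix.mul_add, Matrix.add_mul]
  · simp only [pairN, h2, h4, Matrix.mul_assoc, Matrix.mul_add, Matrix.add_mul]

theorem orbitCoeff_mul_right {n : ℕ} {χ : DirichletCharacter ℂ n} (hχ : χ ^ 2 = 1) {L : ℕ}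
    (hn : n ∣ L) {x y : ℤ} (hxy : IdempotentMod n x y) {M N P P' : Matrix (Fin 2) (Fin 2) ℤ}
    (hP : P * P'ᵀ = 1) (hd : P.det = 1) :
    orbitCoeff χ L (diagonal ![x, y]) (M * P) (N * P') = orbitCoeff χ L (diagonal ![x, y]) M N := by
  by_cases h : ∃ γ : Gamma0 L, InOrbit (diagonal ![x, y]) M N γ
  · obtain ⟨γ, hγ⟩ := h
    obtain ⟨γ', hγ', hdet⟩ := hγ.mul_right hP
    rw [orbitCoeff_eq hχ hn hxy.1 hxy.2 hxy.3 hγ, orbitCoeff_eq hχ hn hxy.1 hxy.2 hxy.3 hγ', hdet, hd,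
      mul_one]
  · rw [orbitCoeff_eq_zero h]
    refine orbitCoeff_eq_zero fun ⟨γ, hγ⟩ => h ?_
    have hP' : P' * Pᵀ = 1 := by simpa [transpose_mul] using congrArg transpose hP
    obtain ⟨γ', hγ', -⟩ := hγ.mul_right (P := P'ᵀ) (P' := Pᵀ)
      (by rw [transpose_transpose]; exact mul_comm_eq_one hP)
    rw [Matrix.mul_assoc, Matrix.mul_assoc, hP, hP', Matrix.mul_one, Matrix.mul_one] at hγ'
    exact ⟨γ', hγ'⟩

/-- The reflection `diag(1, ±1)`, with the sign `-1` for `true`. -/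
def refl (b : Bool) : Matrix (Fin 2) (Fin 2) ℤ := diagonal ![1, if b then -1 else 1]

theorem refl_mul_self (b : Bool) : refl b * refl b = 1 := by
  rw [refl, diagonal_mul_diagonal, ← diagonal_one]
  congr 1; funext i; cases b <;> fin_cases i <;> rfl

theorem refl_det (b : Bool) : (refl b).det = if b then -1 else 1 := by
  rw [refl, det_diagonal]; cases b <;> rfl

theorem refl_transpose (b : Bool) : (refl b)ᵀ = refl b := diagonal_transpose _

theorem refl_false : refl false = 1 := by
  ext i j; fin_cases i <;> fin_cases j <;> rfl

/-- The reflection `diag(1, ±1)` commutes with `diag(x, y)`, so that it can be moved into `Γ₀(L)`. -/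
theorem InOrbit.reflect {L : ℕ} {x y : ℤ} {M N : Matrix (Fin 2) (Fin 2) ℤ} {γ : Gamma0 L}
    (h : InOrbit (diagonal ![x, y]) M N γ) (b : Bool) :
    ∃ γ' : Gamma0 L, InOrbit (diagonal ![x, y]) (refl b * M) (refl b * N) γ' ∧
      γ'.mat.toBlocks₁₁.det = (if b then -1 else 1) * γ.mat.toBlocks₁₁.det := by
  obtain ⟨E, rfl, rfl⟩ := h
  have hb := γ.blocks
  have hC := γ.2
  have r2 := refl_mul_self b
  have assoc : ∀ X Y : Matrix (Fin 2) (Fin 2) ℤ,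
      refl b * X * (refl b * Y)ᵀ = refl b * (X * Yᵀ) * refl b := fun X Y => by
    rw [transpose_mul, refl_transpose]; simp only [Matrix.mul_assoc]
  obtain ⟨γ', h1, h2, h3, h4⟩ := exists_gamma0 (L := L) (A := refl b * γ.mat.toBlocks₁₁)
    (B := refl b * γ.mat.toBlocks₁₂) (C := refl b * γ.mat.toBlocks₂₁)
    (D := refl b * γ.mat.toBlocks₂₂)
    (by rw [assoc, hb.AB, ← assoc])
    (by rw [assoc, hb.CD, ← assoc])
    (by rw [assoc, assoc, ← Matrix.sub_mul, ← Matrix.mul_sub, hb.AD, Matrix.mul_one, r2])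
    (fun i j => by rw [mul_apply]; exact Finset.dvd_sum fun k _ => (hC k j).mul_left _)
  have hcomm : diagonal ![x, y] * refl b = refl b * diagonal ![x, y] := by
    rw [refl, diagonal_mul_diagonal, diagonal_mul_diagonal]
    congr 1; funext i; exact mul_comm _ _
  refine ⟨γ', ⟨⟨refl b * E * refl b, ?_⟩, ?_, ?_⟩, by rw [h1, det_mul, refl_det]⟩
  · rw [det_mul, det_mul, E.det_coe, mul_one, ← det_mul, r2, det_one]
  · have e : pairM (diagonal ![x, y]) γ' = refl b * pairM (diagonal ![x, y]) γ := by
      simp only [pairM, h1, h3]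
      rw [← Matrix.mul_assoc _ (refl b), hcomm, Matrix.mul_assoc (refl b), ← Matrix.mul_add]
    rw [e, Matrix.mul_assoc _ (refl b), ← Matrix.mul_assoc (refl b) (refl b), r2, Matrix.one_mul,
      Matrix.mul_assoc]
  · have e : pairN (diagonal ![x, y]) γ' = refl b * pairN (diagonal ![x, y]) γ := by
      simp only [pairN, h2, h4]
      rw [← Matrix.mul_assoc _ (refl b), hcomm, Matrix.mul_assoc (refl b), ← Matrix.mul_add]
    rw [e, Matrix.mul_assoc _ (refl b), ← Matrix.mul_assoc (refl b) (refl b), r2, Matrix.one_mul,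
      Matrix.mul_assoc]

/-- Reflected pairs carry the factor `χ(-1) = (-1)^k`, which cancels the sign of `det(Mτ + N)^(-k)`. -/
theorem orbitCoeff_reflect {n : ℕ} {χ : DirichletCharacter ℂ n} (hχ : χ ^ 2 = 1) {L : ℕ}
    (hn : n ∣ L) {x y : ℤ} (hxy : IdempotentMod n x y) {M N : Matrix (Fin 2) (Fin 2) ℤ} :
    orbitCoeff χ L (diagonal ![x, y]) (refl true * M) (refl true * N) =
      χ (-1) * orbitCoeff χ L (diagonal ![x, y]) M N := by
  by_cases h : ∃ γ : Gamma0 L, InOrbit (diagonal ![x, y]) M N γ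
  · obtain ⟨γ, hγ⟩ := h
    obtain ⟨γ', hγ', hdet⟩ := hγ.reflect true
    rw [orbitCoeff_eq hχ hn hxy.1 hxy.2 hxy.3 hγ, orbitCoeff_eq hχ hn hxy.1 hxy.2 hxy.3 hγ', hdet,
      ← map_mul]
    simp
  · rw [orbitCoeff_eq_zero h, mul_zero]
    refine orbitCoeff_eq_zero fun ⟨γ, hγ⟩ => h ?_
    obtain ⟨γ', hγ', -⟩ := hγ.reflect true
    rw [← Matrix.mul_assoc, ← Matrix.mul_assoc, refl_mul_self, Matrix.one_mul, Matrix.one_mul] at hγ'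
    exact ⟨γ', hγ'⟩

/-! ### The Eisenstein series as a sum over rational symmetric matrices -/

/-- The coefficient of `det(τ + S)^(-k)` in the Eisenstein series, where `S = M⁻¹N` is the rational
symmetric matrix with triple `s`: a summand is `χ(det D_γ) det(M)^(-k) det(τ + S)^(-k)`. -/
noncomputable def wt {n : ℕ} (k : ℕ) (χ : DirichletCharacter ℂ n) (L : ℕ)
    (M₀ : Matrix (Fin 2) (Fin 2) ℤ) (s : ℚ × ℚ × ℚ) : ℂ :=
  orbitCoeff χ L M₀ (denM s) (denN s) * (((denM s).det : ℂ) ^ k)⁻¹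

theorem wt_eq {n : ℕ} (k : ℕ) (χ : DirichletCharacter ℂ n) (L : ℕ)
    (M₀ : Matrix (Fin 2) (Fin 2) ℤ) {s : ℚ × ℚ × ℚ} {M N : Matrix (Fin 2) (Fin 2) ℤ}
    (h : IsPrimPair M N) (hd : 0 < M.det) (hs : toRat N = toRat M * sym s) :
    wt k χ L M₀ s = orbitCoeff χ L M₀ M N * ((M.det : ℂ) ^ k)⁻¹ := by
  obtain ⟨h', hd', hs'⟩ := den_spec s
  obtain ⟨E, hM, hN⟩ := exists_SL2_of_slope_eq h' h hd' hd hs' hs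
  rw [wt, hM, hN, orbitCoeff_SL2, det_mul, E.det_coe, one_mul]

/-- A symmetric rational matrix as a complex one. -/
def symC (s : ℚ × ℚ × ℚ) : Matrix (Fin 2) (Fin 2) ℂ := (sym s).map (Rat.cast : ℚ → ℂ)

theorem map_eq_mul_symC {M N : Matrix (Fin 2) (Fin 2) ℤ} {s : ℚ × ℚ × ℚ}
    (hs : toRat N = toRat M * sym s) :
    N.map (Int.cast : ℤ → ℂ) = M.map (Int.cast : ℤ → ℂ) * symC s := by
  have := congrArg (fun X : Matrix (Fin 2) (Fin 2) ℚ => X.map (Rat.castHom ℂ)) hs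
  simp only [Matrix.map_mul] at this
  convert this using 1
  · ext i j; simp [toRat_apply]
  · congr 1

theorem det_pair_eq {M N : Matrix (Fin 2) (Fin 2) ℤ} {s : ℚ × ℚ × ℚ}
    (hs : toRat N = toRat M * sym s) (τ : Matrix (Fin 2) (Fin 2) ℂ) :
    (M.map (Int.cast : ℤ → ℂ) * τ + N.map (Int.cast : ℤ → ℂ)).det =
      (M.det : ℂ) * (τ + symC s).det := by
  rw [map_eq_mul_symC hs, ← Matrix.mul_add, det_mul]
  congr 1
  exact ((Int.castRingHom ℂ).map_det M).symm

theorem isPrimPair_reflect {M N : Matrix (Fin 2) (Fin 2) ℤ} (h : IsPrimPair M N) (b : Bool) :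
    IsPrimPair (refl b * M) (refl b * N) := by
  obtain ⟨hs, X, Y, hXY⟩ := h
  refine ⟨?_, X * refl b, Y * refl b, ?_⟩
  · rw [transpose_mul, transpose_mul, Matrix.mul_assoc, ← Matrix.mul_assoc M, hs]
    simp only [Matrix.mul_assoc]
  · have : refl b * M * (X * refl b) + refl b * N * (Y * refl b) =
        refl b * (M * X + N * Y) * refl b := by
      simp only [Matrix.mul_add, Matrix.add_mul, Matrix.mul_assoc]
    rw [this, hXY, Matrix.mul_one, refl_mul_self]

theorem exists_slope {M N : Matrix (Fin 2) (Fin 2) ℤ} (h : IsPrimPair M N) (hd : M.det ≠ 0) :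
    ∃ s, toRat N = toRat M * sym s := by
  have hd' : IsUnit (toRat M).det := by
    rw [toRat_det, isUnit_iff_ne_zero]; exact_mod_cast hd
  have hS : ((toRat M)⁻¹ * toRat N)ᵀ = (toRat M)⁻¹ * toRat N := by
    have hs := congrArg toRat h.symm
    rw [map_mul, map_mul, toRat_transpose, toRat_transpose] at hs
    have hdt : IsUnit (toRat M)ᵀ.det := by rwa [det_transpose]
    apply mul_left_cancel_of_det_ne_zero (g := toRat M) hd'.ne_zero
    apply mul_right_cancel_of_det_ne_zero (g := (toRat M)ᵀ) hdt.ne_zero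
    rw [transpose_mul, transpose_nonsing_inv, Matrix.mul_assoc, Matrix.mul_assoc,
      nonsing_inv_mul _ hdt, Matrix.mul_one, ← Matrix.mul_assoc (toRat M), mul_nonsing_inv _ hd',
      Matrix.one_mul, hs]
  refine ⟨(((toRat M)⁻¹ * toRat N) 0 0, ((toRat M)⁻¹ * toRat N) 0 1, ((toRat M)⁻¹ * toRat N) 1 1), ?_⟩
  rw [← eq_sym hS, ← Matrix.mul_assoc, mul_nonsing_inv _ hd', Matrix.one_mul]

/-- Every primitive symmetric pair with `det M ≠ 0` is, up to `SL₂(ℤ)`, one of the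
`(± reflected) (denM s, denN s)`. -/
theorem exists_index {M N : Matrix (Fin 2) (Fin 2) ℤ} (h : IsPrimPair M N) (hd : M.det ≠ 0) :
    ∃ (i : (ℚ × ℚ × ℚ) × Bool) (E : SL(2, ℤ)),
      refl i.2 * denM i.1 = (E : Matrix (Fin 2) (Fin 2) ℤ) * M ∧
      refl i.2 * denN i.1 = (E : Matrix (Fin 2) (Fin 2) ℤ) * N := by
  obtain ⟨s, hs⟩ := exists_slope h hd
  obtain ⟨b, hb⟩ : ∃ b, 0 < (refl b * M).det := by
    rcases lt_or_gt_of_ne hd with h1 | h1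
    · exact ⟨true, by rw [det_mul, refl_det]; simpa using h1⟩
    · exact ⟨false, by rw [det_mul, refl_det]; simpa using h1⟩
  obtain ⟨h', hd', hs'⟩ := den_spec s
  obtain ⟨E, hM, hN⟩ := exists_SL2_of_slope_eq (isPrimPair_reflect h b) h' hb hd'
    (by rw [map_mul, map_mul, hs, Matrix.mul_assoc]) hs'
  refine ⟨(s, b), ⟨refl b * E * refl b, ?_⟩, ?_, ?_⟩
  · rw [det_mul, det_mul, E.det_coe, mul_one, ← det_mul, refl_mul_self, det_one]
  · simp only [hM, Matrix.mul_assoc]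
  · simp only [hN, Matrix.mul_assoc]

theorem index_unique {i j : (ℚ × ℚ × ℚ) × Bool} {E : SL(2, ℤ)}
    (hM : refl i.2 * denM i.1 = (E : Matrix (Fin 2) (Fin 2) ℤ) * (refl j.2 * denM j.1))
    (hN : refl i.2 * denN i.1 = (E : Matrix (Fin 2) (Fin 2) ℤ) * (refl j.2 * denN j.1)) : i = j := by
  obtain ⟨s, b⟩ := i
  obtain ⟨t, c⟩ := j
  obtain ⟨-, hd, hs⟩ := den_spec s
  obtain ⟨-, hd', hs'⟩ := den_spec t
  simp only at hM hN
  have hdet := congrArg det hM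
  rw [det_mul, det_mul, det_mul, refl_det, refl_det, E.det_coe, one_mul] at hdet
  have hbc : b = c := by
    cases b <;> cases c <;> simp at hdet ⊢ <;> omega
  have hst : sym s = sym t := by
    have h1 := congrArg toRat hN
    have h2 := congrArg toRat hM
    rw [map_mul, map_mul, map_mul, hs, hs', ← Matrix.mul_assoc, ← map_mul, hM, map_mul, map_mul,
      ← Matrix.mul_assoc, ← Matrix.mul_assoc, ← Matrix.mul_assoc] at h1
    refine mul_left_cancel_of_det_ne_zero ?_ h1
    rw [← map_mul, ← map_mul, toRat_det, det_mul, det_mul, E.det_coe, one_mul, refl_det]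
    have : (if c = true then (-1 : ℤ) else 1) * (denM t).det ≠ 0 := by
      cases c <;> simp <;> omega
    exact_mod_cast this
  rw [hbc, sym_injective hst]

/-- The Eisenstein series as an absolutely convergent sum over the rational symmetric matrices. The
classes in the orbit are classified by the slope `M⁻¹N` and the sign of `det M`, and the factor `1/2`
in the definition of the series makes up for the two signs. -/
theorem eisenstein_eq_tsum {n k L : ℕ} (hk : 4 ≤ k) {χ : DirichletCharacter ℂ n} (hχ : χ ^ 2 = 1)
    (hpar : χ (-1) = (-1) ^ k) (hn : n ∣ L) {x y : ℤ} (hxy : IdempotentMod n x y)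
    (hdet : ∀ γ : Gamma0 L, (pairM (diagonal ![x, y]) γ).det ≠ 0)
    {τ : Matrix (Fin 2) (Fin 2) ℂ} (hτ : τ ∈ upperHalfSpace) :
    Summable (fun s => wt k χ L (diagonal ![x, y]) s * ((τ + symC s).det ^ k)⁻¹) ∧
    eisenstein k χ L (diagonal ![x, y]) τ =
      ∑' s, wt k χ L (diagonal ![x, y]) s * ((τ + symC s).det ^ k)⁻¹ := by
  set M₀ : Matrix (Fin 2) (Fin 2) ℤ := diagonal ![x, y] with hM₀
  have hM₀t : M₀ᵀ = M₀ := diagonal_transpose _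
  have hp : ∀ γ : Gamma0 L, IsPrimPair (pairM M₀ γ) (pairN M₀ γ) := isPrimPair_pair hM₀t
  set G : ℚ × ℚ × ℚ → ℂ := fun s => wt k χ L M₀ s * ((τ + symC s).det ^ k)⁻¹ with hG
  let F : (ℚ × ℚ × ℚ) × Bool → ℂ := fun i => orbitCoeff χ L M₀ (refl i.2 * denM i.1)
    (refl i.2 * denN i.1) * (((refl i.2 * denM i.1).map (Int.cast : ℤ → ℂ) * τ +
      (refl i.2 * denN i.1).map (Int.cast : ℤ → ℂ)).det ^ k)⁻¹
  -- both orientations contribute the same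
  have hFG : ∀ i, F i = G i.1 := by
    rintro ⟨s, b⟩
    obtain ⟨-, -, hs⟩ := den_spec s
    simp only [F, G]
    rw [det_pair_eq (s := s) (by rw [map_mul, map_mul, hs, Matrix.mul_assoc]), wt, det_mul, refl_det]
    cases b
    · simp [refl_false, mul_pow, mul_assoc]
      left; exact mul_comm _ _
    · rw [hM₀, orbitCoeff_reflect hχ hn hxy, hpar]
      have h1 : ((-1 : ℂ) ^ k) * ((-1 : ℂ) ^ k)⁻¹ = 1 := mul_inv_cancel₀ (by simp)
      simp only [if_true, Int.cast_mul, Int.cast_neg, Int.cast_one, mul_pow, mul_inv]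
      linear_combination (orbitCoeff χ L (diagonal ![x, y]) (denM s) (denN s) *
        (((denM s).det : ℂ) ^ k)⁻¹ * ((τ + symC s).det ^ k)⁻¹) * h1
  -- classes in the orbit correspond to slopes with a sign, and `F` vanishes off the image
  choose j E hjM hjN using fun c : Quotient (orbitSetoid L M₀) => exists_index (hp c.out) (hdet c.out)
  have hj : Function.Injective j := by
    intro c c' e
    have hM := (hjM c).symm.trans (e ▸ hjM c')
    have hN := (hjN c).symm.trans (e ▸ hjN c')
    rw [← Quotient.out_eq c, ← Quotient.out_eq c']
    refine Quotient.sound ⟨(E c')⁻¹ * E c, ?_, ?_⟩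
    · rw [Matrix.SpecialLinearGroup.coe_mul, Matrix.mul_assoc, hM, ← Matrix.mul_assoc, SL2_inv_mul,
        Matrix.one_mul]
    · rw [Matrix.SpecialLinearGroup.coe_mul, Matrix.mul_assoc, hN, ← Matrix.mul_assoc, SL2_inv_mul,
        Matrix.one_mul]
  have hFj : ∀ c, F (j c) = eisFamily k χ L M₀ τ c := by
    intro c
    have hin : InOrbit M₀ (pairM M₀ c.out) (pairN M₀ c.out) c.out := ⟨1, by simp, by simp⟩
    have hE : ∀ Z : Matrix (Fin 2) (Fin 2) ℤ, ((E c : Matrix (Fin 2) (Fin 2) ℤ) * Z).map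
        (Int.cast : ℤ → ℂ) = (E c : Matrix (Fin 2) (Fin 2) ℤ).map (Int.cast : ℤ → ℂ) *
          Z.map (Int.cast : ℤ → ℂ) := fun Z => Matrix.map_mul (f := Int.castRingHom ℂ)
    have hdE : ((E c : Matrix (Fin 2) (Fin 2) ℤ).map (Int.cast : ℤ → ℂ)).det = 1 := by
      have := (Int.castRingHom ℂ).map_det (E c : Matrix (Fin 2) (Fin 2) ℤ)
      rw [(E c).det_coe, map_one] at this
      exact this.symm
    simp only [F, eisFamily, eisTerm, hjM c, hjN c]
    rw [orbitCoeff_SL2, orbitCoeff_eq hχ hn hxy.1 hxy.2 hxy.3 hin, char_conj hχ, char_det_D hχ hn,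
      hE, hE, Matrix.mul_assoc, ← Matrix.mul_add, det_mul, hdE, one_mul]
  have hF0 : ∀ i, i ∉ Set.range j → F i = 0 := by
    intro i hi
    have : orbitCoeff χ L M₀ (refl i.2 * denM i.1) (refl i.2 * denN i.1) = 0 := by
      refine orbitCoeff_eq_zero fun ⟨γ, A, hA, hA'⟩ => hi ⟨Quotient.mk (orbitSetoid L M₀) γ, ?_⟩
      obtain ⟨B, hB, hB'⟩ : (orbitSetoid L M₀).r γ (Quotient.mk (orbitSetoid L M₀) γ).out :=
        (orbitSetoid L M₀).symm (Quotient.mk_out (s := orbitSetoid L M₀) γ)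
      refine index_unique (E := E (Quotient.mk (orbitSetoid L M₀) γ) * B * A⁻¹) ?_ ?_
      · rw [hjM, hB, hA]
        simp only [Matrix.SpecialLinearGroup.coe_mul, Matrix.mul_assoc]
        rw [← Matrix.mul_assoc _ (A : Matrix (Fin 2) (Fin 2) ℤ), SL2_inv_mul, Matrix.one_mul]
      · rw [hjN, hB', hA']
        simp only [Matrix.SpecialLinearGroup.coe_mul, Matrix.mul_assoc]
        rw [← Matrix.mul_assoc _ (A : Matrix (Fin 2) (Fin 2) ℤ), SL2_inv_mul, Matrix.one_mul]
    simp only [F, this, zero_mul]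
  have hsum := summable_eisFamily (L := L) hk χ hM₀t hτ
  have hFsum : Summable F := by
    rw [← hj.summable_iff hF0]
    exact hsum.congr fun c => (hFj c).symm
  have hGsum : Summable G := by
    have := hFsum.comp_injective (i := fun s => (s, false)) (fun s t h => congrArg Prod.fst h)
    exact this.congr fun s => hFG (s, false)
  refine ⟨hGsum, ?_⟩
  have h1 : ∑' c, eisFamily k χ L M₀ τ c = ∑' i, F i := by
    rw [← hj.tsum_eq (fun i hi => by_contra fun h => hi (hF0 i h))]
    exact tsum_congr fun c => (hFj c).symm
  rw [eisenstein, h1, hFsum.tsum_prod]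
  simp only [hFG, tsum_fintype, Finset.sum_const, Finset.card_univ, Fintype.card_bool]
  simp only [nsmul_eq_mul, tsum_mul_left]
  push_cast
  ring

/-! ### The twist operator on the coefficients -/

/-- The triple of entries of a symmetric matrix. -/
def tri {R : Type*} (S : Matrix (Fin 2) (Fin 2) R) : R × R × R := (S 0 0, S 0 1, S 1 1)

theorem sym_tri {R : Type*} {S : Matrix (Fin 2) (Fin 2) R} (h : Sᵀ = S) : sym (tri S) = S :=
  (eq_sym h).symm

theorem tri_sym {R : Type*} (s : R × R × R) : tri (sym s) = s := rfl

/-- The action `S ↦ P S ᵗP` on triples. -/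
def conj (P : Matrix (Fin 2) (Fin 2) ℚ) (s : ℚ × ℚ × ℚ) : ℚ × ℚ × ℚ := tri (P * sym s * Pᵀ)

theorem conj_symm {R : Type*} [CommRing R] (P : Matrix (Fin 2) (Fin 2) R)
    {S : Matrix (Fin 2) (Fin 2) R} (hS : Sᵀ = S) : (P * S * Pᵀ)ᵀ = P * S * Pᵀ := by
  simp only [transpose_mul, transpose_transpose, hS, Matrix.mul_assoc]

theorem sym_conj (P : Matrix (Fin 2) (Fin 2) ℚ) (s : ℚ × ℚ × ℚ) :
    sym (conj P s) = P * sym s * Pᵀ := sym_tri (conj_symm P (sym_transpose s))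

theorem conj_conj {P Q : Matrix (Fin 2) (Fin 2) ℚ} (h : P * Q = 1) (s : ℚ × ℚ × ℚ) :
    conj P (conj Q s) = s := by
  apply sym_injective
  have ht : Qᵀ * Pᵀ = 1 := by rw [← transpose_mul, h, transpose_one]
  have : P * (Q * sym s * Qᵀ) * Pᵀ = (P * Q) * sym s * (Qᵀ * Pᵀ) := by
    simp only [Matrix.mul_assoc]
  rw [sym_conj, sym_conj, this, h, ht, Matrix.one_mul, Matrix.mul_one]

/-- The triple of `Z / q`, for an integral symmetric matrix `Z`. -/
def divq (q : ℕ) (Z : Matrix (Fin 2) (Fin 2) ℤ) : ℚ × ℚ × ℚ := tri ((1 / (q : ℚ)) • toRat Z)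

theorem sym_divq (q : ℕ) {Z : Matrix (Fin 2) (Fin 2) ℤ} (hZ : Zᵀ = Z) :
    sym (divq q Z) = (1 / (q : ℚ)) • toRat Z :=
  sym_tri (by rw [transpose_smul, ← toRat_transpose, hZ])

/-- The coefficients are invariant under `S ↦ P S ᵗP` for `P ∈ SL₂(ℤ)`. -/
theorem wt_conj {n k L : ℕ} {χ : DirichletCharacter ℂ n} (hχ : χ ^ 2 = 1) (hn : n ∣ L) {x y : ℤ}
    (hxy : IdempotentMod n x y) (G : SL(2, ℤ)) (s : ℚ × ℚ × ℚ) :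
    wt k χ L (diagonal ![x, y]) (conj (toRat G) s) = wt k χ L (diagonal ![x, y]) s := by
  obtain ⟨⟨hs, X, Y, hXY⟩, hd, hS⟩ := den_spec s
  set g : Matrix (Fin 2) (Fin 2) ℤ := (G : Matrix (Fin 2) (Fin 2) ℤ)
  set g' : Matrix (Fin 2) (Fin 2) ℤ := ((G⁻¹ : SL(2, ℤ)) : Matrix (Fin 2) (Fin 2) ℤ)
  have h1 : g' * g = 1 := SL2_inv_mul G
  have h2 : gᵀ * g'ᵀ = 1 := by rw [← transpose_mul, h1, transpose_one]
  have hp : IsPrimPair (denM s * g') (denN s * gᵀ) := by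
    refine ⟨?_, g * X, g'ᵀ * Y, ?_⟩
    · rw [transpose_mul, transpose_transpose, Matrix.mul_assoc, ← Matrix.mul_assoc g', h1,
        Matrix.one_mul, transpose_mul, Matrix.mul_assoc, ← Matrix.mul_assoc gᵀ, h2, Matrix.one_mul, hs]
    · rw [Matrix.mul_assoc, ← Matrix.mul_assoc g', h1, Matrix.one_mul, Matrix.mul_assoc,
        ← Matrix.mul_assoc gᵀ, h2, Matrix.one_mul, hXY]
  have hdet : (denM s * g').det = (denM s).det := by
    rw [det_mul, (G⁻¹).det_coe, mul_one]
  rw [wt_eq k χ L _ hp (by rw [hdet]; exact hd), orbitCoeff_mul_right hχ hn hxy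
    (by rw [transpose_transpose, h1]) (G⁻¹).det_coe, hdet, wt]
  rw [sym_conj, map_mul, map_mul, hS, toRat_transpose]
  have : toRat (denM s) * toRat g' * (toRat g * sym s * (toRat g)ᵀ) =
      toRat (denM s) * (toRat g' * toRat g) * sym s * (toRat g)ᵀ := by simp only [Matrix.mul_assoc]
  rw [this, ← map_mul, h1, map_one, Matrix.mul_one]

/-- An integral matrix as a complex one. -/
def toC : Matrix (Fin 2) (Fin 2) ℤ →+* Matrix (Fin 2) (Fin 2) ℂ := (Int.castRingHom ℂ).mapMatrix

theorem toC_transpose (M : Matrix (Fin 2) (Fin 2) ℤ) : toC Mᵀ = (toC M)ᵀ := rfl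

theorem toC_det (M : Matrix (Fin 2) (Fin 2) ℤ) : (toC M).det = (M.det : ℂ) :=
  ((Int.castRingHom ℂ).map_det M).symm

theorem twist_mem_upperHalfSpace {q : ℕ} {G : SL(2, ℤ)} {Y : Matrix (Fin 2) (Fin 2) ℤ} (hY : Yᵀ = Y)
    {τ : Matrix (Fin 2) (Fin 2) ℂ} (hτ : τ ∈ upperHalfSpace) :
    toC G * τ * (toC G)ᵀ + (1 / (q : ℂ)) • toC Y ∈ upperHalfSpace := by
  obtain ⟨hs, hp⟩ := hτ
  refine ⟨?_, ?_⟩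
  · rw [transpose_add, conj_symm _ hs, transpose_smul, ← toC_transpose Y, hY]
  · let gR : Matrix (Fin 2) (Fin 2) ℝ := (G : Matrix (Fin 2) (Fin 2) ℤ).map (Int.cast : ℤ → ℝ)
    have hd : gR.det = 1 := by
      have := (Int.castRingHom ℝ).map_det (G : Matrix (Fin 2) (Fin 2) ℤ)
      rw [G.det_coe, map_one] at this
      exact this.symm
    have e : (toC G * τ * (toC G)ᵀ + (1 / (q : ℂ)) • toC Y).map Complex.im =
        gR * τ.map Complex.im * gRᴴ := by
      ext i j
      have h1 : ((1 / (q : ℂ)) * (Y i j : ℂ)).im = 0 := by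
        rw [← Complex.ofReal_natCast, ← Complex.ofReal_intCast, ← Complex.ofReal_one,
          ← Complex.ofReal_div, ← Complex.ofReal_mul, Complex.ofReal_im]
      have h2 : toC Y i j = (Y i j : ℂ) := rfl
      have h3 : ∀ i j, toC G i j = (((G i j : ℤ) : ℝ) : ℂ) := fun i j => by
        rw [Complex.ofReal_intCast]; rfl
      simp only [map_apply, Matrix.add_apply, Matrix.smul_apply, smul_eq_mul, h2, Complex.add_im, h1,
        add_zero, mul_apply, Fin.sum_univ_two, h3, transpose_apply, conjTranspose_apply, gR,
        Complex.mul_im, Complex.mul_re, Complex.add_re, Complex.ofReal_re, Complex.ofReal_im,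
        star_trivial]
      ring
    rw [e]
    exact hp.mul_mul_conjTranspose_same (vecMul_injective_of_isUnit
      ((isUnit_iff_isUnit_det _).2 (by rw [hd]; exact isUnit_one)))

theorem slash_twistMatrix {k q : ℕ} (f : Matrix (Fin 2) (Fin 2) ℂ → ℂ) (G : SL(2, ℤ))
    (Y : Matrix (Fin 2) (Fin 2) ℤ) (τ : Matrix (Fin 2) (Fin 2) ℂ) :
    slash k f (twistMatrix q G Y) τ = f (toC ((G⁻¹ : SL(2, ℤ)) : Matrix (Fin 2) (Fin 2) ℤ) * τ *
      (toC ((G⁻¹ : SL(2, ℤ)) : Matrix (Fin 2) (Fin 2) ℤ))ᵀ + (1 / (q : ℂ)) • toC Y) := by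
  set g : Matrix (Fin 2) (Fin 2) ℤ := (G : Matrix (Fin 2) (Fin 2) ℤ) with hg
  set g' : Matrix (Fin 2) (Fin 2) ℤ := ((G⁻¹ : SL(2, ℤ)) : Matrix (Fin 2) (Fin 2) ℤ) with hg'
  have hdet : (twistMatrix q G Y).det = 1 := by
    rw [twistMatrix, det_fromBlocks_zero₂₁]
    have h1 : (g'.map (Int.cast : ℤ → ℚ)).det = 1 := by
      have : (toRat g').det = 1 := by rw [toRat_det, (G⁻¹).det_coe, Int.cast_one]
      exact this
    have h2 : (gᵀ.map (Int.cast : ℤ → ℚ)).det = 1 := by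
      have : (toRat gᵀ).det = 1 := by rw [toRat_det, det_transpose, G.det_coe, Int.cast_one]
      exact this
    rw [h1, h2, one_mul]
  have hA : (twistMatrix q G Y).toBlocks₁₁.map (Rat.cast : ℚ → ℂ) = toC g' := by
    ext i j; simp [twistMatrix, toC, hg']
  have hB : (twistMatrix q G Y).toBlocks₁₂.map (Rat.cast : ℚ → ℂ) =
      (1 / (q : ℂ)) • (toC Y * (toC g)ᵀ) := by
    rw [← toC_transpose, ← map_mul]
    ext i j; simp [twistMatrix, toC, hg]
  have hC : (twistMatrix q G Y).toBlocks₂₁.map (Rat.cast : ℚ → ℂ) = 0 := by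
    ext i j; simp [twistMatrix]
  have hD : (twistMatrix q G Y).toBlocks₂₂.map (Rat.cast : ℚ → ℂ) = (toC g)ᵀ := by
    rw [← toC_transpose]
    ext i j; simp [twistMatrix, toC, hg]
  have hgg : (toC g)ᵀ * (toC g')ᵀ = 1 := by
    rw [← transpose_mul, ← map_mul, SL2_inv_mul G, map_one, transpose_one]
  have hinv : ((toC g)ᵀ)⁻¹ = (toC g')ᵀ := inv_eq_right_inv hgg
  rw [slash, hdet, hA, hB, hC, hD, Matrix.zero_mul, zero_add, hinv, det_transpose, toC_det,
    G.det_coe, Matrix.add_mul, Matrix.smul_mul, Matrix.mul_assoc (toC Y), hgg, Matrix.mul_one]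
  simp

theorem symC_add (s t : ℚ × ℚ × ℚ) : symC (s + t) = symC s + symC t := by
  rw [symC, sym_add]
  exact Matrix.map_add _ (fun a b => by push_cast; rfl) _ _

theorem symC_conj (G : SL(2, ℤ)) (s : ℚ × ℚ × ℚ) :
    symC (conj (toRat G) s) = toC G * symC s * (toC G)ᵀ := by
  have hm : ∀ X : Matrix (Fin 2) (Fin 2) ℚ, X.map (Rat.cast : ℚ → ℂ) = X.map (Rat.castHom ℂ) :=
    fun X => rfl
  have e : (toRat G).map (Rat.castHom ℂ) = toC G := by
    ext i j; simp [toRat_apply, toC]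
  rw [symC, sym_conj, hm, Matrix.map_mul, Matrix.map_mul, transpose_map, e]
  rfl

theorem symC_divq (q : ℕ) {Z : Matrix (Fin 2) (Fin 2) ℤ} (hZ : Zᵀ = Z) :
    symC (divq q Z) = (1 / (q : ℂ)) • toC Z := by
  rw [symC, sym_divq q hZ]
  ext i j; simp [toRat_apply, toC]

/-- The translate of an Eisenstein series by `(G⁻¹, Y ᵗG / q; 0, ᵗG)` shifts the coefficients by
`G Y ᵗG / q`: with `τ' = G⁻¹ (τ + G Y ᵗG / q) ᵗG⁻¹` one has
`det(τ' + S) = det(τ + G Y ᵗG / q + G S ᵗG)`, and the coefficients of `S` and of `G S ᵗG` agree. -/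
theorem slash_eisenstein {n k L q : ℕ} (hk : 4 ≤ k) {χ : DirichletCharacter ℂ n} (hχ : χ ^ 2 = 1)
    (hpar : χ (-1) = (-1) ^ k) (hn : n ∣ L) {x y : ℤ} (hxy : IdempotentMod n x y)
    (hdet : ∀ γ : Gamma0 L, (pairM (diagonal ![x, y]) γ).det ≠ 0)
    {τ : Matrix (Fin 2) (Fin 2) ℂ} (hτ : τ ∈ upperHalfSpace) (G : SL(2, ℤ))
    {Y : Matrix (Fin 2) (Fin 2) ℤ} (hY : Yᵀ = Y) :
    Summable (fun s => wt k χ L (diagonal ![x, y])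
      (s - divq q ((G : Matrix (Fin 2) (Fin 2) ℤ) * Y * (G : Matrix (Fin 2) (Fin 2) ℤ)ᵀ)) *
        ((τ + symC s).det ^ k)⁻¹) ∧
    slash k (eisenstein k χ L (diagonal ![x, y])) (twistMatrix q G Y) τ =
      ∑' s, wt k χ L (diagonal ![x, y])
        (s - divq q ((G : Matrix (Fin 2) (Fin 2) ℤ) * Y * (G : Matrix (Fin 2) (Fin 2) ℤ)ᵀ)) *
        ((τ + symC s).det ^ k)⁻¹ := by
  set g : Matrix (Fin 2) (Fin 2) ℤ := (G : Matrix (Fin 2) (Fin 2) ℤ) with hg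
  have hgg := SL2_mul_inv G
  have hgg' := SL2_inv_mul G
  set g' : Matrix (Fin 2) (Fin 2) ℤ := ((G⁻¹ : SL(2, ℤ)) : Matrix (Fin 2) (Fin 2) ℤ) with hg'
  set t := divq q (g * Y * gᵀ) with ht
  let e : ℚ × ℚ × ℚ ≃ ℚ × ℚ × ℚ :=
    { toFun := fun s => conj (toRat g) s + t
      invFun := fun s => conj (toRat g') (s - t)
      left_inv := fun s => by
        change conj (toRat g') (conj (toRat g) s + t - t) = s
        rw [add_sub_cancel_right, conj_conj (by rw [← map_mul, hgg', map_one])]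
      right_inv := fun s => by
        change conj (toRat g) (conj (toRat g') (s - t)) + t = s
        rw [conj_conj (by rw [← map_mul, hgg, map_one]), sub_add_cancel] }
  set τ' := toC g' * τ * (toC g')ᵀ + (1 / (q : ℂ)) • toC Y with hτ'
  have hτ'm : τ' ∈ upperHalfSpace := twist_mem_upperHalfSpace (G := G⁻¹) hY hτ
  obtain ⟨hsum, heq⟩ := eisenstein_eq_tsum hk hχ hpar hn hxy hdet hτ'm
  have hterm : ∀ s, wt k χ L (diagonal ![x, y]) s * ((τ' + symC s).det ^ k)⁻¹ =
      wt k χ L (diagonal ![x, y]) (e s - t) * ((τ + symC (e s)).det ^ k)⁻¹ := by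
    intro s
    have e1 : e s - t = conj (toRat g) s := add_sub_cancel_right _ _
    have hC1 : toC g' * toC g = 1 := by rw [← map_mul, hgg', map_one]
    have hC2 : (toC g)ᵀ * (toC g')ᵀ = 1 := by rw [← transpose_mul, hC1, transpose_one]
    have e2 : τ' + symC s = toC g' * (τ + symC (e s)) * (toC g')ᵀ := by
      have : symC (e s) = toC g * (symC s + (1 / (q : ℂ)) • toC Y) * (toC g)ᵀ := by
        change symC (conj (toRat g) s + t) = _
        rw [symC_add, symC_conj, ht, symC_divq q (conj_symm g hY), map_mul, map_mul, toC_transpose,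
          Matrix.mul_add, Matrix.add_mul, Matrix.mul_smul, Matrix.smul_mul]
      rw [this, Matrix.mul_add, Matrix.add_mul, hτ']
      have : toC g' * (toC g * (symC s + (1 / (q : ℂ)) • toC Y) * (toC g)ᵀ) * (toC g')ᵀ =
        (toC g' * toC g) * (symC s + (1 / (q : ℂ)) • toC Y) * ((toC g)ᵀ * (toC g')ᵀ) := by
        simp only [Matrix.mul_assoc]
      rw [this, hC1, hC2, Matrix.one_mul, Matrix.mul_one]
      abel
    rw [e1, wt_conj hχ hn hxy, e2, det_mul, det_mul, det_transpose, toC_det, (G⁻¹).det_coe]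
    simp
  constructor
  · rw [← e.summable_iff]
    exact hsum.congr fun s => hterm s
  · rw [slash_twistMatrix, heq]
    exact (tsum_congr hterm).trans (e.tsum_eq (fun s => wt k χ L (diagonal ![x, y]) (s - t) *
      ((τ + symC s).det ^ k)⁻¹))

/-! ### Character sums over binary quadratic forms -/

section FiniteField

variable {F : Type*} [Field F]

/-- The value at `e` of the quadratic form of a symmetric matrix, given as a triple. -/
def form (z : F × F × F) (e : F × F) : F :=
  z.1 * e.1 ^ 2 + 2 * z.2.1 * (e.1 * e.2) + z.2.2 * e.2 ^ 2

/-- The determinant of a symmetric matrix, given as a triple. -/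
def disc (z : F × F × F) : F := z.1 * z.2.2 - z.2.1 ^ 2

/-- The triple of `r v ᵗv`. -/
def rankOne (r : F) (v : F × F) : F × F × F := (r * v.1 ^ 2, r * (v.1 * v.2), r * v.2 ^ 2)

/-- A symmetric matrix of the form `r v ᵗv` with `v ≠ 0`. -/
def IsRankOne (r : F) (z : F × F × F) : Prop := ∃ v, v ≠ 0 ∧ z = rankOne r v

theorem form_sub_rankOne (z : F × F × F) (r : F) (v e : F × F) :
    form (z - rankOne r v) e = form z e - r * (v.1 * e.1 + v.2 * e.2) ^ 2 := by
  simp only [form, rankOne, Prod.fst_sub, Prod.snd_sub]; ring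

theorem prod_ne_zero_iff {v : F × F} : v ≠ 0 ↔ v.1 ≠ 0 ∨ v.2 ≠ 0 := by
  rw [Ne, Prod.ext_iff]
  simp only [Prod.fst_zero, Prod.snd_zero]
  tauto

theorem rankOne_eq_iff {r : F} (hr : r ≠ 0) {v w : F × F} :
    rankOne r v = rankOne r w ↔ v = w ∨ v = -w := by
  constructor
  · intro h
    simp only [rankOne, Prod.mk.injEq, mul_right_inj' hr] at h
    obtain ⟨h1, h2, h3⟩ := h
    obtain ⟨a, b⟩ := v
    obtain ⟨c, d⟩ := w
    simp only [Prod.mk.injEq, Prod.neg_mk] at *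
    rcases sq_eq_sq_iff_eq_or_eq_neg.1 h1 with rfl | rfl
    · by_cases ha : a = 0
      · subst ha
        rcases sq_eq_sq_iff_eq_or_eq_neg.1 h3 with h | h
        · exact Or.inl ⟨rfl, h⟩
        · exact Or.inr ⟨neg_zero.symm, h⟩
      · exact Or.inl ⟨rfl, mul_left_cancel₀ ha h2⟩
    · by_cases ha : c = 0
      · subst ha
        rcases sq_eq_sq_iff_eq_or_eq_neg.1 h3 with h | h
        · exact Or.inl ⟨neg_zero, h⟩
        · exact Or.inr ⟨rfl, h⟩
      · exact Or.inr ⟨rfl, mul_left_cancel₀ ha (by linear_combination -h2)⟩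
  · rintro (rfl | rfl)
    · rfl
    · simp [rankOne]

variable [Fintype F]

/-- A nonzero linear form on the plane takes each value equally often. -/
theorem sum_linear {e : F × F} (he : e ≠ 0) (f : F → ℤ) :
    ∑ v : F × F, f (v.1 * e.1 + v.2 * e.2) = Fintype.card F * ∑ t, f t := by
  rw [Fintype.sum_prod_type]
  rcases prod_ne_zero_iff.1 he with h | h
  · rw [Finset.sum_comm, Finset.sum_congr rfl (g := fun _ => ∑ t, f t), Finset.sum_const,
      nsmul_eq_mul, Finset.card_univ]
    intro y _
    exact ((Equiv.mulRight₀ e.1 h).trans (Equiv.addRight (y * e.2))).sum_comp f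
  · rw [Finset.sum_congr rfl (g := fun _ => ∑ t, f t), Finset.sum_const,
      nsmul_eq_mul, Finset.card_univ]
    intro x _
    exact ((Equiv.mulRight₀ e.2 h).trans (Equiv.addLeft (x * e.1))).sum_comp f

/-- Completing the square, at a vector `(1, t)` where the form has the value `a ≠ 0`. -/
theorem sum_form {z : F × F × F} {t : F} {a : F} (ha : a = z.1 + 2 * z.2.1 * t + z.2.2 * t ^ 2)
    (ha0 : a ≠ 0) (f : F → ℤ) :
    ∑ e : F × F, f (a * form z e) = ∑ p : F × F, f (p.1 ^ 2 + disc z * p.2 ^ 2) := by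
  let φ : F × F ≃ F × F :=
    { toFun := fun e => ((z.1 + z.2.1 * t) * e.1 + (z.2.1 + z.2.2 * t) * e.2, e.2 - t * e.1)
      invFun := fun p => ((p.1 - (z.2.1 + z.2.2 * t) * p.2) / a,
        (t * p.1 + (z.1 + z.2.1 * t) * p.2) / a)
      left_inv := fun e => by
        ext
        · simp only
          rw [div_eq_iff ha0, ha]; ring
        · simp only
          rw [div_eq_iff ha0, ha]; ring
      right_inv := fun p => by
        ext
        · simp only
          field_simp
          rw [ha]; ring
        · simp only
          field_simp
          rw [ha]; ring }
  rw [← φ.sum_comp (fun p => f (p.1 ^ 2 + disc z * p.2 ^ 2))]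
  refine Finset.sum_congr rfl fun e _ => ?_
  congr 1
  change _ = ((z.1 + z.2.1 * t) * e.1 + (z.2.1 + z.2.2 * t) * e.2) ^ 2 +
    disc z * (e.2 - t * e.1) ^ 2
  rw [ha, form, disc]
  ring

variable [DecidableEq F]

theorem quadraticChar_sq_eq_ite (x : F) : quadraticChar F (x ^ 2) = if x = 0 then 0 else 1 := by
  split_ifs with h
  · rw [h, zero_pow two_ne_zero, quadraticChar_zero]
  · exact quadraticChar_sq_one' h

theorem sum_quadraticChar_sq_add (hF : ringChar F ≠ 2) (c : F) :
    ∑ x : F, quadraticChar F (x ^ 2 + c) = (if c = 0 then (Fintype.card F : ℤ) else 0) - 1 := by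
  by_cases hc : c = 0
  · rw [if_pos hc, hc]
    simp only [add_zero, quadraticChar_sq_eq_ite]
    rw [Finset.sum_ite, Finset.sum_const_zero, zero_add, Finset.sum_const, nsmul_eq_mul, mul_one,
      Finset.filter_ne', Finset.card_erase_of_mem (Finset.mem_univ _), Finset.card_univ,
      Nat.cast_sub Fintype.card_pos, Nat.cast_one]
  · rw [if_neg hc]
    have h1 : ∑ x : F, quadraticChar F (x ^ 2 + c) =
        ∑ y : F, (quadraticChar F y + 1) * quadraticChar F (y + c) := by
      rw [← Finset.sum_fiberwise Finset.univ (fun x : F => x ^ 2)]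
      refine Finset.sum_congr rfl fun y _ => ?_
      rw [Finset.sum_congr rfl (g := fun _ => quadraticChar F (y + c))
        (fun x hx => by rw [(Finset.mem_filter.1 hx).2]), Finset.sum_const, nsmul_eq_mul,
        ← quadraticChar_card_sqrts hF y]
      congr 3
      ext x; simp
    -- `ψ(y) ψ(y + c) = ψ(1 + c / y)` away from `y = 0`, and `y ↦ 1 + c / y` is a permutation
    have h2 : ∀ y : F, (quadraticChar F y + 1) * quadraticChar F (y + c) =
        quadraticChar F (1 + c * y⁻¹) - (if y = 0 then 1 else 0) + quadraticChar F (y + c) := by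
      intro y
      rw [add_mul, one_mul, ← map_mul]
      congr 1
      split_ifs with hy
      · simp [hy]
      · rw [sub_zero, ← one_mul (quadraticChar F (1 + c * y⁻¹)), ← quadraticChar_sq_one' hy,
          ← map_mul]
        congr 1
        field_simp
    have h3 : ∑ y : F, quadraticChar F (y + c) = 0 := by
      rw [← quadraticChar_sum_zero hF]
      exact Equiv.sum_comp (Equiv.addRight c : F ≃ F) (fun x => quadraticChar F x)
    have h4 : ∑ y : F, quadraticChar F (1 + c * y⁻¹) = 0 := by
      rw [← quadraticChar_sum_zero hF]
      exact Equiv.sum_comp (((Equiv.inv F).trans (Equiv.mulLeft₀ c hc)).trans (Equiv.addLeft 1) : F ≃ F)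
        (fun x => quadraticChar F x)
    rw [h1, Finset.sum_congr rfl (fun y _ => h2 y), Finset.sum_add_distrib, Finset.sum_sub_distrib,
      h3, h4]
    simp

open Classical in
/-- Every matrix `r v ᵗv` of rank one comes from exactly two vectors, `v` and `-v`. -/
theorem sum_rankOne (hF : ringChar F ≠ 2) {r : F} (hr : r ≠ 0) (f : F × F × F → ℤ) :
    ∑ v ∈ Finset.univ.filter (fun v : F × F => v ≠ 0), f (rankOne r v) =
      2 * ∑ z, (if IsRankOne r z then f z else 0) := by
  rw [← Finset.sum_fiberwise _ (fun v : F × F => rankOne r v), Finset.mul_sum]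
  refine Finset.sum_congr rfl fun z _ => ?_
  rw [Finset.sum_congr rfl (g := fun _ => f z)
    (fun x hx => by rw [(Finset.mem_filter.1 hx).2]), Finset.sum_const, nsmul_eq_mul]
  split_ifs with h
  · obtain ⟨v, hv, rfl⟩ := h
    have : (Finset.univ.filter (fun v : F × F => v ≠ 0)).filter
        (fun w => rankOne r w = rankOne r v) = {v, -v} := by
      ext w
      simp only [Finset.mem_filter, Finset.mem_univ, true_and, rankOne_eq_iff hr,
        Finset.mem_insert, Finset.mem_singleton]
      refine ⟨fun h => h.2, fun h => ⟨?_, h⟩⟩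
      rcases h with rfl | rfl
      · exact hv
      · exact neg_ne_zero.2 hv
    rw [this, Finset.card_pair]
    · norm_num
    · intro h
      have h2 : (2 : F) ≠ 0 := Ring.two_ne_zero hF
      apply hv
      have h1 := congrArg Prod.fst h
      have h3 := congrArg Prod.snd h
      simp only [Prod.fst_neg, Prod.snd_neg] at h1 h3
      ext
      · exact (mul_eq_zero.1 (show 2 * v.1 = 0 by linear_combination h1)).resolve_left h2
      · exact (mul_eq_zero.1 (show 2 * v.2 = 0 by linear_combination h3)).resolve_left h2
  · rw [mul_zero, Finset.filter_eq_empty_iff.2, Finset.card_empty, Nat.cast_zero, zero_mul]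
    intro v hv hv'
    exact h ⟨v, (Finset.mem_filter.1 hv).2, hv'.symm⟩

theorem sum_quadraticChar_sub (hF : ringChar F ≠ 2) {r : F} (hr : r ≠ 0) (c : F) :
    ∑ t : F, quadraticChar F (c - r * t ^ 2) =
      quadraticChar F (-r) * ((if c = 0 then (Fintype.card F : ℤ) else 0) - 1) := by
  have h := sum_quadraticChar_sq_add hF (-(c / r))
  have e : (if -(c / r) = 0 then (Fintype.card F : ℤ) else 0) =
      if c = 0 then (Fintype.card F : ℤ) else 0 := by
    congr 1
    rw [neg_eq_zero, div_eq_zero_iff]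
    simp [hr]
  rw [e] at h
  rw [← h, Finset.mul_sum]
  refine Finset.sum_congr rfl fun t _ => ?_
  rw [← map_mul]
  congr 1
  field_simp
  ring

theorem sum_filter_ne_zero {α : Type*} [Fintype α] [DecidableEq α] [Zero α] (f : α → ℤ) :
    ∑ v ∈ Finset.univ.filter (fun v : α => v ≠ 0), f v = ∑ v, f v - f 0 := by
  rw [Finset.filter_ne', Finset.sum_erase_eq_sub (Finset.mem_univ _)]

/-- A nonzero form has a nonzero value at some vector `(1, t)`: its values at `t = 0, 1, -1` determine
it. -/
theorem exists_form_ne_zero (hF : ringChar F ≠ 2) {z : F × F × F} (hz : z ≠ 0) :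
    ∃ t, z.1 + 2 * z.2.1 * t + z.2.2 * t ^ 2 ≠ 0 := by
  have h2 : (2 : F) ≠ 0 := Ring.two_ne_zero hF
  by_contra! h
  have ha := h 0
  have hp := h 1
  have hm := h (-1)
  have e1 : z.1 = 0 := by linear_combination ha
  have e2 : z.2.1 = 0 := by
    refine (mul_eq_zero.1 (show (2 * 2) * z.2.1 = 0 by linear_combination hp - hm)).resolve_left ?_
    exact mul_ne_zero h2 h2
  have e3 : z.2.2 = 0 := by linear_combination hp - e1 - 2 * e2
  exact hz (Prod.ext e1 (Prod.ext e2 e3))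

/-- A form with the nonzero value `a` has rank one and class `b` exactly if it is degenerate and `a`, `b`
have the same quadratic character. -/
theorem isRankOne_iff {z : F × F × F} {t : F} {a : F}
    (ha : a = z.1 + 2 * z.2.1 * t + z.2.2 * t ^ 2) (ha0 : a ≠ 0) {b : F} (hb : b ≠ 0) :
    IsRankOne b z ↔ disc z = 0 ∧ quadraticChar F a = quadraticChar F b := by
  constructor
  · rintro ⟨v, hv, rfl⟩
    have e : a = b * (v.1 + v.2 * t) ^ 2 := by rw [ha]; simp only [rankOne]; ring
    refine ⟨by simp only [disc, rankOne]; ring, ?_⟩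
    have : v.1 + v.2 * t ≠ 0 := fun h => ha0 (by rw [e, h]; ring)
    rw [e, map_mul, quadraticChar_sq_one' this, mul_one]
  · rintro ⟨hd, hab⟩
    have hsq : IsSquare (a * b) := by
      rw [← quadraticChar_one_iff_isSquare (mul_ne_zero ha0 hb), map_mul, hab, ← map_mul, ← sq,
        quadraticChar_sq_one' hb]
    obtain ⟨c, hc⟩ := hsq
    have hc0 : c ≠ 0 := fun h => mul_ne_zero ha0 hb (by rw [hc, h, zero_mul])
    have hd' : z.1 * z.2.2 = z.2.1 ^ 2 := by rw [disc] at hd; linear_combination hd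
    -- `a z = w ᵗw` with `w = z (1, t)`
    refine ⟨((z.1 + z.2.1 * t) / c, (z.2.1 + z.2.2 * t) / c), ?_, ?_⟩
    · rw [prod_ne_zero_iff]
      by_contra! h
      simp only [div_eq_zero_iff, hc0, or_false] at h
      exact ha0 (by rw [ha]; linear_combination h.1 + t * h.2)
    · have key : ∀ x y : F, a * x = y → x = b * (y / (c * c)) := fun x y h => by
        rw [← hc, ← h]; field_simp
      ext
      · refine (key z.1 ((z.1 + z.2.1 * t) ^ 2) (by rw [ha]; linear_combination t ^ 2 * hd')).trans ?_
        simp only [rankOne]; field_simp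
      · refine (key z.2.1 ((z.1 + z.2.1 * t) * (z.2.1 + z.2.2 * t))
          (by rw [ha]; linear_combination -t * hd')).trans ?_
        simp only [rankOne]; field_simp
      · refine (key z.2.2 ((z.2.1 + z.2.2 * t) ^ 2) (by rw [ha]; linear_combination hd')).trans ?_
        simp only [rankOne]; field_simp

theorem sum_quadraticChar_sq_add_mul_sq (hF : ringChar F ≠ 2) (D : F) :
    ∑ p : F × F, quadraticChar F (p.1 ^ 2 + D * p.2 ^ 2) =
      if D = 0 then (Fintype.card F : ℤ) * (Fintype.card F - 1) else 0 := by
  rw [Fintype.sum_prod_type_right]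
  simp only [sum_quadraticChar_sq_add hF]
  split_ifs with hD
  · simp [hD]; ring
  · rw [Finset.sum_sub_distrib]
    simp [hD]

theorem sum_sq_add_mul_sq_eq_zero (hF : ringChar F ≠ 2) (D : F) :
    ∑ p : F × F, (if p.1 ^ 2 + D * p.2 ^ 2 = 0 then (1 : ℤ) else 0) =
      Fintype.card F + quadraticChar F (-D) * (Fintype.card F - 1) := by
  rw [Fintype.sum_prod_type_right]
  have : ∀ y : F, ∑ x : F, (if x ^ 2 + D * y ^ 2 = 0 then (1 : ℤ) else 0) =
      quadraticChar F (-D) * quadraticChar F (y ^ 2) + 1 := by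
    intro y
    rw [← map_mul, ← quadraticChar_card_sqrts hF, Finset.sum_boole]
    congr 2
    ext x
    simp [eq_neg_iff_add_eq_zero]
  simp only [this, quadraticChar_sq_eq_ite]
  rw [Finset.sum_add_distrib, ← Finset.mul_sum]
  have h : ∑ y : F, (if y = 0 then (0 : ℤ) else 1) = Fintype.card F - 1 := by
    rw [Finset.sum_congr rfl (g := fun y : F => (1 : ℤ) - if y = 0 then 1 else 0)
      (fun y _ => by split_ifs <;> rfl), Finset.sum_sub_distrib]
    simp
  rw [h]
  simp
  ring

open Classical in
/-- The identity of character sums behind the action of the twist operator: the sum over `e` and over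
the matrices `w` of rank one and class `r` of the quadratic character of the value of `z - w` at `e`.
For fixed `e` the sum over `w` is a function of the value of `z` at `e`; summing over `e`, after
completing the square in `z`, leaves a function of the rank, class and discriminant of `z`. -/
theorem sum_twist (hF : ringChar F ≠ 2) {r b : F} (hr : r ≠ 0) (hb : b ≠ 0)
    (hrb : quadraticChar F b = quadraticChar F (-1) * quadraticChar F r) (z : F × F × F) :
    2 * quadraticChar F r * ∑ e ∈ Finset.univ.filter (fun e : F × F => e ≠ 0),
      ∑ w, (if IsRankOne r w then quadraticChar F (form (z - w) e) else 0) =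
    ((Fintype.card F : ℤ) - 1) *
      (-2 * quadraticChar F (-1) * Fintype.card F * (if IsRankOne b z then 1 else 0) +
        quadraticChar F (-1) * Fintype.card F * ((Fintype.card F : ℤ) ^ 2 - 1) *
          (if z = 0 then 1 else 0) +
        (Fintype.card F : ℤ) ^ 2 * quadraticChar F (disc z) -
        quadraticChar F (-1) * Fintype.card F * quadraticChar F (disc z) ^ 2) := by
  set q : ℤ := (Fintype.card F : ℤ) with hq
  let g : F → ℤ := fun x =>
    q * (quadraticChar F (-r) * ((if x = 0 then q else 0) - 1)) - quadraticChar F x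
  have h1 : ∀ e ∈ Finset.univ.filter (fun e : F × F => e ≠ 0),
      2 * ∑ w, (if IsRankOne r w then quadraticChar F (form (z - w) e) else 0) =
        g (form z e) := by
    intro e he
    rw [← sum_rankOne hF hr (fun w => quadraticChar F (form (z - w) e))]
    simp only [form_sub_rankOne]
    rw [sum_filter_ne_zero (fun v : F × F =>
      quadraticChar F (form z e - r * (v.1 * e.1 + v.2 * e.2) ^ 2)),
      sum_linear (Finset.mem_filter.1 he).2 (fun t => quadraticChar F (form z e - r * t ^ 2)),
      sum_quadraticChar_sub hF hr]
    simp [g, hq]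
  have h2 : 2 * quadraticChar F r * ∑ e ∈ Finset.univ.filter (fun e : F × F => e ≠ 0),
      ∑ w, (if IsRankOne r w then quadraticChar F (form (z - w) e) else 0) =
      quadraticChar F r * (∑ e : F × F, g (form z e) - g 0) := by
    rw [mul_comm 2, mul_assoc, Finset.mul_sum, Finset.sum_congr rfl h1,
      sum_filter_ne_zero (fun e => g (form z e))]
    simp [form]
  have hrr : quadraticChar F r * quadraticChar F r = 1 := by
    rw [← map_mul, ← sq, quadraticChar_sq_one' hr]
  have hneg : quadraticChar F (-r) = quadraticChar F (-1) * quadraticChar F r := by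
    rw [← map_mul, neg_one_mul]
  have hg0 : g 0 = q * (quadraticChar F (-r) * (q - 1)) := by simp [g]
  rw [h2, hg0]
  by_cases hz : z = 0
  · subst hz
    have hnr : ¬ IsRankOne b (0 : F × F × F) := by
      rintro ⟨v, hv, h⟩
      simp only [rankOne, Prod.ext_iff, Prod.fst_zero, Prod.snd_zero, zero_eq_mul, hb, false_or,
        ne_eq, OfNat.ofNat_ne_zero, not_false_eq_true, pow_eq_zero_iff] at h
      exact (prod_ne_zero_iff.1 hv).elim (fun hh => hh h.1) (fun hh => hh h.2.2)
    have hd : disc (0 : F × F × F) = 0 := by simp [disc]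
    have hf : ∀ e : F × F, form (0 : F × F × F) e = 0 := fun e => by simp [form]
    simp only [hf, hg0, hnr, hd, quadraticChar_zero, if_false, if_true, Finset.sum_const,
      Finset.card_univ, Fintype.card_prod, nsmul_eq_mul, Nat.cast_mul]
    rw [← hq, hneg]
    linear_combination (q * q - 1) * (q * (q - 1)) * quadraticChar F (-1) * hrr
  · obtain ⟨t, ht⟩ := exists_form_ne_zero hF hz
    set a := z.1 + 2 * z.2.1 * t + z.2.2 * t ^ 2 with ha
    have haa : quadraticChar F a * quadraticChar F a = 1 := by
      rw [← map_mul, ← sq, quadraticChar_sq_one' ht]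
    have h3 : ∑ e : F × F, g (form z e) = ∑ p : F × F, g ((p.1 ^ 2 + disc z * p.2 ^ 2) / a) := by
      rw [← sum_form ha ht (fun x => g (x / a))]
      refine Finset.sum_congr rfl fun e _ => ?_
      rw [mul_div_cancel_left₀ _ ht]
    have h4 : ∀ x, g (x / a) = q * quadraticChar F (-r) * q * (if x = 0 then 1 else 0) -
        q * quadraticChar F (-r) - quadraticChar F a * quadraticChar F x := by
      intro x
      have e1 : quadraticChar F (x / a) = quadraticChar F a * quadraticChar F x := by
        have : quadraticChar F x = quadraticChar F a * quadraticChar F (x / a) := by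
          rw [← map_mul, mul_div_cancel₀ _ ht]
        rw [this, ← mul_assoc, haa, one_mul]
      have e2 : (x / a = 0) = (x = 0) := by simp [div_eq_zero_iff, ht]
      simp only [g, e1, e2]
      split_ifs <;> ring
    have h5 : ∑ e : F × F, g (form z e) = q * quadraticChar F (-r) * q *
        (q + quadraticChar F (-disc z) * (q - 1)) - q * q * (q * quadraticChar F (-r)) -
        quadraticChar F a * (if disc z = 0 then q * (q - 1) else 0) := by
      rw [h3]
      simp only [h4]
      rw [Finset.sum_sub_distrib, Finset.sum_sub_distrib, Finset.sum_const,
        ← Finset.mul_sum, ← Finset.mul_sum,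
        sum_quadraticChar_sq_add_mul_sq hF, sum_sq_add_mul_sq_eq_zero hF,
        Finset.card_univ, Fintype.card_prod, nsmul_eq_mul, Nat.cast_mul]
    have hnd : quadraticChar F (-disc z) = quadraticChar F (-1) * quadraticChar F (disc z) := by
      rw [← map_mul, neg_one_mul]
    have hmm : quadraticChar F (-1) * quadraticChar F (-1) = 1 := by
      rw [← map_mul, neg_one_mul, neg_neg, map_one]
    rw [h5, isRankOne_iff ha ht hb, hneg, hnd, if_neg hz]
    by_cases hD : disc z = 0
    · rw [if_pos hD, hD, quadraticChar_zero, hrb]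
      have : (if (0 : F) = 0 ∧ quadraticChar F a = quadraticChar F (-1) * quadraticChar F r
          then (1 : ℤ) else 0) * 2 = 1 + quadraticChar F (-1) * quadraticChar F r *
            quadraticChar F a := by
        have m1 : (-1 : F) ≠ 0 := neg_ne_zero.2 one_ne_zero
        rcases quadraticChar_dichotomy ht with h | h <;>
          rcases quadraticChar_dichotomy m1 with h' | h' <;>
          rcases quadraticChar_dichotomy hr with h'' | h'' <;> rw [h, h', h''] <;> norm_num
      split_ifs with hI
      · rw [if_pos hI] at this
        linear_combination (-q * quadraticChar F (-1) * (q - 1)) * hrr +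
          (q - 1) * quadraticChar F (-1) * q * this +
          (q - 1) * q * quadraticChar F r * quadraticChar F a * hmm
      · rw [if_neg hI] at this
        linear_combination (-q * quadraticChar F (-1) * (q - 1)) * hrr +
          (q - 1) * quadraticChar F (-1) * q * this +
          (q - 1) * q * quadraticChar F r * quadraticChar F a * hmm
    · have hDD : quadraticChar F (disc z) ^ 2 = 1 := by
        rw [← map_pow, quadraticChar_sq_one' hD]
      rw [if_neg hD, hDD, if_neg (fun h => hD h.1)]
      linear_combination (q * q * quadraticChar F (-1) * quadraticChar F (-1) *
        quadraticChar F (disc z) * (q - 1) - q * quadraticChar F (-1) * (q - 1)) * hrr +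
        (q * q * quadraticChar F (disc z) * (q - 1)) * hmm

end FiniteField

/-! ### Sums over the representatives of the twist operator -/

section Reps

variable {q : ℕ} [Fact q.Prime]

/-- The first row of `G⁻¹` modulo `q`. Up to scalars it determines the coset of `G`, by
`cross_eq_zero_iff`. -/
def repRow (q : ℕ) (G : SL(2, ℤ)) : ZMod q × ZMod q := ((G 1 1 : ZMod q), -(G 0 1 : ZMod q))

theorem cross_eq_zero_iff (G H : SL(2, ℤ)) : (q : ℤ) ∣ (G⁻¹ * H : SL(2, ℤ)) 0 1 ↔
    (repRow q G).2 * (repRow q H).1 = (repRow q G).1 * (repRow q H).2 := by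
  have h : (G⁻¹ * H : SL(2, ℤ)) 0 1 = G 1 1 * H 0 1 - G 0 1 * H 1 1 := by
    rw [Matrix.SpecialLinearGroup.coe_mul, Matrix.SpecialLinearGroup.coe_inv, adjugate_fin_two,
      mul_apply, Fin.sum_univ_two]
    simp
    ring
  rw [h, ← ZMod.intCast_zmod_eq_zero_iff_dvd, repRow, repRow]
  push_cast
  constructor
  · intro h; linear_combination h
  · intro h; linear_combination h

theorem repRow_ne_zero (G : SL(2, ℤ)) : repRow q G ≠ 0 := by
  intro h
  have h1 : (G 1 1 : ZMod q) = 0 := congrArg Prod.fst h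
  have h2 : (G 0 1 : ZMod q) = 0 := neg_eq_zero.1 (congrArg Prod.snd h)
  have hd := congrArg (Int.cast : ℤ → ZMod q) G.det_coe
  rw [det_fin_two] at hd
  push_cast at hd
  rw [h1, h2] at hd
  simp at hd

theorem exists_repRow_eq {e : ZMod q × ZMod q} (he : e ≠ 0) : ∃ H, repRow q H = e := by
  -- complete the row to a matrix of determinant one modulo `q`
  obtain ⟨a, b, hab⟩ : ∃ a b : ZMod q, a * e.1 + b * e.2 = 1 := by
    rcases prod_ne_zero_iff.1 he with h | h
    · exact ⟨e.1⁻¹, 0, by rw [inv_mul_cancel₀ h]; ring⟩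
    · exact ⟨0, e.2⁻¹, by rw [inv_mul_cancel₀ h]; ring⟩
  obtain ⟨m, hm, -⟩ := exists_red_eq !![a, -e.2; b, e.1]
  have hdet : (q : ℤ) ∣ m.det - 1 := by
    rw [← ZMod.intCast_zmod_eq_zero_iff_dvd, Int.cast_sub, ← red_det, hm, det_fin_two_of]
    push_cast
    linear_combination hab
  obtain ⟨H, hH⟩ := exists_SL2_congr (Fact.out : q.Prime).pos m hdet
  have hred : red q H = !![a, -e.2; b, e.1] := hm ▸ red_eq_iff.2 hH
  have h11 := congr_fun (congr_fun hred 1) 1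
  have h01 := congr_fun (congr_fun hred 0) 1
  rw [red_apply] at h11 h01
  refine ⟨H, Prod.ext ?_ ?_⟩
  · simpa [repRow] using h11
  · simp only [repRow, h01]; simp

/-- The coset representatives run over the projective line modulo `q`, through the rows of `G⁻¹`; the
factor `q - 1` counts the scalars. -/
theorem sum_cosetReps {𝒢 : Finset SL(2, ℤ)} (h𝒢 : IsCosetReps q 𝒢) (f : ZMod q × ZMod q → ℤ)
    (hf : ∀ l : ZMod q, l ≠ 0 → ∀ e, f (l * e.1, l * e.2) = f e) :
    ((q : ℤ) - 1) * ∑ G ∈ 𝒢, f (repRow q G) =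
      ∑ e ∈ Finset.univ.filter (fun e : ZMod q × ZMod q => e ≠ 0), f e := by
  have hcard : ((Finset.univ.filter (fun l : ZMod q => l ≠ 0)).card : ℤ) = q - 1 := by
    rw [Finset.filter_ne', Finset.card_erase_of_mem (Finset.mem_univ _), Finset.card_univ,
      ZMod.card, Nat.cast_sub (Fact.out : q.Prime).one_le, Nat.cast_one]
  have h1 : ((q : ℤ) - 1) * ∑ G ∈ 𝒢, f (repRow q G) =
      ∑ p ∈ 𝒢 ×ˢ Finset.univ.filter (fun l : ZMod q => l ≠ 0), f (repRow q p.1) := by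
    rw [Finset.sum_product, Finset.mul_sum]
    refine Finset.sum_congr rfl fun G _ => ?_
    simp only [Finset.sum_const, nsmul_eq_mul, hcard]
  rw [h1]
  refine Finset.sum_nbij
    (fun p => (p.2 * (repRow q p.1).1, p.2 * (repRow q p.1).2)) ?_ ?_ ?_ ?_
  · intro p hp
    have hl := (Finset.mem_filter.1 (Finset.mem_product.1 hp).2).2
    refine Finset.mem_filter.2 ⟨Finset.mem_univ _, prod_ne_zero_iff.2 ?_⟩
    rcases prod_ne_zero_iff.1 (repRow_ne_zero (q := q) p.1) with h | h
    · exact Or.inl (mul_ne_zero hl h)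
    · exact Or.inr (mul_ne_zero hl h)
  · rintro ⟨G, l⟩ hp ⟨G', l'⟩ hp' h
    simp only [Prod.mk.injEq] at h
    have hp := Finset.mem_product.1 hp
    have hp' := Finset.mem_product.1 hp'
    have hl := (Finset.mem_filter.1 hp.2).2
    simp only at hl
    have hG : G' = G := by
      refine (h𝒢 G).unique ⟨hp'.1, (cross_eq_zero_iff _ _).2 ?_⟩
        ⟨hp.1, (cross_eq_zero_iff _ _).2 (mul_comm _ _)⟩
      refine mul_left_cancel₀ hl ?_
      linear_combination (repRow q G').2 * h.1 - (repRow q G').1 * h.2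
    subst hG
    congr 1
    rcases prod_ne_zero_iff.1 (repRow_ne_zero (q := q) G') with h' | h'
    · exact mul_right_cancel₀ h' h.1
    · exact mul_right_cancel₀ h' h.2
  · intro e he
    obtain ⟨H, rfl⟩ := exists_repRow_eq (Finset.mem_filter.1 (Finset.mem_coe.1 he)).2
    obtain ⟨G, ⟨hG, hc⟩, -⟩ := h𝒢 H
    rw [cross_eq_zero_iff] at hc
    have hH := repRow_ne_zero (q := q) H
    suffices ∃ l, l * (repRow q G).1 = (repRow q H).1 ∧ l * (repRow q G).2 = (repRow q H).2 by
      obtain ⟨l, h1, h2⟩ := this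
      refine ⟨(G, l), Finset.mem_coe.2 (Finset.mem_product.2 ⟨hG, Finset.mem_filter.2
        ⟨Finset.mem_univ _, ?_⟩⟩), Prod.ext h1 h2⟩
      rintro rfl
      exact hH (Prod.ext (by rw [← h1, zero_mul]; rfl) (by rw [← h2, zero_mul]; rfl))
    rcases prod_ne_zero_iff.1 (repRow_ne_zero (q := q) G) with h | h
    · refine ⟨(repRow q H).1 / (repRow q G).1, div_mul_cancel₀ _ h, ?_⟩
      rw [div_mul_eq_mul_div, div_eq_iff h]; linear_combination hc
    · refine ⟨(repRow q H).2 / (repRow q G).2, ?_, div_mul_cancel₀ _ h⟩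
      rw [div_mul_eq_mul_div, div_eq_iff h]; linear_combination -hc
  · rintro ⟨G, l⟩ hp
    exact (hf l (Finset.mem_filter.1 (Finset.mem_product.1 hp).2).2 _).symm

theorem sum_symmReps {𝒴 : Finset (Matrix (Fin 2) (Fin 2) ℤ)} (h𝒴 : IsSymmReps q 𝒴)
    (f : ZMod q × ZMod q × ZMod q → ℤ) :
    ∑ Y ∈ 𝒴, f (tri (red q Y)) = ∑ y, f y := by
  have hc : ∀ Y S : Matrix (Fin 2) (Fin 2) ℤ, (∀ i j, Y i j ≡ S i j [ZMOD q]) ↔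
      red q Y = red q S := fun Y S => by
    rw [← Matrix.ext_iff]
    exact forall₂_congr fun i j => (ZMod.intCast_eq_intCast_iff _ _ _).symm
  refine Finset.sum_nbij (fun Y => tri (red q Y)) (fun _ _ => Finset.mem_univ _) ?_ ?_
    (fun _ _ => rfl)
  · intro Y hY Y' hY' h
    have e1 := sym_tri (S := red q Y) (by rw [← red_transpose, h𝒴.1 Y hY])
    have e2 := sym_tri (S := red q Y') (by rw [← red_transpose, h𝒴.1 Y' hY'])
    have hr : red q Y = red q Y' := by rw [← e1, ← e2, show tri (red q Y) = tri (red q Y') from h]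
    exact (h𝒴.2 Y' (h𝒴.1 Y' hY')).unique ⟨hY, (hc _ _).2 hr⟩ ⟨hY', (hc _ _).2 rfl⟩
  · intro y _
    obtain ⟨S, hS, hsym⟩ := exists_red_eq (sym y)
    obtain ⟨Y, ⟨hY, hY'⟩, -⟩ := h𝒴.2 S (hsym (sym_transpose y))
    refine ⟨Y, hY, ?_⟩
    change tri (red q Y) = y
    rw [(hc _ _).1 hY', hS, tri_sym]

/-- Substituting `w = z - G y ᵗG`: the entry `y₁` of `y = G⁻¹ (z - w) ᵗG⁻¹` is the value of `z - w` at
the first row of `G⁻¹`. -/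
theorem sum_congruence (G : SL(2, ℤ)) (z : ZMod q × ZMod q × ZMod q)
    (p : ZMod q × ZMod q × ZMod q → ℤ) :
    ∑ y : ZMod q × ZMod q × ZMod q, quadraticChar (ZMod q) y.1 *
      p (z - tri (red q G * sym y * (red q G)ᵀ)) =
    ∑ w, p w * quadraticChar (ZMod q) (form (z - w) (repRow q G)) := by
  set g := red q G
  set g' := red q ((G⁻¹ : SL(2, ℤ)) : Matrix (Fin 2) (Fin 2) ℤ) with hg'
  have h1 : g * g' = 1 := by rw [hg', ← map_mul, SL2_mul_inv, map_one]
  have h2 : g' * g = 1 := mul_eq_one_comm.1 h1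
  have h1' : g'ᵀ * gᵀ = 1 := by rw [← transpose_mul, h1, transpose_one]
  have h2' : gᵀ * g'ᵀ = 1 := by rw [← transpose_mul, h2, transpose_one]
  let e : ZMod q × ZMod q × ZMod q ≃ ZMod q × ZMod q × ZMod q :=
    { toFun := fun y => z - tri (g * sym y * gᵀ)
      invFun := fun w => tri (g' * sym (z - w) * g'ᵀ)
      left_inv := fun y => by
        change tri (g' * sym (z - (z - tri (g * sym y * gᵀ))) * g'ᵀ) = y
        rw [sub_sub_cancel, sym_tri (conj_symm g (sym_transpose y))]
        have : g' * (g * sym y * gᵀ) * g'ᵀ = (g' * g) * sym y * (gᵀ * g'ᵀ) := by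
          simp only [Matrix.mul_assoc]
        rw [this, h2, h2', Matrix.one_mul, Matrix.mul_one, tri_sym]
      right_inv := fun w => by
        change z - tri (g * sym (tri (g' * sym (z - w) * g'ᵀ)) * gᵀ) = w
        rw [sym_tri (conj_symm g' (sym_transpose _))]
        have : g * (g' * sym (z - w) * g'ᵀ) * gᵀ = (g * g') * sym (z - w) * (g'ᵀ * gᵀ) := by
          simp only [Matrix.mul_assoc]
        rw [this, h1, h1', Matrix.one_mul, Matrix.mul_one, tri_sym, sub_sub_cancel] }
  rw [← e.symm.sum_comp]
  refine Finset.sum_congr rfl fun w _ => ?_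
  have e1 : z - tri (g * sym (e.symm w) * gᵀ) = w := e.right_inv w
  have e2 : (e.symm w).1 = form (z - w) (repRow q G) := by
    change (g' * sym (z - w) * g'ᵀ) 0 0 = _
    have h00 : g' 0 0 = (G 1 1 : ZMod q) := by
      rw [hg', Matrix.SpecialLinearGroup.coe_inv, adjugate_fin_two]; simp [red_apply]
    have h01 : g' 0 1 = -(G 0 1 : ZMod q) := by
      rw [hg', Matrix.SpecialLinearGroup.coe_inv, adjugate_fin_two]; simp [red_apply]
    simp only [mul_apply, Fin.sum_univ_two, transpose_apply, h00, h01, sym, form, repRow, of_apply,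
      cons_val', cons_val_zero, cons_val_one, cons_val_fin_one]
    ring
  rw [e1, e2, mul_comm]

open Classical in
/-- The sum over the representatives `G`, `Y` of the twist operator, as a sum over the plane. -/
theorem sum_reps {𝒢 : Finset SL(2, ℤ)} (h𝒢 : IsCosetReps q 𝒢)
    {𝒴 : Finset (Matrix (Fin 2) (Fin 2) ℤ)} (h𝒴 : IsSymmReps q 𝒴)
    (z : ZMod q × ZMod q × ZMod q) (r : ZMod q) :
    ((q : ℤ) - 1) * ∑ G ∈ 𝒢, ∑ Y ∈ 𝒴, legendreSym q (Y 0 0) *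
      (if IsRankOne r (z - tri (red q ((G : Matrix (Fin 2) (Fin 2) ℤ) * Y *
        (G : Matrix (Fin 2) (Fin 2) ℤ)ᵀ))) then 1 else 0) =
    ∑ e ∈ Finset.univ.filter (fun e : ZMod q × ZMod q => e ≠ 0),
      ∑ w, (if IsRankOne r w then quadraticChar (ZMod q) (form (z - w) e) else 0) := by
  rw [← sum_cosetReps h𝒢 (fun e => ∑ w,
    (if IsRankOne r w then quadraticChar (ZMod q) (form (z - w) e) else 0))]
  · congr 1
    refine Finset.sum_congr rfl fun G _ => ?_
    have h := sum_congruence G z (fun w => if IsRankOne r w then 1 else 0)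
    rw [← sum_symmReps h𝒴 (fun y => quadraticChar (ZMod q) y.1 *
      (if IsRankOne r (z - tri (red q G * sym y * (red q G)ᵀ)) then 1 else 0))] at h
    simp only [ite_mul, one_mul, zero_mul] at h
    rw [← h]
    refine Finset.sum_congr rfl fun Y hY => ?_
    rw [sym_tri (by rw [← red_transpose, h𝒴.1 Y hY]), map_mul, map_mul, red_transpose]
    rfl
  · intro l hl e
    refine Finset.sum_congr rfl fun w _ => ?_
    congr 1
    have : form (z - w) (l * e.1, l * e.2) = l ^ 2 * form (z - w) e := by
      simp only [form]; ring
    rw [this, map_mul, quadraticChar_sq_one' hl, one_mul]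

end Reps

/-! ### Slopes with a single power of `q` in the denominator -/

theorem OrbitRep.exists_inv {R : Type*} [CommRing R] {M₀ M N : Matrix (Fin 2) (Fin 2) R} {u : R}
    (h : OrbitRep M₀ M N u) : ∃ X Y, M * X + N * Y = 1 := by
  obtain ⟨E, A, B, D, hE, hAD, -, rfl, rfl, -⟩ := h
  have hDA : D * Aᵀ = 1 := by simpa [transpose_mul] using congrArg transpose hAD
  have hEE : E * E.adjugate = 1 := by rw [mul_adjugate, hE, one_smul]
  refine ⟨-(Dᵀ * (B * (Aᵀ * E.adjugate))), Aᵀ * E.adjugate, ?_⟩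
  have h1 : A * (Dᵀ * (B * (Aᵀ * E.adjugate))) = B * (Aᵀ * E.adjugate) := by
    rw [← Matrix.mul_assoc, hAD, Matrix.one_mul]
  have h2 : D * (Aᵀ * E.adjugate) = E.adjugate := by rw [← Matrix.mul_assoc, hDA, Matrix.one_mul]
  simp only [Matrix.mul_neg, Matrix.mul_assoc, Matrix.add_mul, h1, h2, Matrix.mul_add, hEE]
  abel

/-- A representation from `A` and from `N ᵗA = M₀ S + 1`, where `S` is symmetric. -/
theorem orbitRep_of {R : Type*} [CommRing R] {M₀ N A D S : Matrix (Fin 2) (Fin 2) R}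
    (hAD : A * Dᵀ = 1) (hS : Sᵀ = S) (hN : N * Aᵀ = M₀ * S + 1) :
    OrbitRep M₀ (M₀ * A) N A.det := by
  have hDA : Aᵀ * D = 1 := by
    have := congrArg transpose (mul_comm_eq_one hAD)
    simpa [transpose_mul] using this
  refine ⟨1, A, S * D, D, det_one, hAD, ?_, by rw [Matrix.one_mul], ?_, rfl⟩
  · have hDA' : D * Aᵀ = 1 := mul_comm_eq_one hDA
    rw [transpose_mul, hS, ← Matrix.mul_assoc, hAD, Matrix.one_mul, Matrix.mul_assoc, hDA',
      Matrix.mul_one]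
  · rw [Matrix.one_mul, ← Matrix.mul_assoc]
    calc N = N * (Aᵀ * D) := by rw [hDA, Matrix.mul_one]
      _ = (M₀ * S + 1) * D := by rw [← Matrix.mul_assoc, hN]
      _ = M₀ * S * D + D := by rw [Matrix.add_mul, Matrix.one_mul]

/-- A symmetric pair is primitive if it is so modulo `n` and away from `n`. -/
theorem isPrimPair_of_mod {n i : ℕ} {P Q X Y : Matrix (Fin 2) (Fin 2) ℤ} {c : ℤ}
    (hs : P * Qᵀ = Q * Pᵀ) (h : P * X + Q * Y = c • (1 : Matrix (Fin 2) (Fin 2) ℤ))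
    (hc : c ∣ (n : ℤ) ^ i) (hn : ∃ X Y, red n P * X + red n Q * Y = 1) : IsPrimPair P Q := by
  obtain ⟨X', Y', h'⟩ := hn
  obtain ⟨X', rfl, -⟩ := exists_red_eq X'
  obtain ⟨Y', rfl, -⟩ := exists_red_eq Y'
  set K := P * X' + Q * Y' with hK
  have hKr : red n K = 1 := by rw [hK, map_add, map_mul, map_mul, h']
  have hd : (n : ℤ) ∣ K.det - 1 := by
    rw [← ZMod.intCast_zmod_eq_zero_iff_dvd, Int.cast_sub, ← red_det, hKr, det_one, Int.cast_one,
      sub_self]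
  have hcop : IsCoprime c K.det := by
    refine IsCoprime.of_isCoprime_of_dvd_left (IsCoprime.pow_left ?_) hc
    obtain ⟨t, ht⟩ := hd
    exact ⟨-t, 1, by linear_combination ht⟩
  obtain ⟨a, b, hab⟩ := hcop
  refine ⟨hs, a • X + b • (X' * K.adjugate), a • Y + b • (Y' * K.adjugate), ?_⟩
  have e : P * (a • X + b • (X' * K.adjugate)) + Q * (a • Y + b • (Y' * K.adjugate)) =
      a • (P * X + Q * Y) + b • (K * K.adjugate) := by
    rw [hK]
    simp only [Matrix.mul_add, Matrix.add_mul, Matrix.mul_smul, smul_add, Matrix.mul_assoc]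
    abel
  rw [e, h, mul_adjugate, smul_smul, smul_smul, ← add_smul, hab, one_smul]

/-- The slope `s` is `M⁻¹N + Z / q`, with `Z` integral symmetric and `(M N)` a primitive pair whose
slope is integral at `q`. Only `Z` modulo `q` matters for the local behaviour at `q`. -/
structure LocalDecomp (q : ℕ) (s : ℚ × ℚ × ℚ) (M N Z : Matrix (Fin 2) (Fin 2) ℤ) : Prop where
  prim : IsPrimPair M N
  det_pos : 0 < M.det
  not_dvd : ¬ (q : ℤ) ∣ M.det
  symm : Zᵀ = Z
  slope : toRat M * ((q : ℚ) • sym s) = toRat ((q : ℤ) • N + M * Z)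

theorem toRat_smul (c : ℤ) (M : Matrix (Fin 2) (Fin 2) ℤ) : toRat (c • M) = (c : ℚ) • toRat M := by
  ext i j
  rw [toRat_apply, Matrix.smul_apply, Matrix.smul_apply, toRat_apply, smul_eq_mul, smul_eq_mul,
    Int.cast_mul]

theorem LocalDecomp.mul_left {q : ℕ} {s : ℚ × ℚ × ℚ} {M N Z : Matrix (Fin 2) (Fin 2) ℤ}
    (h : LocalDecomp q s M N Z) (E : SL(2, ℤ)) :
    LocalDecomp q s ((E : Matrix (Fin 2) (Fin 2) ℤ) * M) ((E : Matrix (Fin 2) (Fin 2) ℤ) * N) Z := by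
  have hdet : ((E : Matrix (Fin 2) (Fin 2) ℤ) * M).det = M.det := by
    rw [det_mul, E.det_coe, one_mul]
  refine ⟨⟨?_, ?_⟩, by rw [hdet]; exact h.det_pos, by rw [hdet]; exact h.not_dvd, h.symm, ?_⟩
  · have := h.prim.symm
    rw [transpose_mul, transpose_mul, Matrix.mul_assoc, ← Matrix.mul_assoc M, this]
    simp only [Matrix.mul_assoc]
  · obtain ⟨X, Y, hXY⟩ := h.prim.exists_inv
    refine ⟨X * ((E⁻¹ : SL(2, ℤ)) : Matrix (Fin 2) (Fin 2) ℤ),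
      Y * ((E⁻¹ : SL(2, ℤ)) : Matrix (Fin 2) (Fin 2) ℤ), ?_⟩
    calc _ = (E : Matrix (Fin 2) (Fin 2) ℤ) * (M * X + N * Y) *
          ((E⁻¹ : SL(2, ℤ)) : Matrix (Fin 2) (Fin 2) ℤ) := by
            simp only [Matrix.mul_add, Matrix.add_mul, Matrix.mul_assoc]
      _ = 1 := by rw [hXY, Matrix.mul_one, SL2_mul_inv]
  · rw [map_mul, Matrix.mul_assoc, h.slope, ← map_mul]
    congr 1
    rw [Matrix.mul_add, Matrix.mul_smul, Matrix.mul_assoc]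

theorem LocalDecomp.sub {q : ℕ} (hq : q ≠ 0) {s : ℚ × ℚ × ℚ} {M N Z W : Matrix (Fin 2) (Fin 2) ℤ}
    (h : LocalDecomp q s M N Z) (hW : Wᵀ = W) : LocalDecomp q (s - divq q W) M N (Z - W) := by
  refine ⟨h.prim, h.det_pos, h.not_dvd, by rw [transpose_sub, h.symm, hW], ?_⟩
  have hq' : (q : ℚ) ≠ 0 := by exact_mod_cast hq
  have e : sym (s - divq q W) = sym s - (1 / (q : ℚ)) • toRat W := by
    rw [eq_sub_iff_add_eq, ← sym_divq q hW, ← sym_add, sub_add_cancel]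
  rw [e, smul_sub, smul_smul, mul_one_div_cancel hq', one_smul, Matrix.mul_sub, h.slope, ← map_mul,
    ← map_sub, Matrix.mul_sub]
  congr 1
  abel

/-- A slope whose denominator is `m q`, with `m` prime to `q`, has a decomposition. -/
theorem exists_localDecomp {q : ℕ} [Fact q.Prime] {s : ℚ × ℚ × ℚ} {m : ℤ} (hm : ¬ (q : ℤ) ∣ m)
    {X : Matrix (Fin 2) (Fin 2) ℤ} (hX : toRat X = ((m * q : ℤ) : ℚ) • sym s) :
    ∃ M N Z, LocalDecomp q s M N Z := by
  have hp : Prime (q : ℤ) := Nat.prime_iff_prime_int.1 Fact.out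
  have hq' : (q : ℚ) ≠ 0 := by exact_mod_cast hp.ne_zero
  obtain ⟨t, m', htm⟩ : IsCoprime (q : ℤ) m := (hp.coprime_iff_not_dvd).2 hm
  have hXs : Xᵀ = X := toRat_injective (by rw [toRat_transpose, hX, transpose_smul, sym_transpose])
  have hZs : (m' • X)ᵀ = m' • X := by rw [transpose_smul, hXs]
  set s₁ := s - divq q (m' • X) with hs₁
  have e : sym s₁ = sym s - (1 / (q : ℚ)) • toRat (m' • X) := by
    rw [eq_sub_iff_add_eq, ← sym_divq q hZs, ← sym_add, sub_add_cancel]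
  -- `m s₁ = t X` is integral
  have hms : (m : ℚ) • sym s₁ = toRat (t • X) := by
    have htq : (t : ℚ) * q + m' * m = 1 := by exact_mod_cast htm
    rw [e, toRat_smul, toRat_smul, hX, smul_sub, smul_smul, smul_smul, smul_smul, smul_smul, ← sub_smul]
    congr 1
    push_cast
    field_simp
    linear_combination -(m : ℚ) * htq
  obtain ⟨M, N, hprim, hdet, hslope⟩ := exists_primPair s₁
  refine ⟨M, N, m' • X, hprim, hdet, fun hdvd => hm ?_, hZs, ?_⟩
  · obtain ⟨X₀, Y₀, hXY⟩ := hprim.exists_inv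
    have h1 : toRat M * (toRat X₀ + sym s₁ * toRat Y₀) = 1 := by
      rw [Matrix.mul_add, ← Matrix.mul_assoc, ← hslope, ← map_mul, ← map_mul, ← map_add, hXY, map_one]
    have h2 := mul_comm_eq_one h1
    have h3 : (m • X₀ + t • X * Y₀) * M = m • (1 : Matrix (Fin 2) (Fin 2) ℤ) := by
      apply toRat_injective
      rw [map_mul, map_add, map_mul, ← hms, toRat_smul, toRat_smul, map_one, Matrix.smul_mul,
        ← smul_add, Matrix.smul_mul, h2]
    have h4 := congrArg det h3
    rw [det_mul, det_smul, det_one, mul_one, Fintype.card_fin] at h4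
    exact hp.dvd_of_dvd_pow (h4 ▸ hdvd.mul_left _)
  · have : sym s = sym s₁ + (1 / (q : ℚ)) • toRat (m' • X) := by rw [e]; abel
    rw [this, smul_add, smul_smul, mul_one_div_cancel hq', one_smul, Matrix.mul_add,
      Matrix.mul_smul, ← hslope, map_add, map_mul, toRat_smul _ N, Int.cast_natCast]

/-- A primitive pair of slope `s = M⁻¹ N + Z / q`: scale by a matrix `h` for which `h M Z / q` is
integral. It is primitive as soon as it is so modulo `q²`. -/
theorem LocalDecomp.scaled_pair {q : ℕ} (hq : q ≠ 0) {s : ℚ × ℚ × ℚ}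
    {M N Z h V : Matrix (Fin 2) (Fin 2) ℤ} (D : LocalDecomp q s M N Z) {j : ℕ}
    (hh : h.det = (q : ℤ) ^ j) (hV : (q : ℤ) • V = h * M * Z)
    (hn : ∃ X Y, red (q ^ 2) (h * M) * X + red (q ^ 2) (h * N + V) * Y = 1) :
    IsPrimPair (h * M) (h * N + V) ∧ 0 < (h * M).det ∧
      toRat (h * N + V) = toRat (h * M) * sym s := by
  have hq' : (q : ℚ) ≠ 0 := by exact_mod_cast hq
  have hs : toRat (h * N + V) = toRat (h * M) * sym s := by
    have h1 : (q : ℚ) • toRat (h * N + V) = (q : ℚ) • (toRat (h * M) * sym s) := by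
      have h2 := D.slope
      rw [← Matrix.mul_smul, map_mul, Matrix.mul_assoc, h2, ← map_mul]
      have h3 := toRat_smul q (h * N + V)
      rw [Int.cast_natCast] at h3
      rw [← h3, smul_add, hV, Matrix.mul_add, Matrix.mul_smul, Matrix.mul_assoc]
    exact smul_right_injective _ hq' h1
  have hsym : h * M * (h * N + V)ᵀ = (h * N + V) * (h * M)ᵀ := by
    apply toRat_injective
    rw [map_mul toRat (h * M), map_mul toRat (h * N + V), toRat_transpose, toRat_transpose, hs,
      transpose_mul, sym_transpose,
      Matrix.mul_assoc]
  refine ⟨?_, ?_, hs⟩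
  · obtain ⟨X, Y, hXY⟩ := D.prim.exists_inv
    refine isPrimPair_of_mod (n := q ^ 2) (i := j + 1) (c := q * q ^ j)
      (X := ((q : ℤ) • X - Z * Y) * h.adjugate) (Y := ((q : ℤ) • Y) * h.adjugate) hsym ?_ ?_ hn
    · have e1 : h * M * ((q : ℤ) • X - Z * Y) + (h * N + V) * ((q : ℤ) • Y) = (q : ℤ) • h := by
        have : (q : ℤ) • (h * (M * X + N * Y)) = (q : ℤ) • h := by rw [hXY, Matrix.mul_one]
        rw [← this, Matrix.mul_sub, Matrix.mul_smul, Matrix.mul_smul, Matrix.add_mul, smul_add,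
          ← Matrix.smul_mul _ V, hV, Matrix.mul_add, smul_add]
        simp only [Matrix.mul_assoc]
        abel
      rw [← Matrix.mul_assoc, ← Matrix.mul_assoc, ← Matrix.add_mul, e1, Matrix.smul_mul,
        mul_adjugate, hh, smul_smul]
    · push_cast
      rw [← pow_mul, ← pow_succ']
      exact pow_dvd_pow _ (by omega)
  · rw [det_mul, hh]
    have : (0 : ℤ) < q := by exact_mod_cast Nat.pos_of_ne_zero hq
    exact mul_pos (pow_pos this j) D.det_pos

/-! ### Orbit representations modulo `q²` -/

section Ring

variable {R : Type*} [CommRing R]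

theorem OrbitRep.det_eq {M₀ M N : Matrix (Fin 2) (Fin 2) R} {u : R} (h : OrbitRep M₀ M N u) :
    M.det = M₀.det * u := by
  obtain ⟨E, A, B, D, hE, -, -, rfl, -, rfl⟩ := h
  rw [det_mul, det_mul, hE, one_mul]

theorem orbitRep_one {M N : Matrix (Fin 2) (Fin 2) R} (hs : M * Nᵀ = N * Mᵀ) (hM : IsUnit M.det) :
    OrbitRep 1 M N M.det := by
  have hMi : M * (M⁻¹) = 1 := mul_nonsing_inv M hM
  have := orbitRep_of (M₀ := 1) (N := N) (A := M) (D := (M⁻¹)ᵀ) (S := N * Mᵀ - 1)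
    (by rw [transpose_transpose, hMi])
    (by rw [transpose_sub, transpose_mul, transpose_transpose, transpose_one, hs])
    (by rw [Matrix.one_mul, sub_add_cancel])
  rwa [Matrix.one_mul] at this

theorem orbitRep_rankOne {q a b t : R} (hab : a * b = 1) {M Q : Matrix (Fin 2) (Fin 2) R}
    (hM : IsUnit M.det) (hs : diagonal ![1, q] * M * Qᵀ = Q * (diagonal ![1, q] * M)ᵀ)
    (ht : (Q * Mᵀ) 1 1 = a + q * t) :
    ∃ u, OrbitRep (diagonal ![1, q * a]) (diagonal ![1, q] * M) Q u := by
  have hMi : M * (M⁻¹) = 1 := mul_nonsing_inv M hM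
  set U := Q * Mᵀ with hU
  have hUs : U * diagonal ![1, q] = diagonal ![1, q] * Uᵀ := by
    rw [hU, transpose_mul, transpose_transpose, Matrix.mul_assoc, ← Matrix.mul_assoc (diagonal _),
      hs, transpose_mul, diagonal_transpose]
  have h10 : U 1 0 = q * U 0 1 := by
    have := congr_fun (congr_fun hUs 1) 0
    simpa [mul_apply, Fin.sum_univ_two] using this
  have hd : diagonal ![1, b] * diagonal ![1, a] = (1 : Matrix (Fin 2) (Fin 2) R) := by
    rw [diagonal_mul_diagonal, ← diagonal_one]
    congr 1; funext i; fin_cases i <;> simp [mul_comm b, hab]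
  have hd' : diagonal ![1, q * a] * diagonal ![1, b] =
      (diagonal ![1, q] : Matrix (Fin 2) (Fin 2) R) := by
    rw [diagonal_mul_diagonal]
    congr 1; funext i; fin_cases i <;> simp [mul_assoc, hab]
  have := orbitRep_of (M₀ := diagonal ![1, q * a]) (N := Q) (A := diagonal ![1, b] * M)
    (D := diagonal ![1, a] * (M⁻¹)ᵀ) (S := !![U 0 0 - 1, b * U 0 1; b * U 0 1, b ^ 2 * t])
    (by rw [transpose_mul, transpose_transpose, diagonal_transpose, Matrix.mul_assoc,
          ← Matrix.mul_assoc M, hMi, Matrix.one_mul, hd])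
    (by ext i j; fin_cases i <;> fin_cases j <;> rfl)
    (by
      rw [transpose_mul, diagonal_transpose, ← Matrix.mul_assoc, ← hU]
      ext i j
      fin_cases i <;> fin_cases j <;> simp [mul_apply, Fin.sum_univ_two]
      · ring
      · rw [h10]; linear_combination -q * U 0 1 * hab
      · rw [ht]; linear_combination (1 - q * b * t) * hab)
  rw [← Matrix.mul_assoc, hd'] at this
  exact ⟨_, this⟩

theorem orbitRep_of_smul {q α : R} {M Q : Matrix (Fin 2) (Fin 2) R} (hQ : IsUnit Q.det)
    (h : q • (M * Qᵀ) = diagonal ![q, q * α]) : ∃ u, OrbitRep (diagonal ![q, q * α]) (q • M) Q u := by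
  have hQi : Qᵀ * (Q⁻¹)ᵀ = 1 := by rw [← transpose_mul, nonsing_inv_mul Q hQ, transpose_one]
  have := orbitRep_of (M₀ := diagonal ![q, q * α]) (N := Q) (A := (Q⁻¹)ᵀ) (D := Q) (S := 0)
    (by rw [← transpose_mul, mul_nonsing_inv Q hQ, transpose_one]) transpose_zero
    (by rw [transpose_transpose, mul_nonsing_inv Q hQ, Matrix.mul_zero, zero_add])
  have e : diagonal ![q, q * α] * (Q⁻¹)ᵀ = q • M := by
    rw [← h, Matrix.smul_mul, Matrix.mul_assoc, hQi, Matrix.mul_one]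
  rw [e] at this
  exact ⟨_, this⟩

/-- `N ᵗM` in terms of a representation. -/
theorem OrbitRep.exists_gram {M₀ M N : Matrix (Fin 2) (Fin 2) R} {u : R} (h : OrbitRep M₀ M N u)
    (hM₀ : M₀ᵀ = M₀) : ∃ E A D S : Matrix (Fin 2) (Fin 2) R, E.det = 1 ∧ A * Dᵀ = 1 ∧ Sᵀ = S ∧
      M = E * (M₀ * A) ∧ N * Mᵀ = E * (M₀ * S * M₀ + M₀) * Eᵀ ∧ u = A.det := by
  obtain ⟨E, A, B, D, hE, hAD, hAB, rfl, rfl, rfl⟩ := h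
  have hDA : D * Aᵀ = 1 := by simpa [transpose_mul] using congrArg transpose hAD
  refine ⟨E, A, D, B * Aᵀ, hE, hAD, by rw [transpose_mul, transpose_transpose, hAB], rfl, ?_, rfl⟩
  rw [transpose_mul, transpose_mul, hM₀]
  have : E * (M₀ * B + D) * (Aᵀ * M₀ * Eᵀ) = E * (M₀ * (B * Aᵀ) * M₀ + D * Aᵀ * M₀) * Eᵀ := by
    simp only [Matrix.mul_add, Matrix.add_mul, Matrix.mul_assoc]
  rw [this, hDA, Matrix.one_mul]

/-- For a pair `(diag(1, q) M, Q)` of type `diag(1, qa)` the lower right entry of `Q ᵗM` determines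
`a` modulo `q` up to squares. -/
theorem OrbitRep.rankOne_value {q a u : R} (hq : q * q = 0) {M Q : Matrix (Fin 2) (Fin 2) R}
    (h : OrbitRep (diagonal ![1, q * a]) (diagonal ![1, q] * M) Q u) :
    ∃ e g t, q * (Q * Mᵀ) 1 1 = q * (a * e ^ 2) ∧ e * g = 1 + q * t := by
  obtain ⟨E, A, D, S, hE, hAD, hS, hM, hN, -⟩ := h.exists_gram (diagonal_transpose _)
  -- the lower left entry of `E` is divisible by `q`, as the first row of `A` is unimodular
  obtain ⟨f, hf⟩ : ∃ f, E 1 0 = q * f := by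
    have h00 := congr_fun (congr_fun hAD 0) 0
    have h0 := congr_fun (congr_fun hM 1) 0
    have h1 := congr_fun (congr_fun hM 1) 1
    simp [mul_apply, Fin.sum_univ_two] at h00 h0 h1
    refine ⟨(M 1 0 - E 1 1 * a * A 1 0) * D 0 0 + (M 1 1 - E 1 1 * a * A 1 1) * D 0 1, ?_⟩
    linear_combination -E 1 0 * h00 - D 0 0 * h0 - D 0 1 * h1
  rw [det_fin_two] at hE
  refine ⟨E 1 1, E 0 0, E 0 1 * f, ?_, by rw [hf] at hE; linear_combination hE⟩
  have h11 := congr_fun (congr_fun hN 1) 1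
  rw [transpose_mul, diagonal_transpose, ← Matrix.mul_assoc] at h11
  simp [mul_apply, Fin.sum_univ_two] at h11
  rw [hf] at h11
  have hS' : S 1 0 = S 0 1 := congr_fun (congr_fun hS 0) 1
  rw [hS'] at h11
  simp only [mul_apply, Fin.sum_univ_two, transpose_apply]
  linear_combination h11 + (f ^ 2 * (S 0 0 + 1) + 2 * f * a * E 1 1 * S 0 1 +
    a ^ 2 * E 1 1 ^ 2 * S 1 1) * hq

/-- For a pair `(q M, Q)` of type `diag(q, qα)` the determinant of `Q ᵗM` is `α` modulo `q`, and that of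
`M` is `α u`. -/
theorem OrbitRep.smul_value {q α u : R} (hq : q * q = 0) {M Q : Matrix (Fin 2) (Fin 2) R}
    (h : OrbitRep (diagonal ![q, q * α]) (q • M) Q u) :
    ∃ E A : Matrix (Fin 2) (Fin 2) R, E.det = 1 ∧ u = A.det ∧
      q • (Q * Mᵀ) = q • (E * diagonal ![1, α] * Eᵀ) ∧ q • M = q • (E * (diagonal ![1, α] * A)) := by
  obtain ⟨E, A, D, S, hE, hAD, hS, hM, hN, hu⟩ := h.exists_gram (diagonal_transpose _)
  have hd : diagonal ![q, q * α] = q • (diagonal ![1, α] : Matrix (Fin 2) (Fin 2) R) := by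
    rw [← diagonal_smul]; congr 1; funext i; fin_cases i <;> simp
  refine ⟨E, A, hE, hu, ?_, ?_⟩
  · rw [hd, transpose_smul, Matrix.mul_smul] at hN
    rw [hN]
    simp only [Matrix.smul_mul, Matrix.mul_smul, smul_smul, hq, zero_smul, zero_add]
  · rw [hM, hd, Matrix.smul_mul, Matrix.mul_smul]

end Ring

/-- Reduction from `ℤ/q²` to `ℤ/q`. -/
def proj (q : ℕ) : ZMod (q ^ 2) →+* ZMod q := ZMod.castHom (dvd_pow_self q two_ne_zero) (ZMod q)

theorem proj_intCast (q : ℕ) (a : ℤ) : proj q (a : ZMod (q ^ 2)) = a := map_intCast _ a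

theorem proj_natCast (q a : ℕ) : proj q (a : ZMod (q ^ 2)) = a := map_natCast _ a

theorem proj_eq_of_mul_eq {q : ℕ} (hq : q ≠ 0) {a b : ZMod (q ^ 2)}
    (h : (q : ZMod (q ^ 2)) * a = (q : ZMod (q ^ 2)) * b) : proj q a = proj q b := by
  obtain ⟨a, rfl⟩ := ZMod.intCast_surjective a
  obtain ⟨b, rfl⟩ := ZMod.intCast_surjective b
  rw [proj_intCast, proj_intCast, ZMod.intCast_eq_intCast_iff_dvd_sub]
  have h' : (((q : ℤ) * a : ℤ) : ZMod (q ^ 2)) = ((q * b : ℤ) : ZMod (q ^ 2)) := by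
    push_cast; exact h
  rw [ZMod.intCast_eq_intCast_iff_dvd_sub, ← mul_sub] at h'
  push_cast at h'
  rw [sq] at h'
  exact (mul_dvd_mul_iff_left (by exact_mod_cast hq)).1 h'

theorem natCast_mul_self (q : ℕ) : (q : ZMod (q ^ 2)) * q = 0 := by
  rw [← Nat.cast_mul, ← sq, ZMod.natCast_self]

theorem proj_map_red (q : ℕ) (M : Matrix (Fin 2) (Fin 2) ℤ) :
    (proj q).mapMatrix (red (q ^ 2) M) = red q M := by
  ext i j
  exact proj_intCast q _

theorem proj_map_eq_of_smul_eq {q : ℕ} (hq : q ≠ 0) {A B : Matrix (Fin 2) (Fin 2) (ZMod (q ^ 2))}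
    (h : (q : ZMod (q ^ 2)) • A = (q : ZMod (q ^ 2)) • B) :
    (proj q).mapMatrix A = (proj q).mapMatrix B := by
  ext i j
  exact proj_eq_of_mul_eq hq (congr_fun (congr_fun h i) j)

theorem isUnit_intCast_sq {q : ℕ} [Fact q.Prime] {a : ℤ} (h : ¬ (q : ℤ) ∣ a) :
    IsUnit (a : ZMod (q ^ 2)) := by
  have hp : Prime (q : ℤ) := Nat.prime_iff_prime_int.1 Fact.out
  obtain ⟨r, t, hrt⟩ := IsCoprime.pow_left (m := 2) (hp.coprime_iff_not_dvd.2 h)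
  refine IsUnit.of_mul_eq_one (t : ZMod (q ^ 2)) ?_
  have := congrArg (Int.cast : ℤ → ZMod (q ^ 2)) hrt
  have h0 : ((q : ZMod (q ^ 2)) ^ 2) = 0 := by rw [← Nat.cast_pow, ZMod.natCast_self]
  push_cast at this
  rw [h0] at this
  linear_combination this

/-! ### The coefficient as a product of local factors -/

/-- The splitting `χ = χ_q χ'` of a quadratic character modulo `n = q n'`, with `χ_q` the Legendre
symbol. -/
structure CharSplit {n n' : ℕ} (q : ℕ) [Fact q.Prime] (χ : DirichletCharacter ℂ n)
    (χ' : DirichletCharacter ℂ n') : Prop where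
  eq_mul : n = q * n'
  coprime : q.Coprime n'
  pos : 0 < n'
  sq : χ ^ 2 = 1
  sq' : χ' ^ 2 = 1
  split : ∀ u : ℤ, χ (u : ZMod n) = (legendreSym q u : ℂ) * χ' (u : ZMod n')

section Local

variable {n n' q : ℕ} [Fact q.Prime] {χ : DirichletCharacter ℂ n} {χ' : DirichletCharacter ℂ n'}

theorem CharSplit.level (S : CharSplit q χ χ') : q * n = q ^ 2 * n' := by
  rw [S.eq_mul, ← mul_assoc, ← _root_.sq]

theorem CharSplit.orbitCoeff_eq_zero (S : CharSplit q χ χ') {M₀ P Q : Matrix (Fin 2) (Fin 2) ℤ}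
    (h : ¬ ∃ u, OrbitRep (red (q ^ 2) M₀) (red (q ^ 2) P) (red (q ^ 2) Q) u) :
    orbitCoeff χ (q * n) M₀ P Q = 0 := by
  refine SiegelEis.orbitCoeff_eq_zero fun ⟨γ, hγ⟩ => h ⟨_, hγ.orbitRep ?_⟩
  rw [S.level]
  exact dvd_mul_right _ _

/-- The coefficient is the product of a Legendre symbol, computed modulo `q²`, and of the local
coefficient modulo `n'`. That local representations come from the orbit is strong approximation, in
the form of `exists_inOrbit`. -/
theorem CharSplit.orbitCoeff_eq (S : CharSplit q χ χ') {x y : ℤ} (hx : IdempotentMod n x y)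
    (hx' : IdempotentMod n' x y) {P Q : Matrix (Fin 2) (Fin 2) ℤ} (hPQ : IsPrimPair P Q) {c : ℤ}
    (hex : ∃ u, OrbitRep (red (q ^ 2) (diagonal ![x, y])) (red (q ^ 2) P) (red (q ^ 2) Q) u)
    (hc : ∀ u : ℤ, OrbitRep (red (q ^ 2) (diagonal ![x, y])) (red (q ^ 2) P) (red (q ^ 2) Q) u →
      legendreSym q u = c) :
    orbitCoeff χ (q * n) (diagonal ![x, y]) P Q =
      c * localCoeff χ' (red n' (diagonal ![x, y])) (red n' P) (red n' Q) := by
  by_cases h : ∃ γ : Gamma0 (q * n), InOrbit (diagonal ![x, y]) P Q γ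
  · obtain ⟨γ, hγ⟩ := h
    rw [SiegelEis.orbitCoeff_eq S.sq (dvd_mul_left _ _) hx.1 hx.2 hx.3 hγ, S.split,
      hc _ (hγ.orbitRep (by rw [S.level]; exact dvd_mul_right _ _))]
    have r := hγ.orbitRep (n := n') (by rw [S.level]; exact dvd_mul_left _ _)
    rw [red_diagonal] at r ⊢
    rw [localCoeff_eq S.sq' hx'.1 hx'.2 hx'.3 r]
  · rw [SiegelEis.orbitCoeff_eq_zero h, localCoeff_eq_zero, mul_zero]
    intro h'
    refine h (exists_inOrbit S.level (S.coprime.pow_left 2) ?_ (diagonal_transpose _) hPQ hex h')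
    rw [S.level]
    exact Nat.mul_pos (pow_pos (Fact.out : q.Prime).pos 2) S.pos

/-- The local coefficient away from `q` of a scaled pair. -/
theorem CharSplit.localCoeff_scaled (S : CharSplit q χ χ') {x y : ℤ} (hx' : IdempotentMod n' x y)
    {M N Z h V : Matrix (Fin 2) (Fin 2) ℤ} (hZ : Zᵀ = Z) {j : ℕ} (hh : h.det = (q : ℤ) ^ j)
    (hV : (q : ℤ) • V = h * M * Z) :
    localCoeff χ' (red n' (diagonal ![x, y])) (red n' (h * M)) (red n' (h * N + V)) =
      χ' (q : ZMod n') ^ j *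
        localCoeff χ' (red n' (diagonal ![x, y])) (red n' M) (red n' N) := by
  have hu : IsUnit (q : ZMod n') := (ZMod.isUnit_iff_coprime q n').2 S.coprime
  obtain ⟨b, hb⟩ := hu.exists_right_inv
  have hdet : (red n' h).det = (q : ZMod n') ^ j := by rw [red_det, hh]; push_cast; rfl
  have e : red n' (h * N + V) = red n' h * (red n' N + red n' M * (b • red n' Z)) := by
    have h1 : (q : ZMod n') • red n' V = red n' h * red n' M * red n' Z := by
      rw [← map_mul, ← map_mul, ← hV]
      ext i j
      rw [Matrix.smul_apply, red_apply, red_apply, Matrix.smul_apply, smul_eq_mul, smul_eq_mul]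
      push_cast
      rfl
    have h2 : red n' V = b • (red n' h * red n' M * red n' Z) := by
      rw [← h1, smul_smul, mul_comm b, hb, one_smul]
    rw [map_add, map_mul, h2, Matrix.mul_add, Matrix.mul_smul, Matrix.mul_smul, Matrix.mul_assoc]
  rw [e, map_mul, red_diagonal, localCoeff_mul_left S.sq' hx'.1 hx'.2 hx'.3
    (by rw [hdet]; exact hu.pow j) (by rw [transpose_smul, ← red_transpose, hZ]), hdet, map_pow]

end Local

/-! ### Normal forms modulo `q` -/

theorem exists_SL2_red {n : ℕ} (hn : 0 < n) {X : Matrix (Fin 2) (Fin 2) (ZMod n)} (hX : X.det = 1) :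
    ∃ E : SL(2, ℤ), red n E = X := by
  obtain ⟨m, hm, -⟩ := exists_red_eq X
  have hdet : (n : ℤ) ∣ m.det - 1 := by
    rw [← ZMod.intCast_zmod_eq_zero_iff_dvd, Int.cast_sub, ← red_det, hm, hX, Int.cast_one, sub_self]
  obtain ⟨E, hE⟩ := exists_SL2_congr hn m hdet
  exact ⟨E, hm ▸ red_eq_iff.2 hE⟩

/-- A nondegenerate binary form over a finite field represents one. -/
theorem exists_form_eq_one {F : Type*} [Field F] [Fintype F] [DecidableEq F] (hF : ringChar F ≠ 2)
    {z : F × F × F} (hz : disc z ≠ 0) : ∃ e, form z e = 1 := by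
  have hz0 : z ≠ 0 := by rintro rfl; exact hz (by simp [disc])
  obtain ⟨t, ht⟩ := exists_form_ne_zero hF hz0
  set a := z.1 + 2 * z.2.1 * t + z.2.2 * t ^ 2 with ha
  obtain ⟨x, y, hxy⟩ := FiniteField.exists_root_sum_quadratic
    (f := Polynomial.X ^ 2 - Polynomial.C a) (g := Polynomial.C (disc z) * Polynomial.X ^ 2)
    (Polynomial.degree_X_pow_sub_C two_pos a) (Polynomial.degree_C_mul_X_pow 2 hz)
    (FiniteField.odd_card_of_char_ne_two hF)
  simp only [Polynomial.eval_sub, Polynomial.eval_pow, Polynomial.eval_X, Polynomial.eval_C,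
    Polynomial.eval_mul] at hxy
  refine ⟨((x - (z.2.1 + z.2.2 * t) * y) / a, (t * x + (z.1 + z.2.1 * t) * y) / a), ?_⟩
  have h1 : x ^ 2 + disc z * y ^ 2 = a := by linear_combination hxy
  have h2 : form z (x - (z.2.1 + z.2.2 * t) * y, t * x + (z.1 + z.2.1 * t) * y) = a * a := by
    calc _ = a * (x ^ 2 + disc z * y ^ 2) := by rw [ha]; simp only [form, disc]; ring
      _ = a * a := by rw [h1]
  have h3 : form z ((x - (z.2.1 + z.2.2 * t) * y) / a, (t * x + (z.1 + z.2.1 * t) * y) / a) =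
      form z (x - (z.2.1 + z.2.2 * t) * y, t * x + (z.1 + z.2.1 * t) * y) / (a * a) := by
    simp only [form]; field_simp
  rw [h3, h2, div_self (mul_ne_zero ht ht)]

theorem det_eq_disc {F : Type*} [Field F] {S : Matrix (Fin 2) (Fin 2) F} (hS : Sᵀ = S) :
    S.det = disc (tri S) := by
  have h10 : S 1 0 = S 0 1 := congr_fun (congr_fun hS 0) 1
  rw [det_fin_two, h10, disc, tri]
  ring

theorem sym_rankOne {F : Type*} [Field F] (r : F) (v : F × F) :
    sym (rankOne r v) = r • vecMulVec ![v.1, v.2] ![v.1, v.2] := by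
  ext i j
  fin_cases i <;> fin_cases j
  · change r * v.1 ^ 2 = r * (v.1 * v.1); ring
  · change r * (v.1 * v.2) = r * (v.1 * v.2); ring
  · change r * (v.1 * v.2) = r * (v.2 * v.1); ring
  · change r * v.2 ^ 2 = r * (v.2 * v.2); ring

section Normal

variable {q : ℕ} [Fact q.Prime] {M Z : Matrix (Fin 2) (Fin 2) ℤ}

theorem intCast_ne_zero_of_not_dvd {a : ℤ} (h : ¬ (q : ℤ) ∣ a) : (a : ZMod q) ≠ 0 :=
  fun h' => h ((ZMod.intCast_zmod_eq_zero_iff_dvd a q).1 h')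

/-- A form of rank one can be brought to the shape `diag(0, r)` by `SL₂(ℤ)`. -/
theorem exists_normal_rankOne (hM : ¬ (q : ℤ) ∣ M.det) (hZ : Zᵀ = Z) {r : ZMod q}
    (h : IsRankOne r (tri (red q Z))) : ∃ E : SL(2, ℤ),
      red q ((E : Matrix (Fin 2) (Fin 2) ℤ) * M * Z * ((E : Matrix (Fin 2) (Fin 2) ℤ) * M)ᵀ) =
        diagonal ![0, r] := by
  obtain ⟨v, hv, hz⟩ := h
  have hZ' : red q Z = r • vecMulVec ![v.1, v.2] ![v.1, v.2] := by
    rw [← sym_rankOne, ← hz, sym_tri (by rw [← red_transpose, hZ])]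
  set w := red q M *ᵥ ![v.1, v.2] with hw
  have hw0 : w 0 ≠ 0 ∨ w 1 ≠ 0 := by
    by_contra! h
    have h0 : red q M *ᵥ ![v.1, v.2] = 0 := by
      rw [← hw]; ext i; fin_cases i
      · exact h.1
      · exact h.2
    have := eq_zero_of_mulVec_eq_zero (by rw [red_det]; exact intCast_ne_zero_of_not_dvd hM) h0
    exact hv (Prod.ext (congr_fun this 0) (congr_fun this 1))
  obtain ⟨a, b, hab⟩ : ∃ a b : ZMod q, a * w 0 + b * w 1 = 1 := by
    rcases hw0 with h | h
    · exact ⟨(w 0)⁻¹, 0, by rw [inv_mul_cancel₀ h]; ring⟩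
    · exact ⟨0, (w 1)⁻¹, by rw [inv_mul_cancel₀ h]; ring⟩
  obtain ⟨E, hE⟩ := exists_SL2_red (Fact.out : q.Prime).pos (X := !![w 1, -w 0; a, b])
    (by rw [det_fin_two_of]; linear_combination hab)
  refine ⟨E, ?_⟩
  have hEw : red q E *ᵥ w = ![0, 1] := by
    rw [hE]
    ext i; fin_cases i
    · simp [mulVec, dotProduct, Fin.sum_univ_two]; ring
    · simpa [mulVec, dotProduct, Fin.sum_univ_two] using hab
  rw [map_mul, map_mul, red_transpose, hZ', map_mul, Matrix.mul_smul, Matrix.smul_mul,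
    mul_vecMulVec, vecMulVec_mul, vecMul_transpose, ← mulVec_mulVec, ← hw, hEw]
  ext i j
  fin_cases i <;> fin_cases j <;> simp

/-- A nondegenerate form can be brought to the shape `diag(1, α)` by `SL₂(ℤ)`. -/
theorem exists_normal_rankTwo (hq : q ≠ 2) (hM : ¬ (q : ℤ) ∣ M.det) (hZ : Zᵀ = Z)
    (h : disc (tri (red q Z)) ≠ 0) : ∃ E : SL(2, ℤ),
      red q ((E : Matrix (Fin 2) (Fin 2) ℤ) * M * Z * ((E : Matrix (Fin 2) (Fin 2) ℤ) * M)ᵀ) =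
        diagonal ![1, (M.det : ZMod q) ^ 2 * disc (tri (red q Z))] := by
  set W := red q (M * Z * Mᵀ) with hW
  have hWs : Wᵀ = W := by rw [hW, ← red_transpose, conj_symm M hZ]
  have hdW : W.det = (M.det : ZMod q) ^ 2 * disc (tri (red q Z)) := by
    rw [← det_eq_disc (by rw [← red_transpose, hZ]), hW, red_det, red_det, det_mul, det_mul,
      det_transpose]
    push_cast; ring
  have hd : disc (tri W) ≠ 0 := by
    rw [← det_eq_disc hWs, hdW]
    exact mul_ne_zero (pow_ne_zero _ (intCast_ne_zero_of_not_dvd hM)) h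
  obtain ⟨p, hp⟩ := exists_form_eq_one (by rwa [ZMod.ringChar_zmod_n]) hd
  have h10 : W 1 0 = W 0 1 := congr_fun (congr_fun hWs 0) 1
  simp only [form, tri] at hp
  -- the second row is orthogonal to the first for the form
  obtain ⟨E, hE⟩ := exists_SL2_red (Fact.out : q.Prime).pos
    (X := !![p.1, p.2; -(p.1 * W 0 1 + p.2 * W 1 1), p.1 * W 0 0 + p.2 * W 0 1])
    (by rw [det_fin_two_of]; linear_combination hp)
  refine ⟨E, ?_⟩
  have e : red q ((E : Matrix (Fin 2) (Fin 2) ℤ) * M * Z * ((E : Matrix (Fin 2) (Fin 2) ℤ) * M)ᵀ) =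
      red q E * W * (red q E)ᵀ := by
    rw [hW, ← red_transpose, ← map_mul, ← map_mul, transpose_mul]
    simp only [Matrix.mul_assoc]
  rw [e, ← hdW, hE, det_fin_two, h10]
  ext i j
  fin_cases i <;> fin_cases j <;>
    simp only [Fin.zero_eta, Fin.mk_one, mul_apply, Fin.sum_univ_two, transpose_apply, of_apply,
      cons_val', cons_val_zero, cons_val_one, cons_val_fin_one, h10, diagonal_apply_eq,
      diagonal_apply_ne _ zero_ne_one, diagonal_apply_ne _ one_ne_zero]
  · linear_combination hp
  · ring
  · ring
  · linear_combination (W 0 0 * W 1 1 - W 0 1 ^ 2) * hp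

end Normal

/-! ### The coefficients near `q` -/

section Values

variable {n n' q : ℕ} [Fact q.Prime] {χ : DirichletCharacter ℂ n} {χ' : DirichletCharacter ℂ n'}

/-- The factor of the coefficient that does not depend on `q`. -/
noncomputable def awayCoeff {n' : ℕ} (k : ℕ) (χ' : DirichletCharacter ℂ n')
    (M₀ M N : Matrix (Fin 2) (Fin 2) ℤ) : ℂ :=
  ((M.det : ℂ) ^ k)⁻¹ * localCoeff χ' (red n' M₀) (red n' M) (red n' N)

theorem CharSplit.awayCoeff_mul_left (S : CharSplit q χ χ') {x y : ℤ} (hx' : IdempotentMod n' x y)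
    (k : ℕ) (M N : Matrix (Fin 2) (Fin 2) ℤ) (E : SL(2, ℤ)) :
    awayCoeff k χ' (diagonal ![x, y]) ((E : Matrix (Fin 2) (Fin 2) ℤ) * M)
      ((E : Matrix (Fin 2) (Fin 2) ℤ) * N) = awayCoeff k χ' (diagonal ![x, y]) M N := by
  have h := localCoeff_mul_left S.sq' hx'.1 hx'.2 hx'.3 (M := red n' M) (N := red n' N) (g := red n' E)
    (Z := 0) (by rw [red_det, E.det_coe, Int.cast_one]; exact isUnit_one) transpose_zero
  rw [Matrix.mul_zero, add_zero, red_det, E.det_coe, Int.cast_one, map_one, one_mul,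
    ← red_diagonal] at h
  rw [awayCoeff, awayCoeff, det_mul, E.det_coe, one_mul, map_mul, map_mul, h]

theorem CharSplit.wt_eq_zero (S : CharSplit q χ χ') {x y : ℤ} {k : ℕ} {s : ℚ × ℚ × ℚ}
    {M N Z h V : Matrix (Fin 2) (Fin 2) ℤ} (D : LocalDecomp q s M N Z) {j : ℕ}
    (hh : h.det = (q : ℤ) ^ j) (hV : (q : ℤ) • V = h * M * Z)
    (hn : ∃ X Y, red (q ^ 2) (h * M) * X + red (q ^ 2) (h * N + V) * Y = 1)
    (hno : ¬ ∃ u, OrbitRep (red (q ^ 2) (diagonal ![x, y])) (red (q ^ 2) (h * M))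
      (red (q ^ 2) (h * N + V)) u) :
    wt k χ (q * n) (diagonal ![x, y]) s = 0 := by
  obtain ⟨h1, h2, h3⟩ := D.scaled_pair (Fact.out : q.Prime).ne_zero hh hV hn
  rw [wt_eq k χ (q * n) _ h1 h2 h3, S.orbitCoeff_eq_zero hno, zero_mul]

theorem CharSplit.wt_eq_of_orbitRep (S : CharSplit q χ χ') {x y : ℤ} (hx : IdempotentMod n x y)
    (hx' : IdempotentMod n' x y) {k : ℕ} {s : ℚ × ℚ × ℚ}
    {M N Z h V : Matrix (Fin 2) (Fin 2) ℤ} (D : LocalDecomp q s M N Z) {j : ℕ}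
    (hh : h.det = (q : ℤ) ^ j) (hV : (q : ℤ) • V = h * M * Z) {c : ℤ}
    (hex : ∃ u, OrbitRep (red (q ^ 2) (diagonal ![x, y])) (red (q ^ 2) (h * M))
      (red (q ^ 2) (h * N + V)) u)
    (hc : ∀ u : ℤ, OrbitRep (red (q ^ 2) (diagonal ![x, y])) (red (q ^ 2) (h * M))
      (red (q ^ 2) (h * N + V)) u → legendreSym q u = c) :
    wt k χ (q * n) (diagonal ![x, y]) s =
      c * χ' (q : ZMod n') ^ j * (((q : ℂ) ^ j) ^ k)⁻¹ * awayCoeff k χ' (diagonal ![x, y]) M N := by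
  obtain ⟨h1, h2, h3⟩ := D.scaled_pair (Fact.out : q.Prime).ne_zero hh hV hex.choose_spec.exists_inv
  rw [wt_eq k χ (q * n) _ h1 h2 h3, S.orbitCoeff_eq hx hx' h1 hex hc,
    S.localCoeff_scaled hx' D.symm hh hV, awayCoeff, det_mul, hh]
  push_cast
  rw [mul_pow, mul_inv]
  ring

/-- The representations of the primitive pair of slope `s`, when `Z` is zero modulo `q`. -/
theorem LocalDecomp.exists_of_eq_zero {s : ℚ × ℚ × ℚ} {M N Z : Matrix (Fin 2) (Fin 2) ℤ}
    (D : LocalDecomp q s M N Z) (hZ : red q Z = 0) :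
    ∃ V, (q : ℤ) • V = 1 * M * Z ∧
      ∃ u, OrbitRep 1 (red (q ^ 2) (1 * M)) (red (q ^ 2) (1 * N + V)) u := by
  choose f hf using red_eq_zero_iff.1 hZ
  have hq0 : (q : ℤ) ≠ 0 := by exact_mod_cast (Fact.out : q.Prime).ne_zero
  have hZf : Z = (q : ℤ) • of f := by
    ext i j
    rw [Matrix.smul_apply, smul_eq_mul, of_apply, hf]
  have hfs : (of f)ᵀ = of f := by
    have := D.symm
    rw [hZf, transpose_smul] at this
    exact smul_right_injective _ hq0 this
  refine ⟨M * of f, by rw [Matrix.one_mul, ← Matrix.mul_smul, ← hZf], _, orbitRep_one ?_ ?_⟩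
  · rw [Matrix.one_mul, Matrix.one_mul, ← red_transpose, ← red_transpose, ← map_mul, ← map_mul]
    congr 1
    rw [transpose_add, transpose_mul, hfs, Matrix.mul_add, Matrix.add_mul, D.prim.symm,
      Matrix.mul_assoc]
  · rw [Matrix.one_mul, red_det]
    exact isUnit_intCast_sq D.not_dvd

theorem red_eq_sq_of_smul {q : ℕ} {A B : Matrix (Fin 2) (Fin 2) ℤ} (h : red q A = red q B) :
    (q : ZMod (q ^ 2)) • red (q ^ 2) A = (q : ZMod (q ^ 2)) • red (q ^ 2) B := by
  rw [red_eq_iff] at h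
  ext i j
  obtain ⟨t, ht⟩ := h i j
  rw [Matrix.smul_apply, Matrix.smul_apply, red_apply, red_apply, smul_eq_mul, smul_eq_mul,
    eq_add_of_sub_eq ht]
  push_cast
  linear_combination (t : ZMod (q ^ 2)) * natCast_mul_self q

/-- The representations of the primitive pair of slope `s`, when `Z` has rank one modulo `q`. -/
theorem LocalDecomp.exists_of_rankOne {s : ℚ × ℚ × ℚ} {M N Z : Matrix (Fin 2) (Fin 2) ℤ}
    (D : LocalDecomp q s M N Z) {r : ℤ} (hr : ¬ (q : ℤ) ∣ r)
    (hZ : red q (M * Z * Mᵀ) = diagonal ![0, (r : ZMod q)]) :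
    ∃ V, (q : ℤ) • V = diagonal ![1, (q : ℤ)] * M * Z ∧
      (∃ u, OrbitRep (diagonal ![1, (q : ZMod (q ^ 2)) * r])
        (red (q ^ 2) (diagonal ![1, (q : ℤ)] * M))
        (red (q ^ 2) (diagonal ![1, (q : ℤ)] * N + V)) u) := by
  have hq0 : (q : ℤ) ≠ 0 := by exact_mod_cast (Fact.out : q.Prime).ne_zero
  have hMu : IsUnit (red q M).det := by
    rw [red_det, isUnit_iff_ne_zero]; exact intCast_ne_zero_of_not_dvd D.not_dvd
  -- the first row of `M Z` vanishes modulo `q`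
  have hrow : red q (diagonal ![1, (q : ℤ)] * M * Z) = 0 := by
    have h1 : red q (diagonal ![1, (q : ℤ)] * M * Z) * (red q M)ᵀ = 0 := by
      rw [← red_transpose, ← map_mul, Matrix.mul_assoc (diagonal _), Matrix.mul_assoc (diagonal _),
        map_mul, hZ, red_diagonal, diagonal_mul_diagonal, ← diagonal_zero]
      congr 1; funext i; fin_cases i <;> simp
    have h2 := mul_nonsing_inv (red q M)ᵀ (by rwa [det_transpose])
    have h3 := congrArg (· * ((red q M)ᵀ)⁻¹) h1
    simpa [Matrix.mul_assoc, h2] using h3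
  choose f hf using red_eq_zero_iff.1 hrow
  have hV : (q : ℤ) • of f = diagonal ![1, (q : ℤ)] * M * Z := by
    ext i j
    rw [Matrix.smul_apply, smul_eq_mul, of_apply, hf]
  refine ⟨of f, hV, ?_⟩
  set P := diagonal ![1, (q : ℤ)] * M with hP
  set Q := diagonal ![1, (q : ℤ)] * N + of f with hQ
  have hs : P * Qᵀ = Q * Pᵀ := by
    have hq2 : (q : ℤ) • (P * Qᵀ) = (q : ℤ) • (Q * Pᵀ) := by
      have e1 : (q : ℤ) • Q = diagonal ![1, (q : ℤ)] * ((q : ℤ) • N + M * Z) := by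
        rw [hQ, smul_add, hV, Matrix.mul_add, Matrix.mul_smul, Matrix.mul_assoc]
      have e2 : M * ((q : ℤ) • N + M * Z)ᵀ = ((q : ℤ) • N + M * Z) * Mᵀ := by
        rw [transpose_add, transpose_smul, transpose_mul, D.symm, Matrix.mul_add, Matrix.add_mul,
          Matrix.mul_smul, Matrix.smul_mul, D.prim.symm, Matrix.mul_assoc]
      rw [← Matrix.mul_smul, ← transpose_smul, ← Matrix.smul_mul, e1, hP, transpose_mul,
        transpose_mul, diagonal_transpose, Matrix.mul_assoc, ← Matrix.mul_assoc M, e2]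
      simp only [Matrix.mul_assoc]
    exact smul_right_injective _ hq0 hq2
  obtain ⟨t, ht⟩ : ∃ t, (Q * Mᵀ) 1 1 = r + q * t := by
    have h11 := congr_fun (congr_fun hZ 1) 1
    rw [red_apply, diagonal_apply_eq] at h11
    have h11 : (((M * Z * Mᵀ) 1 1 : ℤ) : ZMod q) = (r : ZMod q) := h11
    rw [eq_comm, ZMod.intCast_eq_intCast_iff_dvd_sub] at h11
    obtain ⟨t, ht⟩ := h11
    refine ⟨t + (N * Mᵀ) 1 1, mul_left_cancel₀ hq0 ?_⟩
    have e1 : (q : ℤ) * (Q * Mᵀ) 1 1 = (((q : ℤ) • Q) * Mᵀ) 1 1 := by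
      rw [Matrix.smul_mul, Matrix.smul_apply, smul_eq_mul]
    have e2 : (q : ℤ) • Q * Mᵀ = diagonal ![1, (q : ℤ)] * ((q : ℤ) • (N * Mᵀ) + M * Z * Mᵀ) := by
      rw [hQ, smul_add, hV, hP, Matrix.add_mul, Matrix.mul_add, Matrix.mul_smul, Matrix.smul_mul]
      simp only [Matrix.mul_assoc]
    rw [e1, e2, diagonal_mul, Matrix.add_apply, Matrix.smul_apply, smul_eq_mul]
    change (q : ℤ) * _ = _
    linear_combination (q : ℤ) * ht
  obtain ⟨b, hb⟩ := (isUnit_intCast_sq hr).exists_right_inv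
  have hd : red (q ^ 2) (diagonal ![1, (q : ℤ)]) = diagonal ![1, (q : ZMod (q ^ 2))] := by
    rw [red_diagonal]; simp
  have := orbitRep_rankOne (q := (q : ZMod (q ^ 2))) (t := (t : ZMod (q ^ 2))) hb
    (M := red (q ^ 2) M) (Q := red (q ^ 2) Q)
    (by rw [red_det]; exact isUnit_intCast_sq D.not_dvd)
    (by rw [← hd, ← map_mul, ← hP, ← red_transpose, ← red_transpose, ← map_mul, ← map_mul, hs])
    (by
      rw [← red_transpose, ← map_mul, red_apply, ht]
      push_cast; rfl)
  rwa [← hd, ← map_mul, ← hP] at this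

/-- The representations of the primitive pair of slope `s`, when `Z` is invertible modulo `q`. -/
theorem LocalDecomp.exists_of_rankTwo {s : ℚ × ℚ × ℚ} {M N Z : Matrix (Fin 2) (Fin 2) ℤ}
    (D : LocalDecomp q s M N Z) {α : ℤ} (hα : ¬ (q : ℤ) ∣ α)
    (hZ : red q (M * Z * Mᵀ) = diagonal ![1, (α : ZMod q)]) :
    (q : ℤ) • (M * Z) = diagonal ![(q : ℤ), (q : ℤ)] * M * Z ∧
      red (q ^ 2) (diagonal ![(q : ℤ), (q : ℤ)] * M) = (q : ZMod (q ^ 2)) • red (q ^ 2) M ∧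
      red q (diagonal ![(q : ℤ), (q : ℤ)] * N + M * Z) = red q (M * Z) ∧
      (∃ u, OrbitRep (diagonal ![(q : ZMod (q ^ 2)), (q : ZMod (q ^ 2)) * α])
        (red (q ^ 2) (diagonal ![(q : ℤ), (q : ℤ)] * M))
        (red (q ^ 2) (diagonal ![(q : ℤ), (q : ℤ)] * N + M * Z)) u) := by
  have hd : ∀ X : Matrix (Fin 2) (Fin 2) ℤ, diagonal ![(q : ℤ), (q : ℤ)] * X = (q : ℤ) • X := by
    intro X
    ext i j
    rw [diagonal_mul, Matrix.smul_apply, smul_eq_mul]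
    fin_cases i <;> rfl
  have hsm : red (q ^ 2) ((q : ℤ) • M) = (q : ZMod (q ^ 2)) • red (q ^ 2) M := by
    ext i j
    rw [Matrix.smul_apply, red_apply, red_apply, Matrix.smul_apply, smul_eq_mul, smul_eq_mul]
    push_cast; rfl
  have hQ : red q ((q : ℤ) • N + M * Z) = red q (M * Z) := by
    rw [red_eq_iff]
    intro i j
    rw [Matrix.add_apply, Matrix.smul_apply, add_sub_cancel_right]
    exact dvd_mul_right _ _
  rw [Matrix.mul_assoc, hd, hd, hd]
  refine ⟨rfl, hsm, hQ, ?_⟩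
  rw [hsm]
  refine orbitRep_of_smul ?_ ?_
  · rw [red_det]
    refine isUnit_intCast_sq fun hdvd => hα ?_
    rw [← ZMod.intCast_zmod_eq_zero_iff_dvd, ← red_det, hQ] at hdvd
    have := congrArg det hZ
    rw [map_mul, det_mul, hdvd, zero_mul, det_diagonal, Fin.prod_univ_two] at this
    rw [← ZMod.intCast_zmod_eq_zero_iff_dvd]
    simpa using this.symm
  · have h1 : red q (M * ((q : ℤ) • N + M * Z)ᵀ) = red q (diagonal ![1, α]) := by
      rw [map_mul, red_transpose, hQ, ← red_transpose, ← map_mul, transpose_mul, D.symm,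
        ← Matrix.mul_assoc, hZ, red_diagonal, Int.cast_one]
    have h2 := red_eq_sq_of_smul h1
    rw [map_mul, red_transpose] at h2
    rw [h2, red_diagonal, ← diagonal_smul]
    congr 1; funext i; fin_cases i <;> simp

end Values

/-! ### The three coefficient formulas -/

section Formulas

theorem det_diagonal_one_q (q : ℕ) : (diagonal ![1, (q : ℤ)]).det = (q : ℤ) ^ 1 := by
  rw [det_diagonal, Fin.prod_univ_two]; simp

theorem det_diagonal_q_q (q : ℕ) : (diagonal ![(q : ℤ), (q : ℤ)]).det = (q : ℤ) ^ 2 := by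
  rw [det_diagonal, Fin.prod_univ_two, sq]; simp

theorem det_red_scaled {q : ℕ} {h M : Matrix (Fin 2) (Fin 2) ℤ} {j : ℕ} (hh : h.det = (q : ℤ) ^ j) :
    (red (q ^ 2) (h * M)).det = (q : ZMod (q ^ 2)) ^ j * (M.det : ZMod (q ^ 2)) := by
  rw [red_det, det_mul, hh]; push_cast; rfl

theorem natCast_sq_eq_zero (q : ℕ) : (q : ZMod (q ^ 2)) ^ 2 = 0 := by
  rw [← Nat.cast_pow, ZMod.natCast_self]

variable {n n' q : ℕ} [Fact q.Prime] {χ : DirichletCharacter ℂ n} {χ' : DirichletCharacter ℂ n'}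
variable {s : ℚ × ℚ × ℚ} {M N Z : Matrix (Fin 2) (Fin 2) ℤ}

theorem legendreSym_congr {a b : ℤ} (h : (a : ZMod q) = b) : legendreSym q a = legendreSym q b := by
  rw [legendreSym, legendreSym, h]

theorem legendreSym_eq_mul_of_eq {a m u : ℤ} (ha : ¬ (q : ℤ) ∣ a) (h : (m : ZMod q) = a * u) :
    legendreSym q u = legendreSym q a * legendreSym q m := by
  have h1 : legendreSym q m = legendreSym q a * legendreSym q u := by
    rw [← legendreSym.mul]
    exact legendreSym_congr (by push_cast; exact h)
  rw [h1, ← mul_assoc, ← sq, legendreSym.sq_one q (intCast_ne_zero_of_not_dvd ha), one_mul]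

theorem LocalDecomp.tri_eq_zero_iff (D : LocalDecomp q s M N Z) :
    tri (red q Z) = 0 ↔ red q Z = 0 := by
  constructor
  · intro h
    rw [← sym_tri (S := red q Z) (by rw [← red_transpose, D.symm]), h]
    ext i j; fin_cases i <;> fin_cases j <;> rfl
  · intro h; rw [h]; rfl

theorem LocalDecomp.rank_cases (hq : q ≠ 2) (D : LocalDecomp q s M N Z) : red q Z = 0 ∨
    (∃ r : ℤ, ¬ (q : ℤ) ∣ r ∧ IsRankOne (r : ZMod q) (tri (red q Z))) ∨
    disc (tri (red q Z)) ≠ 0 := by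
  by_cases hz : tri (red q Z) = 0
  · exact Or.inl (D.tri_eq_zero_iff.1 hz)
  by_cases hd : disc (tri (red q Z)) = 0
  · obtain ⟨t, ht⟩ := exists_form_ne_zero (by rwa [ZMod.ringChar_zmod_n]) hz
    obtain ⟨r, hr⟩ := ZMod.intCast_surjective ((tri (red q Z)).1 + 2 * (tri (red q Z)).2.1 * t +
      (tri (red q Z)).2.2 * t ^ 2)
    rw [← hr] at ht
    exact Or.inr (Or.inl ⟨r, fun h => ht ((ZMod.intCast_zmod_eq_zero_iff_dvd r q).2 h),
      (isRankOne_iff hr ht ht).2 ⟨hd, rfl⟩⟩)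
  · exact Or.inr (Or.inr hd)

theorem proj_self : proj q (q : ZMod (q ^ 2)) = 0 := by rw [proj_natCast, ZMod.natCast_self]

theorem isUnit_proj {u : ZMod (q ^ 2)} (hu : IsUnit u) : proj q u ≠ 0 :=
  (hu.map (proj q)).ne_zero

open Classical in
/-- The coefficients of the series of type `diag(1, 1)` modulo `q²`: they live on the slopes with `Z`
zero modulo `q`. -/
theorem CharSplit.wt_rankZero (S : CharSplit q χ χ') (hq : q ≠ 2) {x y : ℤ}
    (hx : IdempotentMod n x y) (hx' : IdempotentMod n' x y)
    (hM₀ : red (q ^ 2) (diagonal ![x, y]) = 1) (k : ℕ) (D : LocalDecomp q s M N Z) :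
    wt k χ (q * n) (diagonal ![x, y]) s = if tri (red q Z) = 0 then
      legendreSym q M.det * awayCoeff k χ' (diagonal ![x, y]) M N else 0 := by
  have key : ∀ {P Q : Matrix (Fin 2) (Fin 2) ℤ} {u},
      OrbitRep (red (q ^ 2) (diagonal ![x, y])) (red (q ^ 2) P) (red (q ^ 2) Q) u →
      (red (q ^ 2) P).det = u := fun h => by rw [h.det_eq, hM₀, det_one, one_mul]
  split_ifs with h
  · obtain ⟨V, hV, hrep⟩ := D.exists_of_eq_zero (D.tri_eq_zero_iff.1 h)
    rw [← hM₀] at hrep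
    rw [S.wt_eq_of_orbitRep hx hx' D (j := 0) (by rw [det_one, pow_zero]) hV
      (c := legendreSym q M.det) hrep]
    · simp
    · intro u hu
      have := congrArg (proj q) (key hu)
      rw [Matrix.one_mul, red_det, proj_intCast, proj_intCast] at this
      exact legendreSym_congr this.symm
  · rcases D.rank_cases hq with h0 | ⟨r, hr, h1⟩ | h2
    · exact absurd (D.tri_eq_zero_iff.2 h0) h
    · obtain ⟨E, hE⟩ := exists_normal_rankOne D.not_dvd D.symm h1
      obtain ⟨V, hV, hrep⟩ := (D.mul_left E).exists_of_rankOne hr hE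
      refine S.wt_eq_zero (D.mul_left E) (det_diagonal_one_q q) hV hrep.choose_spec.exists_inv ?_
      rintro ⟨u, hu⟩
      have := congrArg (proj q) (key hu)
      rw [det_red_scaled (det_diagonal_one_q q), map_mul, map_pow, proj_self, pow_one, zero_mul] at this
      exact isUnit_proj (q := q) hu.isUnit this.symm
    · obtain ⟨E, hE⟩ := exists_normal_rankTwo hq D.not_dvd D.symm h2
      obtain ⟨α, hα⟩ := ZMod.intCast_surjective ((M.det : ZMod q) ^ 2 * disc (tri (red q Z)))
      have hα0 : ¬ (q : ℤ) ∣ α := fun h' => by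
        rw [← ZMod.intCast_zmod_eq_zero_iff_dvd, hα] at h'
        exact mul_ne_zero (pow_ne_zero _ (intCast_ne_zero_of_not_dvd D.not_dvd)) h2 h'
      rw [← hα] at hE
      obtain ⟨hV, -, -, hrep⟩ := (D.mul_left E).exists_of_rankTwo hα0 hE
      refine S.wt_eq_zero (D.mul_left E) (det_diagonal_q_q q) hV hrep.choose_spec.exists_inv ?_
      rintro ⟨u, hu⟩
      have := congrArg (proj q) (key hu)
      rw [det_red_scaled (det_diagonal_q_q q), natCast_sq_eq_zero q, zero_mul, map_zero] at this
      exact isUnit_proj (q := q) hu.isUnit this.symm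

open Classical in
/-- The coefficients of the series of type `diag(1, qa)` modulo `q²`: they live on the slopes with `Z`
of rank one and class `a` modulo `q`. -/
theorem CharSplit.wt_rankOne (S : CharSplit q χ χ') (hq : q ≠ 2) {x y a : ℤ}
    (hx : IdempotentMod n x y) (hx' : IdempotentMod n' x y) (ha : ¬ (q : ℤ) ∣ a)
    (hM₀ : red (q ^ 2) (diagonal ![x, y]) = diagonal ![1, (q : ZMod (q ^ 2)) * a]) (k : ℕ)
    (D : LocalDecomp q s M N Z) :
    wt k χ (q * n) (diagonal ![x, y]) s = if IsRankOne (a : ZMod q) (tri (red q Z)) then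
      legendreSym q a * χ' (q : ZMod n') * ((q : ℂ) ^ k)⁻¹ *
        (legendreSym q M.det * awayCoeff k χ' (diagonal ![x, y]) M N) else 0 := by
  have hq0 : q ≠ 0 := (Fact.out : q.Prime).ne_zero
  have key : ∀ {P Q : Matrix (Fin 2) (Fin 2) ℤ} {u},
      OrbitRep (red (q ^ 2) (diagonal ![x, y])) (red (q ^ 2) P) (red (q ^ 2) Q) u →
      (red (q ^ 2) P).det = (q : ZMod (q ^ 2)) * ((a : ZMod (q ^ 2)) * u) := fun h => by
    rw [h.det_eq, hM₀, det_diagonal, Fin.prod_univ_two]; simp [mul_assoc]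
  have ha' := intCast_ne_zero_of_not_dvd ha
  split_ifs with h
  · obtain ⟨E, hE⟩ := exists_normal_rankOne D.not_dvd D.symm h
    obtain ⟨V, hV, hrep⟩ := (D.mul_left E).exists_of_rankOne ha hE
    rw [← hM₀] at hrep
    rw [S.wt_eq_of_orbitRep hx hx' (D.mul_left E) (det_diagonal_one_q q) hV
      (c := legendreSym q a * legendreSym q M.det) hrep, S.awayCoeff_mul_left hx']
    · push_cast; ring
    · intro u hu
      have := key hu
      rw [det_red_scaled (det_diagonal_one_q q), pow_one] at this
      have := proj_eq_of_mul_eq hq0 this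
      rw [map_mul, proj_intCast, proj_intCast, proj_intCast, det_mul, E.det_coe, one_mul] at this
      exact legendreSym_eq_mul_of_eq ha this
  · rcases D.rank_cases hq with h0 | ⟨r, hr, h1⟩ | h2
    · obtain ⟨V, hV, hrep⟩ := D.exists_of_eq_zero h0
      refine S.wt_eq_zero D (j := 0) (by rw [det_one, pow_zero]) hV hrep.choose_spec.exists_inv ?_
      rintro ⟨u, hu⟩
      have := congrArg (proj q) (key hu)
      rw [Matrix.one_mul, red_det, proj_intCast, map_mul, proj_self, zero_mul] at this
      exact intCast_ne_zero_of_not_dvd D.not_dvd this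
    · obtain ⟨E, hE⟩ := exists_normal_rankOne D.not_dvd D.symm h1
      obtain ⟨V, hV, hrep⟩ := (D.mul_left E).exists_of_rankOne hr hE
      refine S.wt_eq_zero (D.mul_left E) (det_diagonal_one_q q) hV hrep.choose_spec.exists_inv ?_
      rintro ⟨u, hu⟩
      obtain ⟨w, hw⟩ := hrep
      have hd : red (q ^ 2) (diagonal ![1, (q : ℤ)]) = diagonal ![1, (q : ZMod (q ^ 2))] := by
        rw [red_diagonal]; simp
      rw [map_mul (red (q ^ 2)) (diagonal ![1, (q : ℤ)]), hd] at hu hw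
      rw [hM₀] at hu
      -- the same entry is `q a e²` and `q r f²`, with `e` and `f` prime to `q`
      obtain ⟨e, e', t, he, hee⟩ := hu.rankOne_value (natCast_mul_self q)
      obtain ⟨f, f', t', hf, hff⟩ := hw.rankOne_value (natCast_mul_self q)
      have h3 := proj_eq_of_mul_eq hq0 (hf.symm.trans he)
      rw [map_mul, map_mul, map_pow, map_pow, proj_intCast, proj_intCast] at h3
      have hff' : proj q f * proj q f' = 1 := by
        rw [← map_mul, hff, map_add, map_mul, proj_self, zero_mul, add_zero, map_one]
      have hee' : proj q e * proj q e' = 1 := by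
        rw [← map_mul, hee, map_add, map_mul, proj_self, zero_mul, add_zero, map_one]
      have h4 : (r : ZMod q) = a * (proj q e * proj q f') ^ 2 := by
        linear_combination (proj q f') ^ 2 * h3 -
          r * (proj q f * proj q f' + 1) * hff'
      obtain ⟨v, hv, hz⟩ := h1
      have hc : proj q e * proj q f' ≠ 0 := fun h5 => by
        have : (1 : ZMod q) = 0 := by
          calc (1 : ZMod q) = (proj q e * proj q e') * (proj q f * proj q f') := by
                rw [hee', hff', one_mul]
            _ = (proj q e * proj q f') * (proj q e' * proj q f) := by ring
            _ = 0 := by rw [h5, zero_mul]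
        exact one_ne_zero this
      refine h ⟨(proj q e * proj q f' * v.1, proj q e * proj q f' * v.2), ?_, ?_⟩
      · rw [prod_ne_zero_iff] at hv ⊢
        exact hv.imp (mul_ne_zero hc) (mul_ne_zero hc)
      · rw [hz, h4]
        simp only [rankOne]
        refine Prod.ext ?_ (Prod.ext ?_ ?_) <;> simp only <;> ring
    · obtain ⟨E, hE⟩ := exists_normal_rankTwo hq D.not_dvd D.symm h2
      obtain ⟨α, hα⟩ := ZMod.intCast_surjective ((M.det : ZMod q) ^ 2 * disc (tri (red q Z)))
      have hα0 : ¬ (q : ℤ) ∣ α := fun h' => by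
        rw [← ZMod.intCast_zmod_eq_zero_iff_dvd, hα] at h'
        exact mul_ne_zero (pow_ne_zero _ (intCast_ne_zero_of_not_dvd D.not_dvd)) h2 h'
      rw [← hα] at hE
      obtain ⟨hV, -, -, hrep⟩ := (D.mul_left E).exists_of_rankTwo hα0 hE
      refine S.wt_eq_zero (D.mul_left E) (det_diagonal_q_q q) hV hrep.choose_spec.exists_inv ?_
      rintro ⟨u, hu⟩
      have := key hu
      rw [det_red_scaled (det_diagonal_q_q q), natCast_sq_eq_zero q, zero_mul,
        ← mul_zero (q : ZMod (q ^ 2))] at this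
      have := proj_eq_of_mul_eq hq0 this
      rw [map_zero, map_mul, proj_intCast] at this
      exact mul_ne_zero ha' (isUnit_proj hu.isUnit) this.symm

open Classical in
/-- The coefficients of the series of type `diag(q, qα)` modulo `q²`: they live on the slopes with `Z`
invertible modulo `q`, of discriminant `α / det(M)²`. -/
theorem CharSplit.wt_rankTwo (S : CharSplit q χ χ') (hq : q ≠ 2) {x y α : ℤ}
    (hx : IdempotentMod n x y) (hx' : IdempotentMod n' x y) (hα : ¬ (q : ℤ) ∣ α)
    (hM₀ : red (q ^ 2) (diagonal ![x, y]) =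
      diagonal ![(q : ZMod (q ^ 2)), (q : ZMod (q ^ 2)) * α]) (k : ℕ)
    (D : LocalDecomp q s M N Z) :
    wt k χ (q * n) (diagonal ![x, y]) s =
      if (α : ZMod q) = (M.det : ZMod q) ^ 2 * disc (tri (red q Z)) then
        legendreSym q α * (((q : ℂ) ^ k) ^ 2)⁻¹ *
          (legendreSym q M.det * awayCoeff k χ' (diagonal ![x, y]) M N) else 0 := by
  have hq0 : q ≠ 0 := (Fact.out : q.Prime).ne_zero
  have hm := intCast_ne_zero_of_not_dvd D.not_dvd
  have key : ∀ {P Q : Matrix (Fin 2) (Fin 2) ℤ} {u},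
      OrbitRep (red (q ^ 2) (diagonal ![x, y])) (red (q ^ 2) P) (red (q ^ 2) Q) u →
      (red (q ^ 2) P).det = 0 := fun {P Q u} h => by
    rw [h.det_eq, hM₀, det_diagonal, Fin.prod_univ_two]
    change (q : ZMod (q ^ 2)) * ((q : ZMod (q ^ 2)) * α) * u = 0
    linear_combination (α * u : ZMod (q ^ 2)) * natCast_mul_self q
  have hα' := intCast_ne_zero_of_not_dvd hα
  rcases D.rank_cases hq with h0 | ⟨r, hr, h1⟩ | h2
  · rw [if_neg]
    · obtain ⟨V, hV, hrep⟩ := D.exists_of_eq_zero h0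
      refine S.wt_eq_zero D (j := 0) (by rw [det_one, pow_zero]) hV hrep.choose_spec.exists_inv ?_
      rintro ⟨u, hu⟩
      have := congrArg (proj q) (key hu)
      rw [Matrix.one_mul, red_det, proj_intCast, map_zero] at this
      exact hm this
    · rw [D.tri_eq_zero_iff.2 h0]
      simpa [disc] using hα'
  · rw [if_neg]
    · obtain ⟨E, hE⟩ := exists_normal_rankOne D.not_dvd D.symm h1
      obtain ⟨V, hV, hrep⟩ := (D.mul_left E).exists_of_rankOne hr hE
      refine S.wt_eq_zero (D.mul_left E) (det_diagonal_one_q q) hV hrep.choose_spec.exists_inv ?_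
      rintro ⟨u, hu⟩
      have := key hu
      rw [det_red_scaled (det_diagonal_one_q q), pow_one, ← mul_zero (q : ZMod (q ^ 2))] at this
      have := proj_eq_of_mul_eq hq0 this
      rw [map_zero, proj_intCast, det_mul, E.det_coe, one_mul] at this
      exact hm this
    · obtain ⟨v, -, hz⟩ := h1
      rw [hz]
      have : disc (rankOne (r : ZMod q) v) = 0 := by simp only [disc, rankOne]; ring
      rwa [this, mul_zero]
  · obtain ⟨E, hE⟩ := exists_normal_rankTwo hq D.not_dvd D.symm h2
    set β := (M.det : ZMod q) ^ 2 * disc (tri (red q Z)) with hβ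
    obtain ⟨β', hβ'⟩ := ZMod.intCast_surjective β
    have hβ0 : ¬ (q : ℤ) ∣ β' := fun h' => by
      rw [← ZMod.intCast_zmod_eq_zero_iff_dvd, hβ'] at h'
      exact mul_ne_zero (pow_ne_zero _ hm) h2 h'
    split_ifs with h
    · rw [← h] at hE
      obtain ⟨hV, hP, -, hrep⟩ := (D.mul_left E).exists_of_rankTwo hα hE
      rw [← hM₀] at hrep
      have hχ2 : χ' (q : ZMod n') ^ 2 = 1 :=
        char_sq_eq_one S.sq' ((ZMod.isUnit_iff_coprime q n').2 S.coprime)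
      rw [S.wt_eq_of_orbitRep hx hx' (D.mul_left E) (det_diagonal_q_q q) hV
        (c := legendreSym q α * legendreSym q M.det) hrep, S.awayCoeff_mul_left hx', hχ2,
        ← pow_mul, mul_comm 2 k, pow_mul]
      · push_cast; ring
      · intro u hu
        rw [hM₀, hP] at hu
        obtain ⟨F, A, hF, huA, -, hMA⟩ := hu.smul_value (natCast_mul_self q)
        have h3 := congrArg det (proj_map_eq_of_smul_eq hq0 hMA)
        rw [proj_map_red, ← (proj q).map_det, red_det, det_mul, E.det_coe, one_mul, det_mul, det_mul,
          hF, ← huA, det_diagonal, Fin.prod_univ_two] at h3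
        refine legendreSym_eq_mul_of_eq hα (h3.trans ?_)
        simp
    · rw [← hβ'] at hE
      obtain ⟨hV, hP, hQ, hrep⟩ := (D.mul_left E).exists_of_rankTwo hβ0 hE
      refine S.wt_eq_zero (D.mul_left E) (det_diagonal_q_q q) hV hrep.choose_spec.exists_inv ?_
      rintro ⟨u, hu⟩
      rw [hM₀, hP] at hu
      obtain ⟨F, A, hF, huA, hQM, -⟩ := hu.smul_value (natCast_mul_self q)
      have h3 := congrArg det (proj_map_eq_of_smul_eq hq0 hQM)
      rw [map_mul, det_mul, ← red_transpose, proj_map_red, proj_map_red, hQ,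
        ← (proj q).map_det, det_mul, det_mul, hF, det_transpose, hF, det_diagonal,
        Fin.prod_univ_two] at h3
      apply h
      have h4 : (proj q) (1 * (![1, (α : ZMod (q ^ 2))] 0 * ![1, (α : ZMod (q ^ 2))] 1) * 1) =
          (α : ZMod q) := by simp
      rw [h4, map_mul, det_mul, det_eq_disc (S := red q Z) (by rw [← red_transpose, D.symm]),
        red_transpose, det_transpose, red_det, det_mul, E.det_coe, one_mul] at h3
      rw [← h3, hβ]; ring

end Formulas

/-! ### Determinants in the orbits, and slopes with more denominators at `q` -/

section Orbits

variable {q : ℕ} [Fact q.Prime] {P Q : Matrix (Fin 2) (Fin 2) ℤ} {u : ZMod (q ^ 2)}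

theorem OrbitRep.not_dvd_det {Q : Matrix (Fin 2) (Fin 2) (ZMod (q ^ 2))}
    (h : OrbitRep 1 (red (q ^ 2) P) Q u) : ¬ (q : ℤ) ∣ P.det := by
  intro hd
  have h1 := congrArg (proj q) h.det_eq
  rw [det_one, one_mul, red_det, proj_intCast, (ZMod.intCast_zmod_eq_zero_iff_dvd _ q).2 hd] at h1
  exact isUnit_proj (q := q) h.isUnit h1.symm

theorem OrbitRep.exists_det_eq {Q : Matrix (Fin 2) (Fin 2) (ZMod (q ^ 2))} {a : ℤ}
    (ha : ¬ (q : ℤ) ∣ a)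
    (h : OrbitRep (diagonal ![1, (q : ZMod (q ^ 2)) * a]) (red (q ^ 2) P) Q u) :
    ∃ m, P.det = q * m ∧ ¬ (q : ℤ) ∣ m := by
  have h1 : (P.det : ZMod (q ^ 2)) = (q : ZMod (q ^ 2)) * ((a : ZMod (q ^ 2)) * u) := by
    rw [← red_det, h.det_eq, det_diagonal, Fin.prod_univ_two]; simp [mul_assoc]
  have h2 := congrArg (proj q) h1
  rw [proj_intCast, map_mul, proj_self, zero_mul, ZMod.intCast_zmod_eq_zero_iff_dvd] at h2
  obtain ⟨m, hm⟩ := h2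
  refine ⟨m, hm, fun hd => ?_⟩
  rw [hm] at h1
  push_cast at h1
  have h3 := proj_eq_of_mul_eq (Fact.out : q.Prime).ne_zero h1
  rw [proj_intCast, (ZMod.intCast_zmod_eq_zero_iff_dvd _ q).2 hd, map_mul, proj_intCast] at h3
  exact mul_ne_zero (intCast_ne_zero_of_not_dvd ha) (isUnit_proj (q := q) h.isUnit) h3.symm

theorem OrbitRep.exists_eq_smul {Q : Matrix (Fin 2) (Fin 2) (ZMod (q ^ 2))} {α : ℤ}
    (hα : ¬ (q : ℤ) ∣ α) (h : OrbitRep (diagonal ![(q : ZMod (q ^ 2)), (q : ZMod (q ^ 2)) * α])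
      (red (q ^ 2) P) Q u) :
    ∃ P' : Matrix (Fin 2) (Fin 2) ℤ, P = (q : ℤ) • P' ∧ ¬ (q : ℤ) ∣ P'.det := by
  have hu := h.isUnit
  obtain ⟨E, A, B, D, hE, -, -, hP, -, rfl⟩ := h
  have hd : diagonal ![(q : ZMod (q ^ 2)), (q : ZMod (q ^ 2)) * α] =
      (q : ZMod (q ^ 2)) • diagonal ![1, (α : ZMod (q ^ 2))] := by
    rw [← diagonal_smul]; congr 1; funext i; fin_cases i <;> simp
  rw [hd, Matrix.smul_mul, Matrix.mul_smul] at hP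
  have hP0 : red q P = 0 := by
    rw [← proj_map_red, hP]
    ext i j
    change proj q ((q : ZMod (q ^ 2)) * _) = 0
    rw [map_mul, proj_self, zero_mul]
  choose f hf using red_eq_zero_iff.1 hP0
  have hPf : P = (q : ℤ) • of f := by
    ext i j
    rw [Matrix.smul_apply, smul_eq_mul, of_apply, hf]
  refine ⟨of f, hPf, fun hdvd => ?_⟩
  have h1 : (q : ZMod (q ^ 2)) • red (q ^ 2) (of f) =
      (q : ZMod (q ^ 2)) • (E * (diagonal ![1, (α : ZMod (q ^ 2))] * A)) := by
    rw [← hP, hPf]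
    ext i j
    rw [Matrix.smul_apply, red_apply, red_apply, Matrix.smul_apply, smul_eq_mul, smul_eq_mul]
    push_cast; rfl
  have h2 := congrArg det (proj_map_eq_of_smul_eq (Fact.out : q.Prime).ne_zero h1)
  rw [proj_map_red, red_det, (ZMod.intCast_zmod_eq_zero_iff_dvd _ q).2 hdvd, ← (proj q).map_det,
    det_mul, det_mul, hE, one_mul, map_mul, det_diagonal, Fin.prod_univ_two] at h2
  refine mul_ne_zero ?_ (isUnit_proj (q := q) hu) h2.symm
  simpa using intCast_ne_zero_of_not_dvd hα

end Orbits

section Vanishing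

variable {n n' q : ℕ} [Fact q.Prime] {χ : DirichletCharacter ℂ n} {χ' : DirichletCharacter ℂ n'}

/-- The three residues modulo `q²` of the matrices that define the series. -/
inductive TypeAt (q : ℕ) (M₀ : Matrix (Fin 2) (Fin 2) ℤ) : Prop
  | rankZero : red (q ^ 2) M₀ = 1 → TypeAt q M₀
  | rankOne (a : ℤ) : ¬ (q : ℤ) ∣ a →
      red (q ^ 2) M₀ = diagonal ![1, (q : ZMod (q ^ 2)) * a] → TypeAt q M₀
  | rankTwo (α : ℤ) : ¬ (q : ℤ) ∣ α →
      red (q ^ 2) M₀ = diagonal ![(q : ZMod (q ^ 2)), (q : ZMod (q ^ 2)) * α] → TypeAt q M₀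

/-- The adjugate solves for the slope. -/
theorem toRat_adjugate_mul {M N : Matrix (Fin 2) (Fin 2) ℤ} {S : Matrix (Fin 2) (Fin 2) ℚ}
    (h : toRat N = toRat M * S) : toRat (M.adjugate * N) = (M.det : ℚ) • S := by
  have h1 : toRat M.adjugate * toRat M = (M.det : ℚ) • 1 := by
    rw [← map_mul, adjugate_mul, toRat_smul, map_one]
  rw [map_mul, h, ← Matrix.mul_assoc, h1, Matrix.smul_mul, Matrix.one_mul]

/-- The slopes in the support of the series have at most one factor `q` in their denominators. -/
theorem CharSplit.exists_localDecomp_of_wt_ne_zero (S : CharSplit q χ χ') {k : ℕ}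
    {M₀ : Matrix (Fin 2) (Fin 2) ℤ} (hM₀ : TypeAt q M₀) {s : ℚ × ℚ × ℚ}
    (h : wt k χ (q * n) M₀ s ≠ 0) : ∃ M N Z, LocalDecomp q s M N Z := by
  obtain ⟨-, -, hs⟩ := den_spec s
  have hu : ∃ u, OrbitRep (red (q ^ 2) M₀) (red (q ^ 2) (denM s)) (red (q ^ 2) (denN s)) u := by
    by_contra hno
    exact h (by rw [wt, S.orbitCoeff_eq_zero hno, zero_mul])
  obtain ⟨u, hu⟩ := hu
  rcases hM₀ with h0 | ⟨a, ha, h1⟩ | ⟨α, hα, h2⟩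
  · rw [h0] at hu
    refine exists_localDecomp hu.not_dvd_det (X := (q : ℤ) • ((denM s).adjugate * denN s)) ?_
    rw [toRat_smul, toRat_adjugate_mul hs, smul_smul, ← Int.cast_mul, mul_comm]
  · rw [h1] at hu
    obtain ⟨m, hm, hmq⟩ := hu.exists_det_eq ha
    refine exists_localDecomp hmq (X := (denM s).adjugate * denN s) ?_
    rw [toRat_adjugate_mul hs, hm, mul_comm]
  · rw [h2] at hu
    obtain ⟨P', hP', hd⟩ := hu.exists_eq_smul hα
    refine exists_localDecomp hd (X := P'.adjugate * denN s) ?_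
    have hs' : toRat (denN s) = toRat P' * (((q : ℤ) : ℚ) • sym s) := by
      rw [hs, hP', toRat_smul, Matrix.smul_mul, Matrix.mul_smul]
    rw [toRat_adjugate_mul hs', smul_smul, Int.cast_mul]

/-- The orbits contain only pairs of full rank, so that every summand belongs to a slope. -/
theorem CharSplit.det_pairM_ne_zero (S : CharSplit q χ χ') {M₀ : Matrix (Fin 2) (Fin 2) ℤ}
    (hM₀ : TypeAt q M₀) (γ : Gamma0 (q * n)) : (pairM M₀ γ).det ≠ 0 := by
  have hq0 : (q : ℤ) ≠ 0 := by exact_mod_cast (Fact.out : q.Prime).ne_zero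
  have hγ : InOrbit M₀ (pairM M₀ γ) (pairN M₀ γ) γ := ⟨1, by simp, by simp⟩
  have hu := hγ.orbitRep (n := q ^ 2) (by rw [S.level]; exact dvd_mul_right _ _)
  rcases hM₀ with h0 | ⟨a, ha, h1⟩ | ⟨α, hα, h2⟩
  · rw [h0] at hu
    exact fun h => hu.not_dvd_det (h ▸ dvd_zero _)
  · rw [h1] at hu
    obtain ⟨m, hm, hmq⟩ := hu.exists_det_eq ha
    rw [hm]
    exact mul_ne_zero hq0 fun h => hmq (h ▸ dvd_zero _)
  · rw [h2] at hu
    obtain ⟨P', hP', hd⟩ := hu.exists_eq_smul hα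
    rw [hP', det_smul]
    exact mul_ne_zero (pow_ne_zero _ hq0) fun h => hd (h ▸ dvd_zero _)

end Vanishing

/-! ### The identity of coefficients -/

section Coefficients

theorem IdempotentMod.mul {n m : ℕ} (h : n.Coprime m) {x y : ℤ} (hn : IdempotentMod n x y)
    (hm : IdempotentMod m x y) : IdempotentMod (n * m) x y := by
  have key : ∀ z w : ℤ, (z : ZMod n) = w → (z : ZMod m) = w → (z : ZMod (n * m)) = w := by
    intro z w h1 h2
    rw [ZMod.intCast_eq_intCast_iff_dvd_sub] at h1 h2 ⊢
    push_cast
    exact (Nat.isCoprime_iff_coprime.2 h).mul_dvd h1 h2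
  have e1 := key (x * x) x (by push_cast; exact hn.1) (by push_cast; exact hm.1)
  have e2 := key (y * y) y (by push_cast; exact hn.2) (by push_cast; exact hm.2)
  have e3 := key (x * y) y (by push_cast; exact hn.3) (by push_cast; exact hm.3)
  push_cast at e1 e2 e3
  exact ⟨e1, e2, e3⟩

/-- Diagonal matrices `diag(x(a, d), y(a, d))`, congruent to `diag(a, d)` modulo `q²` and to one
fixed diagonal idempotent modulo `n'`. -/
structure TypeFamily (q n' : ℕ) (x y : ℤ → ℤ → ℤ) : Prop where
  x_mod : ∀ a d, (x a d : ZMod (q ^ 2)) = a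
  y_mod : ∀ a d, (y a d : ZMod (q ^ 2)) = d
  idem : ∀ a d, IdempotentMod n' (x a d) (y a d)
  away : ∀ a d a' d', red n' (diagonal ![x a d, y a d]) = red n' (diagonal ![x a' d', y a' d'])

theorem TypeFamily.red_sq {q n' : ℕ} {x y : ℤ → ℤ → ℤ}
    (T : TypeFamily q n' x y) (a d : ℤ) :
    red (q ^ 2) (diagonal ![x a d, y a d]) = diagonal ![(a : ZMod (q ^ 2)), (d : ZMod (q ^ 2))] := by
  rw [red_diagonal, T.x_mod, T.y_mod]

theorem TypeFamily.awayCoeff_eq {q n' : ℕ} {x y : ℤ → ℤ → ℤ} {χ' : DirichletCharacter ℂ n'}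
    (T : TypeFamily q n' x y) (k : ℕ) (a d a' d' : ℤ)
    (M N : Matrix (Fin 2) (Fin 2) ℤ) :
    awayCoeff k χ' (diagonal ![x a d, y a d]) M N =
      awayCoeff k χ' (diagonal ![x a' d', y a' d']) M N := by
  rw [awayCoeff, awayCoeff, T.away a d a' d']

theorem TypeFamily.red_one_one {q n' : ℕ} {x y : ℤ → ℤ → ℤ} (T : TypeFamily q n' x y) :
    red (q ^ 2) (diagonal ![x 1 1, y 1 1]) = 1 := by
  rw [T.red_sq, ← diagonal_one]
  congr 1; funext i; fin_cases i <;> simp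

theorem TypeFamily.red_one_q {q n' : ℕ} {x y : ℤ → ℤ → ℤ} (T : TypeFamily q n' x y) (a : ℤ) :
    red (q ^ 2) (diagonal ![x 1 (q * a), y 1 (q * a)]) = diagonal ![1, (q : ZMod (q ^ 2)) * a] := by
  rw [T.red_sq]; push_cast; rfl

theorem TypeFamily.red_q_q {q n' : ℕ} {x y : ℤ → ℤ → ℤ} (T : TypeFamily q n' x y) (α : ℤ) :
    red (q ^ 2) (diagonal ![x q (q * α), y q (q * α)]) =
      diagonal ![(q : ZMod (q ^ 2)), (q : ZMod (q ^ 2)) * α] := by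
  rw [T.red_sq]; push_cast; rfl

variable {n n' q : ℕ} [Fact q.Prime] {χ : DirichletCharacter ℂ n} {χ' : DirichletCharacter ℂ n'}
variable {x y : ℤ → ℤ → ℤ}

theorem TypeFamily.idem_of (T : TypeFamily q n' x y) (S : CharSplit q χ χ') {a d : ℤ}
    (h : IdempotentMod q a d) : IdempotentMod n (x a d) (y a d) := by
  have hx : ((x a d : ℤ) : ZMod q) = a := by
    have := congrArg (proj q) (T.x_mod a d)
    rwa [proj_intCast, proj_intCast] at this
  have hy : ((y a d : ℤ) : ZMod q) = d := by
    have := congrArg (proj q) (T.y_mod a d)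
    rwa [proj_intCast, proj_intCast] at this
  rw [S.eq_mul]
  exact IdempotentMod.mul S.coprime ⟨by rw [hx, h.1], by rw [hy, h.2], by rw [hx, hy, h.3]⟩
    (T.idem a d)

theorem idempotentMod_one_one : IdempotentMod q 1 1 := ⟨by simp, by simp, by simp⟩

theorem idempotentMod_one_q (a : ℤ) : IdempotentMod q 1 (q * a) := ⟨by simp, by simp, by simp⟩

theorem idempotentMod_q_q (a : ℤ) : IdempotentMod q q (q * a) := ⟨by simp, by simp, by simp⟩

theorem not_dvd_of_legendreSym {a e : ℤ} (he : e ≠ 0) (h : legendreSym q a = e) : ¬ (q : ℤ) ∣ a := by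
  rw [← ZMod.intCast_zmod_eq_zero_iff_dvd]
  intro h'
  exact he (h ▸ (legendreSym.eq_zero_iff q a).2 h')

theorem sum_filter_legendreSym {e : ℤ} (β : ZMod q) (t : ℂ) :
    ∑ α ∈ (Finset.range q).filter (fun α : ℕ => legendreSym q (α : ℤ) = e),
      (if (((α : ℤ) : ZMod q)) = β then (legendreSym q (α : ℤ) : ℂ) * t else 0) =
    if quadraticChar (ZMod q) β = e then (e : ℂ) * t else 0 := by
  have hβ : (((β.val : ℤ)) : ZMod q) = β := by simp
  have hlt : β.val < q := ZMod.val_lt β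
  have huniq : ∀ α ∈ Finset.range q, (((α : ℤ) : ZMod q)) = β → α = β.val := by
    intro α hα h
    rw [← h, Int.cast_natCast, ZMod.val_natCast_of_lt (Finset.mem_range.1 hα)]
  have hval : legendreSym q (β.val : ℤ) = quadraticChar (ZMod q) β := by rw [legendreSym, hβ]
  split_ifs with h
  · rw [Finset.sum_eq_single β.val]
    · rw [if_pos hβ, hval, h]
    · intro α hα hne
      exact if_neg fun h' => hne (huniq α (Finset.mem_filter.1 hα).1 h')
    · intro hno
      exact absurd (Finset.mem_filter.2 ⟨Finset.mem_range.2 hlt, hval.trans h⟩) hno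
  · refine Finset.sum_eq_zero fun α hα => if_neg fun h' => h ?_
    rw [← hval, ← huniq α (Finset.mem_filter.1 hα).1 h']
    exact (Finset.mem_filter.1 hα).2

theorem tri_sub {R : Type*} [Sub R] (A B : Matrix (Fin 2) (Fin 2) R) :
    tri (A - B) = tri A - tri B := rfl

theorem divq_neg (q : ℕ) (W : Matrix (Fin 2) (Fin 2) ℤ) : divq q (-W) = -divq q W := by
  rw [divq, map_neg, smul_neg]; rfl

open Classical in
/-- The number of pairs `G`, `Y`, weighted by the twisting character, for which `z - G Y ᵗG` is of rank
one and class `a`. -/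
theorem two_mul_sum_reps (hq : q ≠ 2) {𝒢 : Finset SL(2, ℤ)} (h𝒢 : IsCosetReps q 𝒢)
    {𝒴 : Finset (Matrix (Fin 2) (Fin 2) ℤ)} (h𝒴 : IsSymmReps q 𝒴) {a b : ℤ}
    (ha : ¬ (q : ℤ) ∣ a) (hb : ¬ (q : ℤ) ∣ b)
    (hab : legendreSym q b = legendreSym q (-1) * legendreSym q a)
    (z : ZMod q × ZMod q × ZMod q) :
    2 * legendreSym q a * ∑ G ∈ 𝒢, ∑ Y ∈ 𝒴, legendreSym q (Y 0 0) *
      (if IsRankOne (a : ZMod q) (z - tri (red q ((G : Matrix (Fin 2) (Fin 2) ℤ) * Y *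
        (G : Matrix (Fin 2) (Fin 2) ℤ)ᵀ))) then 1 else 0) =
    -2 * legendreSym q (-1) * q * (if IsRankOne (b : ZMod q) z then 1 else 0) +
      legendreSym q (-1) * q * ((q : ℤ) ^ 2 - 1) * (if z = 0 then 1 else 0) +
      (q : ℤ) ^ 2 * quadraticChar (ZMod q) (disc z) -
      legendreSym q (-1) * q * quadraticChar (ZMod q) (disc z) ^ 2 := by
  have h1 := sum_reps h𝒢 h𝒴 z (a : ZMod q)
  have hm1 : quadraticChar (ZMod q) (-1) = legendreSym q (-1) := by
    rw [legendreSym, Int.cast_neg, Int.cast_one]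
  have h2 := sum_twist (by rwa [ZMod.ringChar_zmod_n]) (intCast_ne_zero_of_not_dvd ha)
    (intCast_ne_zero_of_not_dvd hb) (by rw [hm1]; exact hab) z
  rw [← h1, ZMod.card, hm1] at h2
  have hq1 : (q : ℤ) - 1 ≠ 0 := by
    have := (Fact.out : q.Prime).one_lt
    omega
  refine mul_left_cancel₀ hq1 (Eq.trans ?_ h2)
  change _ = 2 * legendreSym q a * _
  ring

/-- The coefficients of the two sides of the twisting identity agree. Shifting a slope by `G Y ᵗG / q`
shifts `Z` by `G Y ᵗG`, so that on slopes with a decomposition all coefficients are a common factor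
times a function of `Z` modulo `q`, and the identity becomes `two_mul_sum_reps`; on all other slopes
both sides vanish. -/
theorem CharSplit.twist_coeff (S : CharSplit q χ χ') (hq : q ≠ 2) (T : TypeFamily q n' x y) (k : ℕ)
    {𝒢 : Finset SL(2, ℤ)} (h𝒢 : IsCosetReps q 𝒢)
    {𝒴 : Finset (Matrix (Fin 2) (Fin 2) ℤ)} (h𝒴 : IsSymmReps q 𝒴) {a b : ℤ}
    (ha : ¬ (q : ℤ) ∣ a) (hb : ¬ (q : ℤ) ∣ b)
    (hab : legendreSym q b = legendreSym q (-1) * legendreSym q a) (s : ℚ × ℚ × ℚ) :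
    ∑ G ∈ 𝒢, ∑ Y ∈ 𝒴, (legendreSym q (Y 0 0) : ℂ) *
      wt k χ (q * n) (diagonal ![x 1 (q * a), y 1 (q * a)])
        (s - divq q ((G : Matrix (Fin 2) (Fin 2) ℤ) * Y * (G : Matrix (Fin 2) (Fin 2) ℤ)ᵀ)) =
    -((legendreSym q a : ℂ) * q) * wt k χ (q * n) (diagonal ![x 1 (q * b), y 1 (q * b)]) s +
      (legendreSym q (-1) : ℂ) * χ' (q : ZMod n') * (q : ℂ) ^ (1 - (k : ℤ)) * ((q : ℂ) ^ 2 - 1) / 2 *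
        wt k χ (q * n) (diagonal ![x 1 1, y 1 1]) s +
      χ' (q : ZMod n') * (q : ℂ) ^ (k + 2) / 2 *
        (∑ α ∈ (Finset.range q).filter (fun α : ℕ => legendreSym q (α : ℤ) = 1),
            wt k χ (q * n) (diagonal ![x q (q * α), y q (q * α)]) s +
          ∑ α ∈ (Finset.range q).filter (fun α : ℕ => legendreSym q (α : ℤ) = -1),
            wt k χ (q * n) (diagonal ![x q (q * α), y q (q * α)]) s) -
      (legendreSym q (-1) : ℂ) * χ' (q : ZMod n') * (q : ℂ) ^ (k + 1) / 2 *
        (∑ α ∈ (Finset.range q).filter (fun α : ℕ => legendreSym q (α : ℤ) = 1),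
            wt k χ (q * n) (diagonal ![x q (q * α), y q (q * α)]) s -
          ∑ α ∈ (Finset.range q).filter (fun α : ℕ => legendreSym q (α : ℤ) = -1),
            wt k χ (q * n) (diagonal ![x q (q * α), y q (q * α)]) s) := by
  classical
  have hq0 : q ≠ 0 := (Fact.out : q.Prime).ne_zero
  have hqC : (q : ℂ) ≠ 0 := by exact_mod_cast hq0
  by_cases hloc : ∃ M N Z, LocalDecomp q s M N Z
  · obtain ⟨M, N, Z, D⟩ := hloc
    -- the factor common to all coefficients at `s`
    set c : ℂ := legendreSym q M.det * awayCoeff k χ' (diagonal ![x 1 1, y 1 1]) M N with hc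
    set z := tri (red q Z) with hz
    have hL : ∀ G ∈ 𝒢, ∀ Y ∈ 𝒴, wt k χ (q * n) (diagonal ![x 1 (q * a), y 1 (q * a)])
        (s - divq q ((G : Matrix (Fin 2) (Fin 2) ℤ) * Y * (G : Matrix (Fin 2) (Fin 2) ℤ)ᵀ)) =
        legendreSym q a * χ' (q : ZMod n') * ((q : ℂ) ^ k)⁻¹ * c *
          ((if IsRankOne (a : ZMod q) (z - tri (red q ((G : Matrix (Fin 2) (Fin 2) ℤ) * Y *
            (G : Matrix (Fin 2) (Fin 2) ℤ)ᵀ))) then 1 else 0 : ℤ) : ℂ) := by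
      intro G _ Y hY
      rw [S.wt_rankOne hq (T.idem_of S (idempotentMod_one_q a)) (T.idem _ _) ha (T.red_one_q a) k
        (D.sub hq0 (conj_symm _ (h𝒴.1 Y hY))), T.awayCoeff_eq k 1 (q * a) 1 1, map_sub, tri_sub]
      split_ifs <;> simp [hc]
    have hLs : ∑ G ∈ 𝒢, ∑ Y ∈ 𝒴, (legendreSym q (Y 0 0) : ℂ) *
        wt k χ (q * n) (diagonal ![x 1 (q * a), y 1 (q * a)])
        (s - divq q ((G : Matrix (Fin 2) (Fin 2) ℤ) * Y * (G : Matrix (Fin 2) (Fin 2) ℤ)ᵀ)) =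
        χ' (q : ZMod n') * ((q : ℂ) ^ k)⁻¹ * c * ((legendreSym q a * ∑ G ∈ 𝒢, ∑ Y ∈ 𝒴,
          legendreSym q (Y 0 0) *
          (if IsRankOne (a : ZMod q) (z - tri (red q ((G : Matrix (Fin 2) (Fin 2) ℤ) * Y *
            (G : Matrix (Fin 2) (Fin 2) ℤ)ᵀ))) then 1 else 0) : ℤ) : ℂ) := by
      rw [Int.cast_mul, Int.cast_sum, Finset.mul_sum, Finset.mul_sum]
      refine Finset.sum_congr rfl fun G hG => ?_
      rw [Int.cast_sum, Finset.mul_sum, Finset.mul_sum]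
      refine Finset.sum_congr rfl fun Y hY => ?_
      rw [hL G hG Y hY, Int.cast_mul]
      ring
    have hR : ∀ e : ℤ, e ≠ 0 → ∑ α ∈ (Finset.range q).filter (fun α : ℕ => legendreSym q (α : ℤ) = e),
        wt k χ (q * n) (diagonal ![x q (q * α), y q (q * α)]) s =
        if quadraticChar (ZMod q) ((M.det : ZMod q) ^ 2 * disc z) = e then
          (e : ℂ) * ((((q : ℂ) ^ k) ^ 2)⁻¹ * c) else 0 := by
      intro e he
      rw [← sum_filter_legendreSym]
      refine Finset.sum_congr rfl fun α hα => ?_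
      rw [S.wt_rankTwo hq (T.idem_of S (idempotentMod_q_q _)) (T.idem _ _)
        (not_dvd_of_legendreSym he (Finset.mem_filter.1 hα).2) (T.red_q_q _) k D,
        T.awayCoeff_eq k q (q * α) 1 1]
      split_ifs <;> [(rw [hc]; ring); rfl]
    have hβ : quadraticChar (ZMod q) ((M.det : ZMod q) ^ 2 * disc z) =
        quadraticChar (ZMod q) (disc z) := by
      rw [map_mul, quadraticChar_sq_one' (intCast_ne_zero_of_not_dvd D.not_dvd), one_mul]
    have hsum := two_mul_sum_reps hq h𝒢 h𝒴 ha hb hab z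
    set X := ∑ G ∈ 𝒢, ∑ Y ∈ 𝒴, legendreSym q (Y 0 0) *
          (if IsRankOne (a : ZMod q) (z - tri (red q ((G : Matrix (Fin 2) (Fin 2) ℤ) * Y *
            (G : Matrix (Fin 2) (Fin 2) ℤ)ᵀ))) then 1 else 0) with hX
    rw [hLs, hR 1 one_ne_zero, hR (-1) (by norm_num), hβ,
      S.wt_rankOne hq (T.idem_of S (idempotentMod_one_q b)) (T.idem _ _) hb (T.red_one_q b) k D,
      S.wt_rankZero hq (T.idem_of S idempotentMod_one_one) (T.idem _ _) T.red_one_one k D,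
      T.awayCoeff_eq k 1 (q * b) 1 1, ← hc, ← hz]
    have haa : legendreSym q a * legendreSym q a = 1 := by
      rw [← pow_two, legendreSym.sq_one q (intCast_ne_zero_of_not_dvd ha)]
    set ψ := quadraticChar (ZMod q) (disc z) with hψ
    have hplus : (if ψ = 1 then ((1 : ℤ) : ℂ) * ((((q : ℂ) ^ k) ^ 2)⁻¹ * c) else 0) +
        (if ψ = -1 then ((-1 : ℤ) : ℂ) * ((((q : ℂ) ^ k) ^ 2)⁻¹ * c) else 0) =
        (ψ : ℂ) * ((((q : ℂ) ^ k) ^ 2)⁻¹ * c) ∧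
        (if ψ = 1 then ((1 : ℤ) : ℂ) * ((((q : ℂ) ^ k) ^ 2)⁻¹ * c) else 0) -
        (if ψ = -1 then ((-1 : ℤ) : ℂ) * ((((q : ℂ) ^ k) ^ 2)⁻¹ * c) else 0) =
        (ψ : ℂ) ^ 2 * ((((q : ℂ) ^ k) ^ 2)⁻¹ * c) := by
      have h3 : ψ = 0 ∨ ψ = 1 ∨ ψ = -1 := by
        by_cases hd : disc z = 0
        · left; rw [hψ, hd, quadraticChar_zero]
        · exact Or.inr (quadraticChar_dichotomy hd)
      rcases h3 with h | h | h <;> rw [h] <;> norm_num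
    rw [hplus.1, hplus.2]
    have hsumC := congrArg (Int.cast : ℤ → ℂ) hsum
    have habC := congrArg (Int.cast : ℤ → ℂ) hab
    have haaC := congrArg (Int.cast : ℤ → ℂ) haa
    push_cast at hsumC habC haaC ⊢
    rw [zpow_sub₀ hqC, zpow_one, zpow_natCast, pow_add, pow_add]
    have hpk : (q : ℂ) ^ k ≠ 0 := pow_ne_zero _ hqC
    have e1 : (if IsRankOne (b : ZMod q) z then
        (legendreSym q b : ℂ) * χ' (q : ZMod n') * ((q : ℂ) ^ k)⁻¹ * c else 0) =
        (legendreSym q b : ℂ) * χ' (q : ZMod n') * ((q : ℂ) ^ k)⁻¹ * c *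
          (if IsRankOne (b : ZMod q) z then 1 else 0) := by split_ifs <;> simp
    have e2 : (if z = 0 then c else 0) = c * (if z = 0 then 1 else 0) := by split_ifs <;> simp
    rw [e1, e2, habC]
    generalize (if IsRankOne (b : ZMod q) z then (1 : ℂ) else 0) = I1 at *
    generalize (if z = 0 then (1 : ℂ) else 0) = I2 at *
    generalize (q : ℂ) ^ k = p at *
    field_simp
    linear_combination χ' (q : ZMod n') * c * hsumC +
      2 * χ' (q : ZMod n') * c * q * (legendreSym q (-1) : ℂ) * I1 * haaC
  · have hz : ∀ {M₀ : Matrix (Fin 2) (Fin 2) ℤ}, TypeAt q M₀ → wt k χ (q * n) M₀ s = 0 :=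
      fun h => by
        by_contra hne
        exact hloc (S.exists_localDecomp_of_wt_ne_zero h hne)
    have h2 : ∀ e : ℤ, e ≠ 0 → ∑ α ∈ (Finset.range q).filter (fun α : ℕ => legendreSym q (α : ℤ) = e),
        wt k χ (q * n) (diagonal ![x q (q * α), y q (q * α)]) s = 0 := fun e he =>
      Finset.sum_eq_zero fun α hα => hz (.rankTwo α
        (not_dvd_of_legendreSym he (Finset.mem_filter.1 hα).2) (T.red_q_q _))
    rw [h2 1 one_ne_zero, h2 (-1) (by norm_num), hz (.rankZero T.red_one_one),
      hz (.rankOne b hb (T.red_one_q b)), Finset.sum_eq_zero]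
    · simp
    · intro G _
      refine Finset.sum_eq_zero fun Y hY => ?_
      rw [mul_eq_zero]
      right
      by_contra hne
      obtain ⟨M, N, Z, D⟩ := S.exists_localDecomp_of_wt_ne_zero
        (.rankOne a ha (T.red_one_q a)) hne
      have hW := conj_symm (G : Matrix (Fin 2) (Fin 2) ℤ) (h𝒴.1 Y hY)
      have := D.sub hq0 (W := -((G : Matrix (Fin 2) (Fin 2) ℤ) * Y *
        (G : Matrix (Fin 2) (Fin 2) ℤ)ᵀ)) (by rw [transpose_neg, hW])
      rw [divq_neg, sub_neg_eq_add, sub_add_cancel] at this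
      exact hloc ⟨_, _, _, this⟩

end Coefficients

/-! ### Characters and types modulo a square-free level -/

theorem dvd_of_forall_prime_dvd {n : ℕ} (hn : Squarefree n) {z : ℤ}
    (h : ∀ p : ℕ, p.Prime → p ∣ n → (p : ℤ) ∣ z) : (n : ℤ) ∣ z := by
  rw [Int.natCast_dvd, ← Nat.prod_primeFactors_of_squarefree hn]
  refine Finset.prod_primes_dvd _ (fun p hp => (Nat.prime_of_mem_primeFactors hp).prime) fun p hp => ?_
  exact Int.natCast_dvd.1 (h p (Nat.prime_of_mem_primeFactors hp) (Nat.dvd_of_mem_primeFactors hp))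

/-- The only nontrivial quadratic character modulo a prime is the Legendre symbol. -/
theorem legendreSym_eq_of_sq_eq_one {q : ℕ} [Fact q.Prime] {ψ : DirichletCharacter ℂ q}
    (hψ : ψ ^ 2 = 1) (hψ1 : ψ ≠ 1) (u : ℤ) : ψ (u : ZMod q) = (legendreSym q u : ℂ) := by
  have hsq : ∀ {w : ZMod q}, w ≠ 0 → IsSquare w → ψ w = 1 := by
    rintro w hw ⟨t, rfl⟩
    rw [map_mul, ← sq]
    exact char_sq_eq_one hψ (isUnit_iff_ne_zero.2 (left_ne_zero_of_mul hw))
  obtain ⟨a, ha⟩ := MulChar.ne_one_iff.1 hψ1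
  have ha' : ψ a = -1 :=
    (eq_or_eq_neg_of_sq_eq_sq _ _
      (by rw [char_sq_eq_one hψ a.isUnit, one_pow])).resolve_left ha
  by_cases hu : (u : ZMod q) = 0
  · rw [hu, MulChar.map_nonunit _ not_isUnit_zero, (legendreSym.eq_zero_iff q u).2 hu, Int.cast_zero]
  have hae : (a : ZMod q) ≠ 0 := a.ne_zero
  rcases legendreSym.eq_one_or_neg_one q hu with h | h
  · rw [h, hsq hu ((legendreSym.eq_one_iff q hu).1 h), Int.cast_one]
  · have hau : IsSquare ((a : ZMod q) * u) := by
      by_contra hcon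
      have hna : ¬ IsSquare (a : ZMod q) := fun hs => ha (hsq hae hs)
      have hnu : ¬ IsSquare (u : ZMod q) := (legendreSym.eq_neg_one_iff q).1 h
      rw [← quadraticChar_neg_one_iff_not_isSquare] at hcon hna hnu
      rw [map_mul, hna, hnu] at hcon
      norm_num at hcon
    have := hsq (mul_ne_zero hae hu) hau
    rw [map_mul, ha'] at this
    rw [h]
    push_cast
    linear_combination -this

/-- If the product of two characters with coprime moduli is quadratic, so is the first of them. -/
theorem sq_eq_one_of_mul_sq {m n : ℕ} (hmn : IsCoprime (m : ℤ) n) {ψ : DirichletCharacter ℂ m}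
    {ψ' : DirichletCharacter ℂ n}
    (hsq : ∀ u : ℤ, IsCoprime u m → IsCoprime u n →
      (ψ (u : ZMod m) * ψ' (u : ZMod n)) ^ 2 = 1) : ψ ^ 2 = 1 := by
  obtain ⟨a, b, hab⟩ := hmn
  ext u
  obtain ⟨w, hw⟩ := ZMod.intCast_surjective (u : ZMod m)
  -- an integer that is `w` modulo `m` and `1` modulo `n`
  have hm : ((a * m + w * (b * n) : ℤ) : ZMod m) = w := by
    rw [show a * m + w * (b * n) = w + m * (a * (1 - w)) by linear_combination w * hab]
    simp
  have hn : ((a * m + w * (b * n) : ℤ) : ZMod n) = 1 := by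
    rw [show a * m + w * (b * n) = 1 + n * (b * (w - 1)) by linear_combination hab]
    simp
  have hcm : IsCoprime (a * m + w * (b * n)) (m : ℤ) :=
    ((ZMod.coe_int_isUnit_iff_isCoprime _ _).1 (by rw [hm, hw]; exact u.isUnit)).symm
  have hcn : IsCoprime (a * m + w * (b * n)) (n : ℤ) :=
    ((ZMod.coe_int_isUnit_iff_isCoprime _ _).1 (by rw [hn]; exact isUnit_one)).symm
  have := hsq _ hcm hcn
  rwa [hm, hn, map_one, mul_one, hw, ← MulChar.pow_apply_coe, ← MulChar.one_apply_coe u] at this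

theorem CharSplit.of_changeLevel {N q : ℕ} [Fact q.Prime] (hN : Squarefree N) (hqN : q ∣ N)
    {χ : DirichletCharacter ℂ N} {χq : DirichletCharacter ℂ q} {χ' : DirichletCharacter ℂ (N / q)}
    (hχ : χ = DirichletCharacter.changeLevel hqN χq *
      DirichletCharacter.changeLevel (Nat.div_dvd_of_dvd hqN) χ')
    (hχ2 : χ ^ 2 = 1) (hχq : χq ≠ 1) : CharSplit q χ χ' := by
  have hmul : N = q * (N / q) := (Nat.mul_div_cancel' hqN).symm
  have hcop : q.Coprime (N / q) := Nat.coprime_of_squarefree_mul (hmul ▸ hN)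
  have hcop' := Nat.isCoprime_iff_coprime.2 hcop
  have hmul' : (N : ℤ) = q * ((N / q : ℕ) : ℤ) := by exact_mod_cast hmul
  have hval : ∀ u : ℤ, χ (u : ZMod N) = χq (u : ZMod q) * χ' (u : ZMod (N / q)) := by
    intro u
    by_cases hu : IsCoprime u N
    · rw [hχ, MulChar.mul_apply, DirichletCharacter.changeLevel_eq_cast_of_dvd' _ _ hu,
        DirichletCharacter.changeLevel_eq_cast_of_dvd' _ _ hu]
    · rw [(DirichletCharacter.apply_eq_zero_iff χ u).2 hu, eq_comm, mul_eq_zero,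
        DirichletCharacter.apply_eq_zero_iff, DirichletCharacter.apply_eq_zero_iff]
      by_contra! h
      exact hu (hmul' ▸ h.1.mul_right h.2)
  have hsq : ∀ u : ℤ, IsCoprime u (q : ℤ) → IsCoprime u ((N / q : ℕ) : ℤ) →
      (χq (u : ZMod q) * χ' (u : ZMod (N / q))) ^ 2 = 1 := by
    intro u hu hu'
    rw [← hval]
    exact char_sq_eq_one hχ2 ((ZMod.coe_int_isUnit_iff_isCoprime u N).2 (hmul' ▸ (hu.mul_right hu').symm))
  have hq2 : χq ^ 2 = 1 := sq_eq_one_of_mul_sq hcop' hsq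
  have hχ'2 : χ' ^ 2 = 1 := sq_eq_one_of_mul_sq hcop'.symm fun u hu hu' => by
    rw [mul_comm, hsq u hu' hu]
  exact
    { eq_mul := hmul
      coprime := hcop
      pos := Nat.pos_of_ne_zero fun h => hN.ne_zero (by rw [hmul, h, mul_zero])
      sq := hχ2
      sq' := hχ'2
      split := fun u => by rw [hval, legendreSym_eq_of_sq_eq_one hq2 hχq] }

/-- The types attached to the factorization of `N / q` form a family. -/
theorem exists_typeFamily {q N₀ N₁ N₂ n' : ℕ} (hn : Squarefree n') (hσ : N₀ * N₁ * N₂ = n')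
    {M : ℤ → ℤ → Matrix (Fin 2) (Fin 2) ℤ} (hM : ∀ a d : ℤ, IsTypeMatrix q N₀ N₁ N₂ a d (M a d)) :
    ∃ x y : ℤ → ℤ → ℤ, (∀ a d, M a d = diagonal ![x a d, y a d]) ∧ TypeFamily q n' x y := by
  choose x y hxy hmod h0 h1 h2 using hM
  have hmodp : ∀ {p : ℕ} {z w : ℤ}, z ≡ w [ZMOD p] → (z : ZMod p) = w := fun {p z w} h =>
    (ZMod.intCast_eq_intCast_iff z w p).2 h
  -- modulo each prime divisor of `n'` the pair is `(0, 0)`, `(1, 0)` or `(1, 1)`, always the same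
  have hcase : ∀ p : ℕ, p.Prime → p ∣ n' → ∃ e f : ZMod p, (e * e = e ∧ f * f = f ∧ e * f = f) ∧
      ∀ a d, (x a d : ZMod p) = e ∧ (y a d : ZMod p) = f := by
    intro p hp hpn
    rw [← hσ, hp.dvd_mul, hp.dvd_mul] at hpn
    rcases hpn with (hpn | hpn) | hpn
    · exact ⟨0, 0, by simp, fun a d => by
        simpa using And.intro (hmodp (h0 a d p hp hpn).1) (hmodp (h0 a d p hp hpn).2)⟩
    · exact ⟨1, 0, by simp, fun a d => by
        simpa using And.intro (hmodp (h1 a d p hp hpn).1) (hmodp (h1 a d p hp hpn).2)⟩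
    · exact ⟨1, 1, by simp, fun a d => by
        simpa using And.intro (hmodp (h2 a d p hp hpn).1) (hmodp (h2 a d p hp hpn).2)⟩
  have hglue : ∀ z w : ℤ, (∀ p : ℕ, p.Prime → p ∣ n' → (z : ZMod p) = w) → (z : ZMod n') = w := by
    intro z w h
    rw [ZMod.intCast_eq_intCast_iff_dvd_sub]
    exact dvd_of_forall_prime_dvd hn fun p hp hpn => by
      rw [← ZMod.intCast_eq_intCast_iff_dvd_sub]
      exact h p hp hpn
  have hm2 : ∀ {z w : ℤ}, z ≡ w [ZMOD (q : ℤ) ^ 2] → (z : ZMod (q ^ 2)) = w := fun {z w} h => by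
    refine hmodp ?_
    push_cast
    exact h
  refine ⟨x, y, hxy, fun a d => hm2 (hmod a d).1, fun a d => hm2 (hmod a d).2, fun a d => ?_,
    fun a d a' d' => ?_⟩
  · refine ⟨?_, ?_, ?_⟩
    · rw [← Int.cast_mul]
      refine hglue _ _ fun p hp hpn => ?_
      obtain ⟨e, f, he, h⟩ := hcase p hp hpn
      rw [Int.cast_mul, (h a d).1, he.1]
    · rw [← Int.cast_mul]
      refine hglue _ _ fun p hp hpn => ?_
      obtain ⟨e, f, he, h⟩ := hcase p hp hpn
      rw [Int.cast_mul, (h a d).2, he.2.1]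
    · rw [← Int.cast_mul]
      refine hglue _ _ fun p hp hpn => ?_
      obtain ⟨e, f, he, h⟩ := hcase p hp hpn
      rw [Int.cast_mul, (h a d).1, (h a d).2, he.2.2]
  · have hX : (x a d : ZMod n') = x a' d' := hglue _ _ fun p hp hpn => by
      obtain ⟨e, f, -, h⟩ := hcase p hp hpn
      rw [(h a d).1, (h a' d').1]
    have hY : (y a d : ZMod n') = y a' d' := hglue _ _ fun p hp hpn => by
      obtain ⟨e, f, -, h⟩ := hcase p hp hpn
      rw [(h a d).2, (h a' d').2]
    rw [red_diagonal, red_diagonal, hX, hY]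

end SiegelEis

/-! ### The twisted series -/

theorem proposition5p23
    (k N q : ℕ) [Fact q.Prime] (hk : 4 ≤ k)
    (hNodd : Odd N) (hNsq : Squarefree N) (hqN : q ∣ N)
    -- the character `χ` modulo `N` and its components modulo `q` and modulo `N / q`
    (χ : DirichletCharacter ℂ N) (χq : DirichletCharacter ℂ q)
    (χ' : DirichletCharacter ℂ (N / q))
    (hχ : χ = DirichletCharacter.changeLevel hqN χq *
      DirichletCharacter.changeLevel (Nat.div_dvd_of_dvd hqN) χ')
    (hχ2 : χ ^ 2 = 1) (hpar : χ (-1) = (-1) ^ k) (hχq : χq ≠ 1)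
    -- the partition `(N₀, N₁, N₂)` of `N / q`, and matrices of the corresponding types
    (N₀ N₁ N₂ : ℕ) (hσ : N₀ * N₁ * N₂ = N / q)
    (ω : ℤ) (hω : legendreSym q ω = -1)
    (M : ℤ → ℤ → Matrix (Fin 2) (Fin 2) ℤ)
    (hM : ∀ a d : ℤ, SiegelEis.IsTypeMatrix q N₀ N₁ N₂ a d (M a d))
    -- the representatives that are used in the definition of `A₁*(q)`
    (𝒢 : Finset (Matrix.SpecialLinearGroup (Fin 2) ℤ)) (h𝒢 : SiegelEis.IsCosetReps q 𝒢)
    (𝒴 : Finset (Matrix (Fin 2) (Fin 2) ℤ)) (h𝒴 : SiegelEis.IsSymmReps q 𝒴)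
    (ν ε : ℤ) (hν : ν = 1 ∨ ν = -1) (hε : ε = legendreSym q (-1))
    (τ : Matrix (Fin 2) (Fin 2) ℂ) (hτ : τ ∈ SiegelEis.upperHalfSpace) :
    (∀ a d : ℤ, Summable (SiegelEis.eisFamily k χ (q * N) (M a d) τ)) ∧
    SiegelEis.A1star k q 𝒢 𝒴 (SiegelEis.E12 k χ q M ω ν) τ =
      -((ν : ℂ) * (q : ℂ)) * SiegelEis.E12 k χ q M ω (ε * ν) τ
      + (ε : ℂ) * χ' (q : ZMod (N / q)) * (q : ℂ) ^ (1 - (k : ℤ)) * ((q : ℂ) ^ 2 - 1) / 2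
          * SiegelEis.E2 k χ q M τ
      + χ' (q : ZMod (N / q)) * (q : ℂ) ^ (k + 2) / 2
          * (SiegelEis.E02 k χ q M 1 τ + SiegelEis.E02 k χ q M (-1) τ)
      - (ε : ℂ) * χ' (q : ZMod (N / q)) * (q : ℂ) ^ (k + 1) / 2
          * (SiegelEis.E02 k χ q M 1 τ - SiegelEis.E02 k χ q M (-1) τ) := by
  have hq2 : q ≠ 2 := by
    rintro rfl
    exact (Nat.not_even_iff_odd.2 hNodd) (even_iff_two_dvd.2 hqN)
  have S := SiegelEis.CharSplit.of_changeLevel hNsq hqN hχ hχ2 hχq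
  obtain ⟨x, y, hxy, T⟩ := SiegelEis.exists_typeFamily
    (hNsq.squarefree_of_dvd (Nat.div_dvd_of_dvd hqN)) hσ hM
  refine ⟨fun a d => SiegelEis.summable_eisFamily hk χ (by rw [hxy]; exact diagonal_transpose _) hτ,
    ?_⟩
  -- the second diagonal entry of the matrix defining `𝔼_{1,2,e}` is `q * A e`
  let A : ℤ → ℤ := fun e => if e = 1 then 1 else ω
  have hA : ∀ e : ℤ, (if e = 1 then (q : ℤ) else (q : ℤ) * ω) = q * A e := fun e => by
    simp only [A]; split_ifs <;> simp
  have hleg : ∀ e : ℤ, e = 1 ∨ e = -1 → legendreSym q (A e) = e := by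
    rintro e (rfl | rfl)
    · simp [A, legendreSym.at_one]
    · simpa [A] using hω
  have hε1 : ε = 1 ∨ ε = -1 := hε ▸ legendreSym.eq_one_or_neg_one q (by simp)
  have hεν : ε * ν = 1 ∨ ε * ν = -1 := by
    rcases hε1 with h | h <;> rcases hν with h' | h' <;> simp [h, h']
  have hne : ∀ e : ℤ, e = 1 ∨ e = -1 → e ≠ 0 := by rintro e (rfl | rfl) <;> norm_num
  have hnd : ∀ e : ℤ, e = 1 ∨ e = -1 → ¬ (q : ℤ) ∣ A e := fun e he =>
    SiegelEis.not_dvd_of_legendreSym (hne e he) (hleg e he)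
  -- every Eisenstein series that occurs is a series over the slopes
  have hsum : ∀ {a d : ℤ}, SiegelEis.IdempotentMod q a d →
      SiegelEis.TypeAt q (diagonal ![x a d, y a d]) →
      HasSum (fun s => SiegelEis.wt k χ (q * N) (diagonal ![x a d, y a d]) s *
        ((τ + SiegelEis.symC s).det ^ k)⁻¹) (SiegelEis.eisenstein k χ (q * N) (M a d) τ) := by
    intro a d hi ht
    obtain ⟨h, h'⟩ := SiegelEis.eisenstein_eq_tsum hk hχ2 hpar (dvd_mul_left N q) (T.idem_of S hi)
      (S.det_pairM_ne_zero ht) hτ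
    rw [hxy, h']
    exact h.hasSum
  have h12 : ∀ e : ℤ, e = 1 ∨ e = -1 → SiegelEis.TypeAt q (diagonal ![x 1 (q * A e), y 1 (q * A e)]) :=
    fun e he => .rankOne (A e) (hnd e he) (T.red_one_q _)
  have hE12 := hsum (SiegelEis.idempotentMod_one_q (A (ε * ν))) (h12 _ hεν)
  have hE2 := hsum SiegelEis.idempotentMod_one_one (.rankZero T.red_one_one)
  have hE02 : ∀ e : ℤ, e = 1 ∨ e = -1 → HasSum (fun s =>
      (∑ α ∈ (Finset.range q).filter (fun α : ℕ => legendreSym q (α : ℤ) = e),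
        SiegelEis.wt k χ (q * N) (diagonal ![x q (q * α), y q (q * α)]) s) *
        ((τ + SiegelEis.symC s).det ^ k)⁻¹) (SiegelEis.E02 k χ q M e τ) := by
    intro e he
    simp only [Finset.sum_mul]
    exact hasSum_sum fun α hα => hsum (SiegelEis.idempotentMod_q_q _)
      (.rankTwo α (SiegelEis.not_dvd_of_legendreSym (hne e he) (Finset.mem_filter.1 hα).2)
        (T.red_q_q _))
  have hL : HasSum (fun s => ∑ G ∈ 𝒢, ∑ Y ∈ 𝒴, ((legendreSym q (Y 0 0) : ℤ) : ℂ) *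
      (SiegelEis.wt k χ (q * N) (diagonal ![x 1 (q * A ν), y 1 (q * A ν)])
        (s - SiegelEis.divq q ((G : Matrix (Fin 2) (Fin 2) ℤ) * Y *
          (G : Matrix (Fin 2) (Fin 2) ℤ)ᵀ)) * ((τ + SiegelEis.symC s).det ^ k)⁻¹))
      (SiegelEis.A1star k q 𝒢 𝒴 (SiegelEis.E12 k χ q M ω ν) τ) := by
    refine hasSum_sum fun G _ => hasSum_sum fun Y hY => HasSum.mul_left _ ?_
    obtain ⟨h, h'⟩ := SiegelEis.slash_eisenstein hk hχ2 hpar (dvd_mul_left N q)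
      (T.idem_of S (SiegelEis.idempotentMod_one_q (A ν))) (S.det_pairM_ne_zero (h12 ν hν)) hτ G
      (h𝒴.1 Y hY)
    have hE : SiegelEis.E12 k χ q M ω ν = SiegelEis.eisenstein k χ (q * N)
        (diagonal ![x 1 (q * A ν), y 1 (q * A ν)]) := by
      funext τ'
      rw [SiegelEis.E12, hA, hxy]
    rw [hE, h']
    exact h.hasSum
  have hR := (((hE12.mul_left (-((ν : ℂ) * q))).add (hE2.mul_left ((ε : ℂ) * χ' (q : ZMod (N / q)) *
    (q : ℂ) ^ (1 - (k : ℤ)) * ((q : ℂ) ^ 2 - 1) / 2))).add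
    (((hE02 1 (.inl rfl)).add (hE02 (-1) (.inr rfl))).mul_left
      (χ' (q : ZMod (N / q)) * (q : ℂ) ^ (k + 2) / 2))).sub
    (((hE02 1 (.inl rfl)).sub (hE02 (-1) (.inr rfl))).mul_left
      ((ε : ℂ) * χ' (q : ZMod (N / q)) * (q : ℂ) ^ (k + 1) / 2))
  rw [← hA] at hR
  refine (hL.congr_fun ?_).unique hR
  intro s
  have h := S.twist_coeff hq2 T k h𝒢 h𝒴 (hnd ν hν) (hnd _ hεν)
    (by rw [hleg ν hν, hleg _ hεν, hε]) s
  rw [hleg ν hν, ← hε] at h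
  simp only [← mul_assoc, ← Finset.sum_mul]
  rw [h, ← hA]
  ring
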